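/- Let $m,n,N\ge 0$, and let $e_{i,j}$ be the elementary matrices of size $2m+2n+1$. Put $C=\operatorname{diag}(\alpha_m,\beta_n)$, $\alpha_m=\sum_{i=1}^{2m}e_{i,2m+1-i}$, $\beta_n=\sum_{i=1}^{2n+1}(-1)^{n+i-1}e_{i,2n+2-i}$, and $$J=\operatorname{diag}(0_{2m},J_0(\lambda)),\quad J_0(\lambda)=e_{1,2n+1}\lambda+b,\quad b=\sum_{i=1}^{2n}e_{i+1,i}.$$ All objects below are formal: their coefficients are formal power series in the times $t_1=x,t_3,\dots,t_{2N+1}$, and loops are formal Laurent series in $\lambda^{-1}$ in each order in $t$. For a loop $\xi=\sum_i\xi_i\lambda^i$ write $\xi_+=\sum_{i\ge0}\xi_i\lambda^i$, $\xi_-=\xi-\xi_+$, and $\langle\xi,\eta\rangle_{k}=\sum_i\operatorname{tr}(\xi_i\eta_{k-i})$. Let $G$ be the group of invertible loops $g$ with $g(\lambda)\,C\,g(-\lambda)^{t}\,C^{-1}=I$; let $G_+\subset G$ consist of the $g$ with only nonnegative powers of $\lambda$, and $G_-\subset G$ of the $g=I+\sum_{i<0}g_i\lambda^i$ with $\det g=1$.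 Let $f\in G_-$ be independent of $t$, let $W(t)=\exp\bigl(-\sum_{i=1}^{N+1}t_{2i-1}J^{2i-1}\bigr)$, and factor $W(t)f^{-1}=M(t)^{-1}E(t)$ with $M\in G_-$, $E\in G_+$. The tau function $\tau_f(t)$ is defined by $$S(W(t))\,S(f^{-1})=\tau_f(t)\,S(M(t)^{-1})\,S(E(t))$$ in the central extension of the loop group with Lie algebra cocycle $w(\xi,\eta)=\langle\partial_\lambda\xi,\eta\rangle_{-1}$, where $S$ (of a group element) denotes the natural lift of $G_\pm$. Concretely, the extension is the determinant extension on the negative half $H_-$ of the space of vector-valued loops: $S(g)=(g,P_-gP_-)$, and $(g,rq)=\det(r)\cdot(g,q)$. Let $V_{m,n}$ be the span of $$\mu_i=e_{i,2m+2n+1}+(-1)^{n+1}e_{2m+1,2m+1-i},\qquad \nu_i=(-1)^ne_{m+i,2m+2n+1}-e_{2m+1,m+1-i}\qquad(1\le i\le m),$$ $$\omega_i=-e_{2m+n+1-i,2m+n+i}-e_{2m+n+2-i,2m+n+1+i}\qquad(1\le i\le n),$$ and let $N^+$ be the group of matrices $\operatorname{diag}(I_{2m},D)$ with $D$ unipotent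 upper triangular. Let $u$ be the solution of the matrix constrained CKP hierarchy determined by $f$: define $q$ by $J+q=(MJM^{-1})_+$, and let $u$ be $V_{m,n}$-valued with $$\Delta\,(\partial_x+\operatorname{diag}(0_{2m},b)+q)\,\Delta^{-1}=\partial_x+\operatorname{diag}(0_{2m},b)+u$$ for some $N^+$-valued $\Delta$. Then $\tau_f(0)=1$; there is a unique $S=S(u,\lambda)$ that satisfies $[\partial_x+J+u,S]=0$ and is conjugate to $J$ by an element of $N^+G_-$; $u$ solves the matrix constrained CKP hierarchy, i.e. for $1\le j\le N+1$ there is $\eta$ with values in the Lie algebra of $N^+$ such that $$u_{t_{2j-1}}=\bigl[\partial_x+\operatorname{diag}(0_{2m},b)+u,\;S_{2j-1,0}(u)+\eta\bigr],$$ where $S_{2j-1,0}(u)$ is the coefficient of $\lambda^0$ in $S^{2j-1}(u,\lambda)$; and for all $1\le j,k\le N+1$ $$(\ln\tau_f)_{t_1t_{2j-1}}=\bigl\langle S^{2j-1}(u,\lambda),\,e_{2m+1,2m+2n+1}\bigr\rangle_{-1},$$ $$(\ln\tau_f)_{t_{2j-1}t_{2k-1}}=\bigl\langle S^{2j-1}(u,\lambda),\,\partial_\lambda\bigl(S^{2k-1}(u,\lambda)\bigr)_+\bigr\rangle_{-1}.$$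 -/

import Mathlib

open Matrix Filter

noncomputable section

namespace CKP

/-- Matrix indices `1, …, 2m+2n+1`, split into a block of size `2m` and a block of size `2n+1`. -/
abbrev Idx (m n : ℕ) := Fin (2 * m) ⊕ Fin (2 * n + 1)

/-- Formal power series in the times `t_1, t_3, …, t_{2N+1}`: the variable with index `i` is
`t_{2i+1}`. The variable with index `0` is `x = t_1`. -/
abbrev TSeries (N : ℕ) := MvPowerSeries (Fin (N + 1)) ℂ

/-- Formal power series in the times whose coefficients are formal Laurent series
`∑_{i ≤ i₀} ξ_i λ^i`, i.e. Laurent series in the variable `λ⁻¹`. -/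
abbrev Loop (N : ℕ) := MvPowerSeries (Fin (N + 1)) (LaurentSeries ℂ)

variable {m n N : ℕ}

/-! ### Operations on loops -/

/-- The coefficient of `λ^k`. (The Hahn series variable is `λ⁻¹`.) -/
def lamCoeff (k : ℤ) (a : Loop N) : TSeries N :=
  fun d => (MvPowerSeries.coeff d a).coeff (-k)

/-- The monomial `λ^k`. -/
def lamPow (k : ℤ) : Loop N := MvPowerSeries.C (HahnSeries.single (-k) 1)

/-- `a_+ = ∑_{i ≥ 0} a_i λ^i`. -/
def plusPart (a : Loop N) : Loop N :=
  fun d => HahnSeries.truncLT 1 (MvPowerSeries.coeff d a)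

/-- `a_- = ∑_{i < 0} a_i λ^i`. -/
def minusPart (a : Loop N) : Loop N := a - plusPart a

/-- The substitution `λ ↦ -λ`. -/
def lamNeg (a : Loop N) : Loop N := fun d =>
  { coeff := fun i => (-1 : ℂ) ^ i * (MvPowerSeries.coeff d a).coeff i
    isPWO_support' := (MvPowerSeries.coeff d a).isPWO_support.mono fun i hi => by
      simp only [Function.mem_support, HahnSeries.mem_support] at hi ⊢
      exact right_ne_zero_of_mul hi }

/-- `∂_λ`. With `z = λ⁻¹` this is `-z² ∂_z`. -/
def lamDeriv (a : Loop N) : Loop N := fun d =>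
  -(HahnSeries.single 2 1 * LaurentSeries.derivative ℂ (MvPowerSeries.coeff d a))

/-- Series in the times alone, regarded as loops that are constant in `λ`. -/
def constLoop : TSeries N →+* Loop N := MvPowerSeries.map HahnSeries.C

/-- The bilinear form `⟨ξ, η⟩_k = ∑_j tr(ξ_j η_{k-j})`, which is the coefficient of `λ^k`
in `tr(ξ η)`. -/
def pairing (k : ℤ) (ξ η : Matrix (Idx m n) (Idx m n) (Loop N)) : TSeries N :=
  lamCoeff k (ξ * η).trace

/-! ### The groups `G_±` -/

/-- `C_{m,n} = diag(α_m, β_n)`, where `α_m = ∑ e_{i,2m+1-i}` and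
`β_n = ∑ (-1)^{n+i-1} e_{i,2n+2-i}`. -/
def Cmat (m n N : ℕ) : Matrix (Idx m n) (Idx m n) (Loop N) :=
  fromBlocks (of fun i j => if j = i.rev then 1 else 0) 0 0
    (of fun i j => if j = i.rev then (-1) ^ (n + (i : ℕ)) else 0)

/-- The reality condition `σ(g(-λ)) = g(λ)` with `σ(Y) = (C Yᵗ C⁻¹)⁻¹`,
written as `g(λ) C g(-λ)ᵗ = C`. -/
def IsTwisted (g : Matrix (Idx m n) (Idx m n) (Loop N)) : Prop :=
  g * Cmat m n N * (g.map lamNeg)ᵀ = Cmat m n N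

/-- `g ∈ (G_{m,n})_-` (with parameters `t`): `g = I + ∑_{i<0} g_i λ^i`, `det g = 1`,
and `σ(g(-λ)) = g(λ)`. -/
def IsMinus (g : GL (Idx m n) (Loop N)) : Prop :=
  (∀ k : ℤ, 0 ≤ k → ∀ a b,
    lamCoeff k (g.val a b) = if k = 0 then (1 : Matrix (Idx m n) (Idx m n) (TSeries N)) a b else 0) ∧
  g.val.det = 1 ∧ IsTwisted g.val

/-- `g ∈ (G_{m,n})_+` (with parameters `t`): `g = ∑_{i≥0} g_i λ^i` and `σ(g(-λ)) = g(λ)`.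
No determinant condition is imposed: the vacuum sequence contains `J^{2n+1} = λ diag(0, I)`,
which is not traceless. -/
def IsPlus (g : GL (Idx m n) (Loop N)) : Prop :=
  (∀ k : ℤ, k < 0 → ∀ a b, lamCoeff k (g.val a b) = 0) ∧ IsTwisted g.val

/-- A loop that does not depend on the times. -/
def constTime : GL (Idx m n) (LaurentSeries ℂ) →* GL (Idx m n) (Loop N) :=
  Units.map (MvPowerSeries.C : LaurentSeries ℂ →+* Loop N).mapMatrix.toMonoidHom

/-! ### The vacuum sequence -/

/-- `diag(0_{2m}, b)` with `b = ∑ e_{i+1,i}`. -/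
def bMat (m n : ℕ) (A : Type*) [Zero A] [One A] : Matrix (Idx m n) (Idx m n) A :=
  fromBlocks 0 0 0 (of fun i j => if (i : ℕ) = (j : ℕ) + 1 then 1 else 0)

/-- `e_{2m+1,2m+2n+1}`. -/
def eMat (m n : ℕ) (A : Type*) [Zero A] [One A] : Matrix (Idx m n) (Idx m n) A :=
  Matrix.single (Sum.inr 0) (Sum.inr (Fin.last (2 * n))) 1

/-- `J = diag(0_{2m}, J_0)` with `J_0 = e_{1,2n+1} λ + b`. -/
def Jmat (m n N : ℕ) : Matrix (Idx m n) (Idx m n) (Loop N) :=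
  (lamPow 1 : Loop N) • eMat m n (Loop N) + bMat m n (Loop N)

/-- The exponential `∑_k X^k / k!` of a matrix all of whose entries have no constant term in `t`;
in each order in `t` only finitely many powers contribute. -/
def expT (X : Matrix (Idx m n) (Idx m n) (Loop N)) : Matrix (Idx m n) (Idx m n) (Loop N) :=
  of fun a b d => ∑ k ∈ Finset.range (d.degree + 1),
    ((k.factorial : ℂ)⁻¹) • MvPowerSeries.coeff d ((X ^ k) a b)

/-- The vacuum wave `W(t) = exp(-∑ t_{2i-1} J^{2i-1})`. -/
def vacuum (m n N : ℕ) : Matrix (Idx m n) (Idx m n) (Loop N) :=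
  expT (-∑ i : Fin (N + 1), (MvPowerSeries.X i : Loop N) • Jmat m n N ^ (2 * (i : ℕ) + 1))

/-- The factorization `W(t) f⁻¹ = M(t)⁻¹ E(t)` with `M ∈ (G_{m,n})_-`, `E ∈ (G_{m,n})_+`. -/
def IsFactorization (f : GL (Idx m n) (LaurentSeries ℂ)) (M E : GL (Idx m n) (Loop N)) : Prop :=
  IsMinus M ∧ IsPlus E ∧
    vacuum m n N * (constTime f⁻¹ : GL (Idx m n) (Loop N)).val = (M⁻¹).val * E.val

/-! ### The central extension

The central extension with Lie algebra cocycle `w(ξ, η) = ⟨ξ_λ, η⟩_{-1}` is realized in the usual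
way on the negative half `H_-` of the space of vector valued loops: an element over a loop `g` is
given by an operator `q` on `H_-` that differs from the compression `d(g) = P_- g P_-` by an operator
of finite rank (in each order in `t`), and `(g, q)`, `(g, r q)` differ by the central element
`det r`. For `X = ξ λ^k`, `Y = η λ^{-k}` one has
`tr([d(X), d(Y)] - d([X, Y])) = k tr(ξ η) = w(X, Y)`. -/

/-- A vector valued loop in `H_-`. -/
def IsNeg (v : Idx m n → Loop N) : Prop := ∀ a, plusPart (v a) = 0

/-- The compression `d(g) = P_- g P_-` of the multiplication operator `g`, as an operator
on `H_-`. -/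
def compress (g : Matrix (Idx m n) (Idx m n) (Loop N)) (v : Idx m n → Loop N) : Idx m n → Loop N :=
  fun a => minusPart ((g *ᵥ v) a)

/-- The basis vector `λ^{-(k+1)} e_b` of `H_-`. -/
def negBasis (p : ℕ × Idx m n) : Idx m n → Loop N := Pi.single p.2 (lamPow (-((p.1 : ℤ) + 1)))

/-- The matrix entries of an operator on `H_-` in the basis `negBasis`. -/
def opEntry (r : (Idx m n → Loop N) → (Idx m n → Loop N)) (p p' : ℕ × Idx m n) : TSeries N :=
  lamCoeff (-((p.1 : ℤ) + 1)) (r (negBasis p') p.2)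

/-- The operator `r` on `H_-` is, in each order in `t`, the identity plus an operator of finite
rank (only finitely many columns of `r - 1` are nonzero), and its determinant is `c`, the limit of
the determinants of the finite sections. -/
def HasDet (r : (Idx m n → Loop N) → (Idx m n → Loop N)) (c : TSeries N) : Prop :=
  (∀ d : Fin (N + 1) →₀ ℕ, ∃ K : ℕ, ∀ p : ℕ × Idx m n, K ≤ p.1 →
    ∀ a, MvPowerSeries.coeff d (r (negBasis p) a) = MvPowerSeries.coeff d (negBasis p a)) ∧
  ∀ d : Fin (N + 1) →₀ ℕ, ∀ᶠ K : ℕ in atTop,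
    MvPowerSeries.coeff d
      (Matrix.det (of fun p p' : Fin K × Idx m n =>
        opEntry r ((p.1 : ℕ), p.2) ((p'.1 : ℕ), p'.2))) = MvPowerSeries.coeff d c

/-- Representatives of elements of the centrally extended loop group: a loop together with an
operator on `H_-`. -/
@[ext] structure ExtLoop (m n N : ℕ) where
  loop : Matrix (Idx m n) (Idx m n) (Loop N)
  op : (Idx m n → Loop N) → (Idx m n → Loop N)

/-- The product in the central extension. -/
instance : Mul (ExtLoop m n N) := ⟨fun x y => ⟨x.loop * y.loop, x.op ∘ y.op⟩⟩

/-- The natural lift of elements of `G_+` and of `G_-`. On each of these two subgroups `d` is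
multiplicative. -/
def lift (g : Matrix (Idx m n) (Idx m n) (Loop N)) : ExtLoop m n N := ⟨g, compress g⟩

/-- `x = c · y` in the central extension, with `c` a central element: the two loops agree, and the
operators on `H_-` satisfy `x.op = r ∘ y.op` with `det r = c`. -/
def EqScalar (c : TSeries N) (x y : ExtLoop m n N) : Prop :=
  x.loop = y.loop ∧ ∃ r : (Idx m n → Loop N) → (Idx m n → Loop N),
    HasDet r c ∧ ∀ v, IsNeg v → x.op v = r (y.op v)

/-- `τ = τ_f` is the tau function of `f ∈ (G_{m,n})_-`: with `W(t) f⁻¹ = M(t)⁻¹ E(t)`,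
`S(W(t)) S(f⁻¹) = τ_f(t) S(M(t)⁻¹) S(E(t))`. -/
def IsTau (f : GL (Idx m n) (LaurentSeries ℂ)) (τ : TSeries N) : Prop :=
  ∃ M E : GL (Idx m n) (Loop N), IsFactorization f M E ∧
    EqScalar τ (lift (vacuum m n N) * lift (constTime f⁻¹ : GL (Idx m n) (Loop N)).val)
      (lift (M⁻¹).val * lift E.val)

/-- `(ln τ)_{t_{2i+1} t_{2j+1}}`, for a series `τ` with nonzero constant term. -/
def logDeriv₂ (i j : Fin (N + 1)) (τ : TSeries N) : TSeries N :=
  MvPowerSeries.pderiv ℂ i (τ⁻¹ * MvPowerSeries.pderiv ℂ j τ)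

/-! ### The phase space `V_{m,n}` and the hierarchy -/

/-- `μ_i = e_{i,2m+2n+1} + (-1)^{n+1} e_{2m+1,2m+1-i}`. -/
def muMat (m n N : ℕ) (i : Fin m) : Matrix (Idx m n) (Idx m n) (TSeries N) :=
  Matrix.single (Sum.inl ⟨i, by omega⟩) (Sum.inr (Fin.last (2 * n))) 1 +
    (-1) ^ (n + 1) • Matrix.single (Sum.inr 0) (Sum.inl ⟨2 * m - 1 - i, by omega⟩) 1

/-- `ν_i = (-1)^n e_{m+i,2m+2n+1} - e_{2m+1,m+1-i}`. -/
def nuMat (m n N : ℕ) (i : Fin m) : Matrix (Idx m n) (Idx m n) (TSeries N) :=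
  (-1) ^ n • Matrix.single (Sum.inl ⟨m + i, by omega⟩) (Sum.inr (Fin.last (2 * n))) 1 -
    Matrix.single (Sum.inr 0) (Sum.inl ⟨m - 1 - i, by omega⟩) 1

/-- `ω_i = -e_{2m+n+1-i,2m+n+i} - e_{2m+n+2-i,2m+n+1+i}`. -/
def omegaMat (m n N : ℕ) (i : Fin n) : Matrix (Idx m n) (Idx m n) (TSeries N) :=
  -Matrix.single (Sum.inr ⟨n - 1 - i, by omega⟩) (Sum.inr ⟨n + i, by omega⟩) 1 -
    Matrix.single (Sum.inr ⟨n - i, by omega⟩) (Sum.inr ⟨n + i + 1, by omega⟩) 1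

/-- `u` takes values in `V_{m,n}`: `u = ∑ q_i μ_i + ∑ r_{m+1-i} ν_i + ∑ u_i ω_i`. -/
def InV (u : Matrix (Idx m n) (Idx m n) (TSeries N)) : Prop :=
  ∃ (q r : Fin m → TSeries N) (v : Fin n → TSeries N),
    u = ∑ i, q i • muMat m n N i + ∑ i, r i.rev • nuMat m n N i + ∑ i, v i • omegaMat m n N i

/-- `Δ` takes values in `N^+`: `Δ = diag(I_{2m}, Δ_{22})` with `Δ_{22}` upper triangular with
`1` on the diagonal. -/
def InNplus (Δ : Matrix (Idx m n) (Idx m n) (TSeries N)) : Prop :=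
  ∃ D : Matrix (Fin (2 * n + 1)) (Fin (2 * n + 1)) (TSeries N),
    (∀ i, D i i = 1) ∧ (∀ i j, j < i → D i j = 0) ∧ Δ = fromBlocks 1 0 0 D

/-- `η` takes values in the Lie algebra of `N^+`: `η = diag(0_{2m}, η_{22})` with `η_{22}` strictly
upper triangular. -/
def InLieNplus (η : Matrix (Idx m n) (Idx m n) (TSeries N)) : Prop :=
  ∃ D : Matrix (Fin (2 * n + 1)) (Fin (2 * n + 1)) (TSeries N),
    (∀ i j, j ≤ i → D i j = 0) ∧ η = fromBlocks 0 0 0 D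

/-- `u = Δ ∗ q`: `Δ (∂_x + diag(0, b) + q) Δ⁻¹ = ∂_x + diag(0, b) + u`. -/
def IsGauge (Δ q u : Matrix (Idx m n) (Idx m n) (TSeries N)) : Prop :=
  Δ * (bMat m n _ + q) = Δ.map (MvPowerSeries.pderiv ℂ 0) + (bMat m n _ + u) * Δ

/-- `u` is the solution determined by `f ∈ (G_{m,n})_-`: with `W(t) f⁻¹ = M(t)⁻¹ E(t)` and
`J + q = (M J M⁻¹)_+`, it is the representative `u = Δ ∗ q` of `q` in `V_{m,n}`, `Δ ∈ N^+`. -/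
def IsSolutionOf (f : GL (Idx m n) (LaurentSeries ℂ))
    (u : Matrix (Idx m n) (Idx m n) (TSeries N)) : Prop :=
  ∃ (M E : GL (Idx m n) (Loop N)) (q Δ : Matrix (Idx m n) (Idx m n) (TSeries N)),
    IsFactorization f M E ∧
    Jmat m n N + q.map constLoop = (M.val * Jmat m n N * (M⁻¹).val).map plusPart ∧
    InNplus Δ ∧ InV u ∧ IsGauge Δ q u

/-- `S = S(u, λ)`: `[∂_x + J + u, S] = 0`, and `S` is conjugate to `J` by an element of
`N^+ (G_{m,n})_-`. -/
def IsS (u : Matrix (Idx m n) (Idx m n) (TSeries N))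
    (S : Matrix (Idx m n) (Idx m n) (Loop N)) : Prop :=
  S.map (MvPowerSeries.pderiv (LaurentSeries ℂ) 0) +
      ((Jmat m n N + u.map constLoop) * S - S * (Jmat m n N + u.map constLoop)) = 0 ∧
  ∃ (Δ : Matrix (Idx m n) (Idx m n) (TSeries N)) (M : GL (Idx m n) (Loop N)),
    InNplus Δ ∧ IsMinus M ∧
    S * (Δ.map constLoop * M.val) = Δ.map constLoop * M.val * Jmat m n N

/-- `u` solves the hierarchy, where `S = S(u, λ)`: for each time `t = t_{2j+1}` there is `η` with
values in the Lie algebra of `N^+` such that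
`u_t = [∂_x + diag(0, b) + u, S_{2j+1,0}(u) + η]`, with `S_{2j+1,0}(u)` the coefficient of `λ^0` in
`S^{2j+1}`. (As `u`, hence `u_t`, takes values in `V_{m,n}`, so does the commutator.) -/
def SolvesHierarchy (u : Matrix (Idx m n) (Idx m n) (TSeries N))
    (S : Matrix (Idx m n) (Idx m n) (Loop N)) : Prop :=
  InV u ∧ ∀ j : Fin (N + 1), ∃ η : Matrix (Idx m n) (Idx m n) (TSeries N), InLieNplus η ∧
    ∃ B : Matrix (Idx m n) (Idx m n) (TSeries N),
      B = (S ^ (2 * (j : ℕ) + 1)).map (lamCoeff 0) + η ∧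
      u.map (MvPowerSeries.pderiv ℂ j) =
        B.map (MvPowerSeries.pderiv ℂ 0) + ((bMat m n _ + u) * B - B * (bMat m n _ + u))

end CKP

end

/-!
Differentiating `W f⁻¹ = M⁻¹ E` gives, with `L = M J M⁻¹`, the flows `M_t = (L^{2j+1})_- M` and
`E_t = -(L^{2j+1})_+ E` for `t = t_{2j+1}`. Hence `S = Δ L Δ⁻¹` commutes with `∂_x + J + u`, and
`Δ E` is a common fundamental solution of `∂_x + J + u` and `∂_t + (S^{2j+1})_+ - Δ_t Δ⁻¹`, whose
zero curvature equation at `λ^0` is the hierarchy. If `S'` is another candidate and `Q = Δ M`, then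
`T = Q⁻¹ S' Q` is `J` plus terms of lower principal degree and `T_x = -[J, T]`. Since `ad J` is
semisimple, this equation lowers the degree of `[J, T]` indefinitely, so `[J, T] = 0`, and
`T^{2n+2} = λ T` then forces `T = J`.

With `d(g) = P_- g P_-` and `a = M⁻¹ E`, the definition of the tau function says that
`τ = det (d(a) d(a⁻¹))`, a limit of determinants of finite sections. As `a_t = -J^{2j+1} a`,
Jacobi's formula gives `(ln τ)_t = tr (d(M)⁻¹ d(M J^{2j+1}) - d(J^{2j+1}))`, where counting powers
of `λ` evaluates the trace to `-⟨M⁻¹, ∂_λ (M J^{2j+1})⟩_{-1}`. One more derivative, computed from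
the flow of `M`, is `⟨L^{2j+1}, ∂_λ (L^{2k+1})_+⟩_{-1}`, and conjugation by `Δ`, which is constant
in `λ`, turns `L` into `S`. For `t_1` the factor `∂_λ S_+` is `∂_λ J = e_{2m+1,2m+2n+1}`.
-/

noncomputable section

open MvPowerSeries
open scoped Pointwise

namespace CKP

local notation "∂ₜ" => MvPowerSeries.pderiv (LaurentSeries ℂ)
local notation "∂ₛ" => MvPowerSeries.pderiv ℂ

variable {m n N : ℕ}

/- Shortcut instances: the search for these goes a long way through the function type underlying
`MvPowerSeries`. -/
instance (priority := 2000) instCommRingLoop : CommRing (Loop N) := inferInstance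

instance (priority := 2000) instCommRingTSeries : CommRing (TSeries N) := inferInstance

/- `Derivation ℤ (Loop N) (Loop N)` must use the `ℤ`-algebra structure that every ring has. -/
instance (priority := 2000) instIntAlgebraLoop : Algebra ℤ (Loop N) := Ring.toIntAlgebra _

/-! ### Coefficients of powers of `λ` -/

theorem coeff_lamCoeff (k : ℤ) (a : Loop N) (d : Fin (N + 1) →₀ ℕ) :
    coeff d (lamCoeff k a) = (coeff d a).coeff (-k) := rfl

theorem ext_lamCoeff {a b : Loop N} (h : ∀ k, lamCoeff k a = lamCoeff k b) : a = b := by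
  refine MvPowerSeries.ext fun d => HahnSeries.ext (funext fun i => ?_)
  simpa only [coeff_lamCoeff, neg_neg] using congrArg (coeff d) (h (-i))

@[simp] theorem lamCoeff_add (k : ℤ) (a b : Loop N) :
    lamCoeff k (a + b) = lamCoeff k a + lamCoeff k b := by
  ext d; simp [coeff_lamCoeff]

@[simp] theorem lamCoeff_zero (k : ℤ) : lamCoeff k (0 : Loop N) = 0 := by
  ext; simp [coeff_lamCoeff]

/-- `lamCoeff k` as a homomorphism of additive groups. -/
def lamCoeffHom (k : ℤ) : Loop N →+ TSeries N where
  toFun := lamCoeff k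
  map_zero' := lamCoeff_zero k
  map_add' := lamCoeff_add k

@[simp] theorem lamCoeff_neg (k : ℤ) (a : Loop N) : lamCoeff k (-a) = -lamCoeff k a :=
  map_neg (lamCoeffHom k) a

@[simp] theorem lamCoeff_sub (k : ℤ) (a b : Loop N) :
    lamCoeff k (a - b) = lamCoeff k a - lamCoeff k b :=
  map_sub (lamCoeffHom k) a b

theorem lamCoeff_sum {ι : Type*} (k : ℤ) (s : Finset ι) (f : ι → Loop N) :
    lamCoeff k (∑ i ∈ s, f i) = ∑ i ∈ s, lamCoeff k (f i) :=
  map_sum (lamCoeffHom k) f s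

theorem lamCoeff_plusPart (k : ℤ) (a : Loop N) :
    lamCoeff k (plusPart a) = if 0 ≤ k then lamCoeff k a else 0 := by
  ext d
  change (HahnSeries.truncLT 1 (coeff d a)).coeff (-k) = _
  rw [HahnSeries.coeff_truncLT]
  split_ifs <;> first | omega | rfl

theorem lamCoeff_minusPart (k : ℤ) (a : Loop N) :
    lamCoeff k (minusPart a) = if k < 0 then lamCoeff k a else 0 := by
  rw [minusPart, lamCoeff_sub, lamCoeff_plusPart]
  split_ifs <;> first | omega | simp

theorem lamCoeff_lamNeg (k : ℤ) (a : Loop N) :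
    lamCoeff k (lamNeg a) = (-1 : ℂ) ^ k • lamCoeff k a := by
  ext d
  change (-1 : ℂ) ^ (-k) * (coeff d a).coeff (-k) = _
  rw [coeff_smul, coeff_lamCoeff, _root_.zpow_neg, ← _root_.inv_zpow, inv_neg, inv_one]

theorem lamCoeff_lamDeriv (k : ℤ) (a : Loop N) :
    lamCoeff k (lamDeriv a) = (k + 1) • lamCoeff (k + 1) a := by
  ext d
  change (-(HahnSeries.single 2 1 * LaurentSeries.derivative ℂ (coeff d a))).coeff (-k) = _
  rw [HahnSeries.coeff_neg, HahnSeries.coeff_single_mul, LaurentSeries.derivative_apply,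
    LaurentSeries.hasseDeriv_coeff, map_zsmul, coeff_lamCoeff]
  simp only [Nat.cast_one, Ring.choose_one_right, one_mul]
  rw [show -k - 2 + 1 = -(k + 1) by ring, neg_zsmul, neg_neg]

theorem lamCoeff_pderiv (k : ℤ) (j : Fin (N + 1)) (a : Loop N) :
    lamCoeff k (∂ₜ j a) = ∂ₛ j (lamCoeff k a) := by
  ext d
  have succ_eq_C : (d j : LaurentSeries ℂ) + 1 = HahnSeries.C ((d j : ℂ) + 1) := by
    rw [map_add, map_one, map_natCast]
  rw [coeff_lamCoeff, coeff_pderiv, coeff_pderiv, coeff_lamCoeff, succ_eq_C, HahnSeries.C_apply,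
    HahnSeries.coeff_mul_single_zero]

theorem coeff_lamCoeff_mul (k : ℤ) (a b : Loop N) (d : Fin (N + 1) →₀ ℕ) :
    coeff d (lamCoeff k (a * b)) = ∑ p ∈ Finset.HasAntidiagonal.antidiagonal d,
      (coeff p.1 a * coeff p.2 b).coeff (-k) := by
  classical
  rw [coeff_lamCoeff, coeff_mul]
  exact map_sum (HahnSeries.coeff.addMonoidHom (-k)) _ _

theorem lamCoeff_mul_eq_zero {k : ℤ} {a b : Loop N}
    (h : ∀ i j, i + j = k → lamCoeff i a = 0 ∨ lamCoeff j b = 0) : lamCoeff k (a * b) = 0 := by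
  ext d
  rw [coeff_lamCoeff_mul, map_zero]
  refine Finset.sum_eq_zero fun p _ => ?_
  rw [HahnSeries.coeff_mul]
  refine Finset.sum_eq_zero fun q hq => ?_
  have sum_eq : q.1 + q.2 = -k := (Finset.mem_antidiagonal.mp hq).2.2
  rcases h (-q.1) (-q.2) (by omega) with ha | hb
  · have coeff_eq := congrArg (coeff p.1) ha
    rw [coeff_lamCoeff, neg_neg] at coeff_eq
    rw [coeff_eq, map_zero, zero_mul]
  · have coeff_eq := congrArg (coeff p.2) hb
    rw [coeff_lamCoeff, neg_neg] at coeff_eq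
    rw [coeff_eq, map_zero, mul_zero]

theorem lamCoeff_constLoop_mul (k : ℤ) (c : TSeries N) (a : Loop N) :
    lamCoeff k (constLoop c * a) = c * lamCoeff k a := by
  classical
  ext d
  rw [coeff_lamCoeff_mul, coeff_mul]
  refine Finset.sum_congr rfl fun p _ => ?_
  rw [constLoop, coeff_map, HahnSeries.C_apply, HahnSeries.coeff_single_zero_mul, coeff_lamCoeff]

theorem lamCoeff_lamPow_mul (k i : ℤ) (a : Loop N) :
    lamCoeff k (lamPow i * a) = lamCoeff (k - i) a := by
  ext d
  rw [lamPow, coeff_lamCoeff, coeff_C_mul, HahnSeries.coeff_single_mul, one_mul, coeff_lamCoeff]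
  congr 1; ring

theorem lamPow_add (i j : ℤ) : (lamPow (i + j) : Loop N) = lamPow i * lamPow j := by
  rw [lamPow, lamPow, lamPow, ← map_mul, HahnSeries.single_mul_single, mul_one, neg_add]

@[simp] theorem lamPow_zero : (lamPow 0 : Loop N) = 1 := by
  rw [lamPow, neg_zero, HahnSeries.single_zero_one, map_one]

theorem lamCoeff_one (k : ℤ) : lamCoeff k (1 : Loop N) = if k = 0 then 1 else 0 := by
  classical
  ext d
  rw [coeff_lamCoeff, coeff_one]
  split_ifs <;> simp_all [coeff_one, HahnSeries.coeff_one]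

theorem lamCoeff_constLoop (k : ℤ) (c : TSeries N) :
    lamCoeff k (constLoop c) = if k = 0 then c else 0 := by
  rw [← mul_one (constLoop c), lamCoeff_constLoop_mul, lamCoeff_one, mul_ite, mul_one, mul_zero]

theorem lamCoeff_lamPow (k i : ℤ) :
    lamCoeff k (lamPow i : Loop N) = if k = i then 1 else 0 := by
  rw [← mul_one (lamPow i), lamCoeff_lamPow_mul, lamCoeff_one]
  simp only [sub_eq_zero]

/-! ### Derivations -/

section Laurent

variable {R : Type*} [CommRing R]

/-- The Euler operator `z ∂_z` on Laurent series. Unlike `∂_z` it preserves the degree, so that its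
product rule can be read off from a single antidiagonal. -/
def laurentEuler (x : LaurentSeries R) : LaurentSeries R where
  coeff i := i • x.coeff i
  isPWO_support' := x.isPWO_support.mono fun i hi hx => hi <| by
    simp only [hx, smul_zero]

theorem support_laurentEuler_subset (x : LaurentSeries R) :
    (laurentEuler x).support ⊆ x.support := fun i hi hx => hi <| by
  simp only [laurentEuler, hx, smul_zero]

theorem laurentEuler_mul (x y : LaurentSeries R) :
    laurentEuler (x * y) = laurentEuler x * y + x * laurentEuler y := by
  ext k
  rw [HahnSeries.coeff_add,
    HahnSeries.coeff_mul_left' x.isPWO_support (support_laurentEuler_subset x),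
    HahnSeries.coeff_mul_right' y.isPWO_support (support_laurentEuler_subset y),
    ← Finset.sum_add_distrib]
  change k • (x * y).coeff k = _
  rw [HahnSeries.coeff_mul, Finset.smul_sum]
  refine Finset.sum_congr rfl fun p hp => ?_
  have sum_eq : p.1 + p.2 = k := (Finset.mem_antidiagonal.mp hp).2.2
  change _ = p.1 • x.coeff p.1 * y.coeff p.2 + x.coeff p.1 * (p.2 • y.coeff p.2)
  rw [smul_mul_assoc, mul_smul_comm, ← add_smul, sum_eq]

theorem laurent_derivative_eq (x : LaurentSeries R) :
    LaurentSeries.derivative R x = HahnSeries.single (-1) 1 * laurentEuler x := by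
  ext k
  rw [HahnSeries.coeff_single_mul, LaurentSeries.derivative_apply, LaurentSeries.hasseDeriv_coeff]
  simp [laurentEuler]

theorem laurent_derivative_mul (x y : LaurentSeries R) :
    LaurentSeries.derivative R (x * y) =
      LaurentSeries.derivative R x * y + x * LaurentSeries.derivative R y := by
  simp only [laurent_derivative_eq, laurentEuler_mul]
  ring

end Laurent

theorem lamDeriv_mul (a b : Loop N) : lamDeriv (a * b) = lamDeriv a * b + a * lamDeriv b := by
  classical
  ext1 d
  rw [map_add, coeff_mul, coeff_mul, ← Finset.sum_add_distrib]
  change -(HahnSeries.single 2 1 * LaurentSeries.derivative ℂ (coeff d (a * b))) = _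
  rw [coeff_mul, map_sum, Finset.mul_sum, ← Finset.sum_neg_distrib]
  refine Finset.sum_congr rfl fun p _ => ?_
  rw [laurent_derivative_mul, show ∀ c : Loop N, ∀ e, coeff e (lamDeriv c) =
    -(HahnSeries.single 2 1 * LaurentSeries.derivative ℂ (coeff e c)) from fun _ _ => rfl]
  change _ = _ + _ * -(HahnSeries.single 2 1 * LaurentSeries.derivative ℂ (coeff p.2 b))
  ring

/-- An additive map satisfying the product rule, as a derivation. -/
def derivationOfLeibniz {R : Type*} [CommRing R] (D : R →+ R)
    (h : ∀ a b, D (a * b) = D a * b + a * D b) : Derivation ℤ R R :=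
  Derivation.mk' D.toIntLinearMap fun a b => by
    change D (a * b) = a * D b + b * D a
    rw [h, add_comm, mul_comm b]

/-- `lamDeriv` as a derivation. -/
def lamDer : Derivation ℤ (Loop N) (Loop N) :=
  derivationOfLeibniz
    (AddMonoidHom.mk' lamDeriv fun a b => ext_lamCoeff fun k => by
      simp only [lamCoeff_lamDeriv, lamCoeff_add, smul_add])
    lamDeriv_mul

theorem lamCoeff_lamDer (k : ℤ) (a : Loop N) :
    lamCoeff k (lamDer a) = (k + 1) • lamCoeff (k + 1) a := lamCoeff_lamDeriv k a

theorem pderiv_lamDer (j : Fin (N + 1)) (a : Loop N) : ∂ₜ j (lamDer a) = lamDer (∂ₜ j a) :=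
  ext_lamCoeff fun k => by
    rw [lamCoeff_pderiv, lamCoeff_lamDer, lamCoeff_lamDer, lamCoeff_pderiv, map_zsmul]

theorem pderiv_constLoop (j : Fin (N + 1)) (c : TSeries N) :
    ∂ₜ j (constLoop c) = constLoop (∂ₛ j c) :=
  ext_lamCoeff fun k => by
    rw [lamCoeff_pderiv, lamCoeff_constLoop, lamCoeff_constLoop, apply_ite (∂ₛ j), map_zero]

theorem lamDer_constLoop (c : TSeries N) : lamDer (constLoop c) = 0 :=
  ext_lamCoeff fun k => by
    rw [lamCoeff_lamDer, lamCoeff_constLoop, lamCoeff_zero]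
    split_ifs with h <;> simp [h]

theorem pderiv_lamPow (j : Fin (N + 1)) (k : ℤ) : ∂ₜ j (lamPow k : Loop N) = 0 := pderiv_C

theorem pderiv_comm {σ R : Type*} [CommSemiring R] (i j : σ) (a : MvPowerSeries σ R) :
    pderiv R i (pderiv R j a) = pderiv R j (pderiv R i a) := by
  classical
  ext d
  simp only [coeff_pderiv, Finsupp.add_apply, Finsupp.single_apply,
    add_right_comm d (Finsupp.single i 1)]
  rcases eq_or_ne i j with rfl | hij
  · rfl
  · simp only [if_neg hij, if_neg hij.symm, add_zero]
    ring

/-! ### Derivations applied to matrices -/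

section MatrixDerivation

variable {A R ι κ ρ : Type*} [CommSemiring A] [CommRing R] [Algebra A R] (D : Derivation A R R)

theorem map_derivation_add (X Y : Matrix ι κ R) : (X + Y).map D = X.map D + Y.map D :=
  Matrix.map_add D (map_add D) X Y

theorem map_derivation_sub (X Y : Matrix ι κ R) : (X - Y).map D = X.map D - Y.map D :=
  Matrix.map_sub D (map_sub D) X Y

theorem map_derivation_mul [Fintype κ] (X : Matrix ι κ R) (Y : Matrix κ ρ R) :
    (X * Y).map D = X.map D * Y + X * Y.map D := by
  ext1 a c
  simp only [Matrix.map_apply, Matrix.mul_apply, Matrix.add_apply, map_sum, Derivation.leibniz,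
    smul_eq_mul, ← Finset.sum_add_distrib]
  exact Finset.sum_congr rfl fun b _ => by ring

theorem map_derivation_one [DecidableEq ι] : (1 : Matrix ι ι R).map D = 0 := by
  ext1 a b
  rw [Matrix.map_apply, Matrix.one_apply, apply_ite D, Derivation.map_one_eq_zero, map_zero,
    ite_self, Matrix.zero_apply]

theorem derivation_prod [DecidableEq ι] (s : Finset ι) (f : ι → R) :
    D (∏ i ∈ s, f i) = ∑ i ∈ s, (∏ j ∈ s.erase i, f j) * D (f i) := by
  induction s using Finset.induction_on with
  | empty => rw [Finset.prod_empty, Finset.sum_empty, Derivation.map_one_eq_zero]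
  | insert a s ha ih =>
    rw [Finset.prod_insert ha, Derivation.leibniz, ih, Finset.sum_insert ha,
      Finset.erase_insert ha, smul_eq_mul, smul_eq_mul, add_comm, Finset.mul_sum]
    congr 1
    refine Finset.sum_congr rfl fun i hi => ?_
    have hai : a ≠ i := fun h => ha (h ▸ hi)
    rw [Finset.erase_insert_of_ne hai, Finset.prod_insert (by simp [ha]), mul_assoc]

theorem trace_map_derivation [Fintype ι] (X : Matrix ι ι R) : (X.map D).trace = D X.trace :=
  (map_sum D _ _).symm

variable [Fintype ι] [DecidableEq ι]

theorem map_derivation_pow_of_commute {X : Matrix ι ι R} (h : Commute X (X.map D)) (k : ℕ) :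
    (X ^ (k + 1)).map D = (k + 1 : R) • (X ^ k * X.map D) := by
  induction k with
  | zero => simp
  | succ k ih =>
    rw [pow_succ, map_derivation_mul, ih, smul_mul_assoc, mul_assoc, ← h.eq, ← mul_assoc,
      ← pow_succ, Nat.cast_succ, add_smul (k + 1 : R) 1, one_smul]

theorem map_derivation_pow_eq_zero {X : Matrix ι ι R} (h : X.map D = 0) (k : ℕ) :
    (X ^ k).map D = 0 := by
  cases k with
  | zero => rw [pow_zero, map_derivation_one]
  | succ k =>
    rw [map_derivation_pow_of_commute D (h ▸ Commute.zero_right X), h, mul_zero, smul_zero]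

theorem map_derivation_mul_inv (g : GL ι R) :
    g.val.map D * (g⁻¹).val = -(g.val * (g⁻¹).val.map D) := by
  rw [eq_neg_iff_add_eq_zero, ← map_derivation_mul, Units.mul_inv, map_derivation_one]

theorem trace_adjugate_mul (X Y : Matrix ι ι R) :
    (X.adjugate * Y).trace = ∑ i, (X.updateCol i fun j => Y j i).det :=
  Finset.sum_congr rfl fun i _ => by
    rw [← Matrix.cramer_apply, Matrix.cramer_eq_adjugate_mulVec]
    rfl

/-- Jacobi's formula. -/
theorem derivation_det (X : Matrix ι ι R) : D X.det = (X.adjugate * X.map D).trace := by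
  rw [trace_adjugate_mul, Matrix.det_apply, map_sum]
  simp_rw [Matrix.det_apply]
  rw [Finset.sum_comm]
  refine Finset.sum_congr rfl fun σ _ => ?_
  rw [← Finset.smul_sum, Units.smul_def, map_zsmul, Units.smul_def, derivation_prod]
  congr 1
  refine Finset.sum_congr rfl fun i _ => ?_
  rw [← Finset.prod_erase_mul _ _ (Finset.mem_univ i), Matrix.updateCol_self]
  congr 1
  exact Finset.prod_congr rfl fun j hj => by
    rw [Matrix.updateCol_ne (Finset.ne_of_mem_erase hj)]

end MatrixDerivation

/-! ### Loops with prescribed powers of `λ` -/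

/-- The loops in which only powers `λ^k` with `k ∈ s` occur. -/
def lamSupp (s : Set ℤ) : AddSubgroup (Loop N) where
  carrier := {a | ∀ k ∉ s, lamCoeff k a = 0}
  add_mem' ha hb k hk := by rw [lamCoeff_add, ha k hk, hb k hk, add_zero]
  zero_mem' k _ := lamCoeff_zero k
  neg_mem' ha k hk := by rw [lamCoeff_neg, ha k hk, neg_zero]

section lamSupp

variable {s t u : Set ℤ} {a b : Loop N}

theorem lamSupp_mono (h : s ⊆ t) (ha : a ∈ lamSupp s) : a ∈ lamSupp t :=
  fun k hk => ha k fun hs => hk (h hs)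

theorem mul_mem_lamSupp (h : s + t ⊆ u) (ha : a ∈ lamSupp s) (hb : b ∈ lamSupp t) :
    a * b ∈ lamSupp u := by
  intro k hk
  refine lamCoeff_mul_eq_zero fun i j hij => ?_
  by_cases hi : i ∈ s
  · exact Or.inr (hb j fun hj => hk (hij ▸ h (Set.add_mem_add hi hj)))
  · exact Or.inl (ha i hi)

theorem eq_zero_of_mem_lamSupp (h : Disjoint s t) (hs : a ∈ lamSupp s) (ht : a ∈ lamSupp t) :
    a = 0 := by
  refine ext_lamCoeff fun k => ?_
  rw [lamCoeff_zero]
  by_cases hk : k ∈ s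
  · exact ht k (Set.disjoint_left.mp h hk)
  · exact hs k hk

theorem plusPart_mem (a : Loop N) : plusPart a ∈ lamSupp (Set.Ici 0) :=
  fun k hk => (lamCoeff_plusPart k a).trans (if_neg hk)

theorem minusPart_mem (a : Loop N) : minusPart a ∈ lamSupp (Set.Iio 0) :=
  fun k hk => (lamCoeff_minusPart k a).trans (if_neg hk)

theorem plusPart_add_minusPart (a : Loop N) : plusPart a + minusPart a = a :=
  add_sub_cancel _ _

theorem disjoint_Ici_Iio (k : ℤ) : Disjoint (Set.Ici k) (Set.Iio k) :=
  Set.disjoint_left.mpr fun _ h h' => (Set.mem_Ici.mp h).not_gt h'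

theorem plusPart_eq_self (h : a ∈ lamSupp (Set.Ici 0)) : plusPart a = a := by
  have minus_eq : minusPart a = 0 := eq_zero_of_mem_lamSupp (disjoint_Ici_Iio 0)
    (sub_mem h (plusPart_mem a)) (minusPart_mem a)
  exact (sub_eq_zero.mp minus_eq).symm

theorem plusPart_eq_zero (h : a ∈ lamSupp (Set.Iio 0)) : plusPart a = 0 := by
  refine eq_zero_of_mem_lamSupp (disjoint_Ici_Iio 0) (plusPart_mem a) ?_
  rw [← sub_sub_cancel a (plusPart a)]
  exact sub_mem h (minusPart_mem a)

theorem minusPart_eq_self (h : a ∈ lamSupp (Set.Iio 0)) : minusPart a = a := by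
  rw [minusPart, plusPart_eq_zero h, sub_zero]

theorem minusPart_eq_zero (h : a ∈ lamSupp (Set.Ici 0)) : minusPart a = 0 := by
  rw [minusPart, plusPart_eq_self h, sub_self]

/-- `minusPart` as a homomorphism of additive groups. -/
def minusHom : Loop N →+ Loop N :=
  AddMonoidHom.mk' minusPart fun a b => ext_lamCoeff fun k => by
    simp only [lamCoeff_minusPart, lamCoeff_add]
    split_ifs <;> simp

theorem minusPart_pderiv (j : Fin (N + 1)) (a : Loop N) :
    minusPart (∂ₜ j a) = ∂ₜ j (minusPart a) :=
  ext_lamCoeff fun k => by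
    rw [lamCoeff_pderiv, lamCoeff_minusPart, lamCoeff_minusPart, lamCoeff_pderiv,
      apply_ite (∂ₛ j), map_zero]

theorem pderiv_mem (j : Fin (N + 1)) (h : a ∈ lamSupp s) : ∂ₜ j a ∈ lamSupp s := by
  intro k hk
  rw [lamCoeff_pderiv, h k hk, map_zero]

theorem lamNeg_mem (h : a ∈ lamSupp s) : lamNeg a ∈ lamSupp s := by
  intro k hk
  rw [lamCoeff_lamNeg, h k hk, smul_zero]

theorem constLoop_mem (c : TSeries N) : constLoop c ∈ lamSupp (N := N) {0} :=
  fun k hk => (lamCoeff_constLoop k c).trans (if_neg hk)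

theorem lamPow_mem (i : ℤ) : lamPow i ∈ lamSupp (N := N) {i} :=
  fun k hk => (lamCoeff_lamPow k i).trans (if_neg hk)

theorem one_mem_lamSupp : (1 : Loop N) ∈ lamSupp (N := N) {0} := by
  rw [← lamPow_zero]; exact lamPow_mem 0

end lamSupp

/-! ### Matrices with prescribed powers of `λ` in each entry -/

section matSupp

variable {ι κ ρ : Type*}

/-- Matrices whose `(a, b)` entry contains only powers `λ^k` with `k ∈ s a b`. -/
def matSupp (s : ι → κ → Set ℤ) : AddSubgroup (Matrix ι κ (Loop N)) where
  carrier := {X | ∀ a b, X a b ∈ lamSupp (s a b)}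
  add_mem' hX hY a b := add_mem (hX a b) (hY a b)
  zero_mem' _ _ := zero_mem _
  neg_mem' hX a b := neg_mem (hX a b)

/-- Matrices all of whose entries contain only powers `λ^k` with `k ∈ s`. -/
abbrev unifSupp (s : Set ℤ) : AddSubgroup (Matrix ι κ (Loop N)) := matSupp fun _ _ => s

variable {s t u : ι → κ → Set ℤ} {X Y : Matrix ι κ (Loop N)}

theorem matSupp_mono (h : ∀ a b, s a b ⊆ t a b) (hX : X ∈ matSupp s) : X ∈ matSupp t :=
  fun a b => lamSupp_mono (h a b) (hX a b)

theorem unifSupp_mono {s t : Set ℤ} (h : s ⊆ t) (hX : X ∈ unifSupp s) : X ∈ unifSupp t :=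
  matSupp_mono (fun _ _ => h) hX

theorem mul_mem_matSupp [Fintype κ] {t : κ → ρ → Set ℤ} {u : ι → ρ → Set ℤ}
    {Y : Matrix κ ρ (Loop N)} (h : ∀ a b c, s a b + t b c ⊆ u a c) (hX : X ∈ matSupp s)
    (hY : Y ∈ matSupp t) : X * Y ∈ matSupp u := by
  intro a c
  rw [Matrix.mul_apply]
  exact sum_mem fun b _ => mul_mem_lamSupp (h a b c) (hX a b) (hY b c)

theorem mul_mem_unifSupp [Fintype κ] {s t u : Set ℤ} {Y : Matrix κ ρ (Loop N)} (h : s + t ⊆ u)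
    (hX : X ∈ unifSupp s) (hY : Y ∈ unifSupp t) : X * Y ∈ unifSupp u :=
  mul_mem_matSupp (fun _ _ _ => h) hX hY

theorem smul_mem_matSupp {s : Set ℤ} (h : ∀ a b, s + t a b ⊆ u a b) {c : Loop N}
    (hc : c ∈ lamSupp s) (hX : X ∈ matSupp t) : c • X ∈ matSupp u :=
  fun a b => mul_mem_lamSupp (h a b) hc (hX a b)

theorem one_mem_unifSupp [DecidableEq ι] : (1 : Matrix ι ι (Loop N)) ∈ unifSupp {0} := by
  intro a b
  rw [Matrix.one_apply]
  split_ifs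
  · exact one_mem_lamSupp
  · exact zero_mem _

theorem map_pderiv_mem (j : Fin (N + 1)) (h : X ∈ matSupp s) : X.map (∂ₜ j) ∈ matSupp s :=
  fun a b => pderiv_mem j (h a b)

theorem map_constLoop_mem (X : Matrix ι κ (TSeries N)) : X.map constLoop ∈ unifSupp {0} :=
  fun _ _ => constLoop_mem _

theorem map_plusPart_mem (X : Matrix ι κ (Loop N)) : X.map plusPart ∈ unifSupp (Set.Ici 0) :=
  fun _ _ => plusPart_mem _

theorem map_minusPart_mem (X : Matrix ι κ (Loop N)) : X.map minusPart ∈ unifSupp (Set.Iio 0) :=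
  fun _ _ => minusPart_mem _

theorem map_plusPart_add_map_minusPart (X : Matrix ι κ (Loop N)) :
    X.map plusPart + X.map minusPart = X :=
  Matrix.ext fun _ _ => plusPart_add_minusPart _

theorem eq_zero_of_mem_matSupp (h : ∀ a b, Disjoint (s a b) (t a b)) (hs : X ∈ matSupp s)
    (ht : X ∈ matSupp t) : X = 0 :=
  Matrix.ext fun a b => eq_zero_of_mem_lamSupp (h a b) (hs a b) (ht a b)

theorem eq_of_add_eq_add_of_mem_unifSupp {X' Y' : Matrix ι κ (Loop N)}
    (hX : X ∈ unifSupp (Set.Ici 0)) (hX' : X' ∈ unifSupp (Set.Ici 0))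
    (hY : Y ∈ unifSupp (Set.Iio 0)) (hY' : Y' ∈ unifSupp (Set.Iio 0))
    (h : X + Y = X' + Y') : X = X' ∧ Y = Y' := by
  have sub_eq : X - X' = Y' - Y := by rw [sub_eq_sub_iff_add_eq_add, h, add_comm]
  have sub_eq_zero' : X - X' = 0 := eq_zero_of_mem_matSupp (fun _ _ => disjoint_Ici_Iio 0)
    (sub_mem hX hX') (sub_eq ▸ sub_mem hY' hY)
  exact ⟨sub_eq_zero.mp sub_eq_zero', (sub_eq_zero.mp (sub_eq ▸ sub_eq_zero')).symm⟩

end matSupp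

/-! ### The twisted groups -/

section AntiDiagonal

variable {R : Type*} [CommRing R] {k : ℕ}

/-- The matrix `∑ c_i e_{i,k+1-i}`; both blocks of `Cmat` have this form. -/
def antiDiagonal (c : Fin k → R) : Matrix (Fin k) (Fin k) R :=
  of fun i j => if j = i.rev then c i else 0

theorem antiDiagonal_mul (c d : Fin k → R) :
    antiDiagonal c * antiDiagonal d = diagonal fun i => c i * d i.rev := by
  ext1 i j
  rw [Matrix.mul_apply, Finset.sum_eq_single i.rev]
  · simp [antiDiagonal, Matrix.diagonal_apply, eq_comm (a := i)]
  · intro l _ hl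
    simp [antiDiagonal, hl]
  · simp

end AntiDiagonal

theorem Cmat_eq_fromBlocks : Cmat m n N =
    fromBlocks (antiDiagonal fun _ => 1) 0 0 (antiDiagonal fun i => (-1) ^ (n + (i : ℕ))) := rfl

theorem Cmat_mul_self : Cmat m n N * Cmat m n N = 1 := by
  have sign_sq (i : Fin (2 * n + 1)) :
      (-1 : Loop N) ^ (n + (i : ℕ)) * (-1) ^ (n + (i.rev : ℕ)) = 1 := by
    rw [← pow_add, Fin.val_rev]
    exact Even.neg_one_pow ⟨2 * n, by omega⟩
  simp only [Cmat_eq_fromBlocks, fromBlocks_multiply, antiDiagonal_mul, sign_sq, mul_one,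
    Matrix.mul_zero, Matrix.zero_mul, add_zero, zero_add, diagonal_one, fromBlocks_one]

theorem antiDiagonal_mem {k : ℕ} {s : Set ℤ} {c : Fin k → Loop N} (hc : ∀ i, c i ∈ lamSupp s) :
    antiDiagonal c ∈ unifSupp s := by
  intro i j
  rw [antiDiagonal, of_apply]
  split_ifs
  · exact hc i
  · exact zero_mem _

theorem neg_one_pow_mem_lamSupp (k : ℕ) : (-1 : Loop N) ^ k ∈ lamSupp (N := N) {0} := by
  rcases neg_one_pow_eq_or (Loop N) k with h | h <;> rw [h]
  · exact one_mem_lamSupp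
  · exact neg_mem one_mem_lamSupp

theorem Cmat_mem : Cmat m n N ∈ unifSupp {0} := by
  rintro (a | a) (b | b)
  · exact antiDiagonal_mem (fun _ => one_mem_lamSupp) a b
  · exact zero_mem _
  · exact zero_mem _
  · exact antiDiagonal_mem (fun i => neg_one_pow_mem_lamSupp (n + i)) a b

theorem IsTwisted.inv_eq {g : GL (Idx m n) (Loop N)} (h : IsTwisted g.val) :
    (g⁻¹).val = Cmat m n N * (g.val.map lamNeg)ᵀ * Cmat m n N := by
  rw [Units.inv_eq_of_mul_eq_one_right]
  rw [← mul_assoc, ← mul_assoc, show g.val * Cmat m n N * _ = _ from h, Cmat_mul_self]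

theorem IsTwisted.inv_mem {g : GL (Idx m n) (Loop N)} (h : IsTwisted g.val) {s : Set ℤ}
    (hg : g.val ∈ unifSupp s) : (g⁻¹).val ∈ unifSupp s := by
  have lamNeg_transpose_mem : (g.val.map lamNeg)ᵀ ∈ unifSupp s := fun a b => lamNeg_mem (hg b a)
  rw [h.inv_eq]
  exact mul_mem_unifSupp (add_zero s).subset
    (mul_mem_unifSupp (zero_add s).subset Cmat_mem lamNeg_transpose_mem) Cmat_mem

theorem Iio_add_Iic_subset : Set.Iio (0 : ℤ) + Set.Iic 0 ⊆ Set.Iio 0 :=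
  Set.Iio_add_Iic_subset 0 0

theorem Iic_add_Iio_subset : Set.Iic (0 : ℤ) + Set.Iio 0 ⊆ Set.Iio 0 :=
  Set.Iic_add_Iio_subset 0 0

theorem Ici_add_Ici_subset : Set.Ici (0 : ℤ) + Set.Ici 0 ⊆ Set.Ici 0 :=
  Set.Ici_add_Ici_subset 0 0

theorem zero_subset_Iic : ({0} : Set ℤ) ⊆ Set.Iic 0 :=
  Set.singleton_subset_iff.mpr Set.self_mem_Iic

theorem zero_subset_Ici : ({0} : Set ℤ) ⊆ Set.Ici 0 :=
  Set.singleton_subset_iff.mpr Set.self_mem_Ici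

theorem mem_of_sub_one_mem {ι : Type*} [DecidableEq ι] {X : Matrix ι ι (Loop N)}
    (h : X - 1 ∈ unifSupp (Set.Iio 0)) : X ∈ unifSupp (Set.Iic 0) :=
  sub_add_cancel X 1 ▸ add_mem (unifSupp_mono Set.Iio_subset_Iic_self h)
    (unifSupp_mono zero_subset_Iic one_mem_unifSupp)

section Groups

variable {g : GL (Idx m n) (Loop N)}

theorem IsPlus.mem (h : IsPlus g) : g.val ∈ unifSupp (Set.Ici 0) :=
  fun a b k hk => h.1 k (not_le.mp hk) a b

theorem IsPlus.inv_mem (h : IsPlus g) : (g⁻¹).val ∈ unifSupp (Set.Ici 0) :=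
  h.2.inv_mem h.mem

theorem IsMinus.sub_one_mem (h : IsMinus g) : g.val - 1 ∈ unifSupp (Set.Iio 0) := by
  intro a b k hk
  rw [Matrix.sub_apply, lamCoeff_sub, h.1 k (not_lt.mp hk), Matrix.one_apply, Matrix.one_apply]
  split_ifs <;> simp_all [lamCoeff_one]

theorem IsMinus.mem (h : IsMinus g) : g.val ∈ unifSupp (Set.Iic 0) :=
  mem_of_sub_one_mem h.sub_one_mem

theorem IsMinus.inv_mem (h : IsMinus g) : (g⁻¹).val ∈ unifSupp (Set.Iic 0) :=
  h.2.2.inv_mem h.mem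

theorem IsMinus.inv_sub_one_mem (h : IsMinus g) : (g⁻¹).val - 1 ∈ unifSupp (Set.Iio 0) := by
  have inv_sub_one : (g⁻¹).val - 1 = -((g.val - 1) * (g⁻¹).val) := by
    rw [sub_mul, Units.mul_inv, one_mul, neg_sub]
  rw [inv_sub_one]
  exact neg_mem (mul_mem_unifSupp Iio_add_Iic_subset h.sub_one_mem h.inv_mem)

theorem IsMinus.map_pderiv_mem (h : IsMinus g) (j : Fin (N + 1)) :
    g.val.map (∂ₜ j) ∈ unifSupp (Set.Iio 0) := by
  rw [← sub_zero (g.val.map _), ← map_derivation_one (∂ₜ j), ← map_derivation_sub]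
  exact CKP.map_pderiv_mem j h.sub_one_mem

theorem IsMinus.mul_inv_sub_one_mem {g' : GL (Idx m n) (Loop N)} (h : IsMinus g)
    (h' : IsMinus g') : g.val * (g'⁻¹).val - 1 ∈ unifSupp (Set.Iio 0) := by
  have expand : g.val * (g'⁻¹).val - 1 =
      (g.val - 1) * (g'⁻¹).val + ((g'⁻¹).val - 1) := by
    rw [sub_mul, one_mul, sub_add_sub_cancel]
  rw [expand]
  exact add_mem (mul_mem_unifSupp Iio_add_Iic_subset h.sub_one_mem h'.inv_mem) h'.inv_sub_one_mem

theorem eq_of_inv_mul_eq_inv_mul {M E M' E' : GL (Idx m n) (Loop N)} (hM : IsMinus M)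
    (hE : IsPlus E) (hM' : IsMinus M') (hE' : IsPlus E') (h : M⁻¹ * E = M'⁻¹ * E') : M = M' := by
  have quotient_eq : M' * M⁻¹ = E' * E⁻¹ := by
    rw [eq_mul_inv_iff_mul_eq, mul_assoc, h, mul_inv_cancel_left]
  have quotient_mem : M'.val * (M⁻¹).val - 1 ∈ unifSupp (Set.Ici 0) := by
    rw [show M'.val * (M⁻¹).val = E'.val * (E⁻¹).val from congrArg Units.val quotient_eq]
    exact sub_mem (mul_mem_unifSupp Ici_add_Ici_subset hE'.mem hE.inv_mem)
      (unifSupp_mono zero_subset_Ici one_mem_unifSupp)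
  have quotient_sub_one : M'.val * (M⁻¹).val - 1 = 0 := eq_zero_of_mem_matSupp
    (fun _ _ => disjoint_Ici_Iio 0) quotient_mem (hM'.mul_inv_sub_one_mem hM)
  exact (mul_inv_eq_one.mp (Units.ext (sub_eq_zero.mp quotient_sub_one))).symm

end Groups

theorem IsFactorization.unique {f : GL (Idx m n) (LaurentSeries ℂ)}
    {M E M' E' : GL (Idx m n) (Loop N)} (h : IsFactorization f M E)
    (h' : IsFactorization f M' E') : M = M' ∧ E = E' := by
  have quotient_eq : M⁻¹ * E = M'⁻¹ * E' := Units.ext (h.2.2.symm.trans h'.2.2)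
  obtain rfl := eq_of_inv_mul_eq_inv_mul h.1 h.2.1 h'.1 h'.2.1 quotient_eq
  exact ⟨rfl, mul_left_cancel quotient_eq⟩

/-! ### Series of high order in the times -/

section TimesIdeal

variable {σ R : Type*} [CommRing R] {D D' : ℕ} {x y : MvPowerSeries σ R}

/-- The ideal of series without terms of degree less than `D`. -/
def tIdeal (σ R : Type*) [CommRing R] (D : ℕ) : Ideal (MvPowerSeries σ R) where
  carrier := {x | ∀ d : σ →₀ ℕ, d.degree < D → coeff d x = 0}
  add_mem' hx hy d hd := by rw [map_add, hx d hd, hy d hd, add_zero]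
  zero_mem' _ _ := map_zero _
  smul_mem' c x hx d hd := by
    classical
    rw [smul_eq_mul, coeff_mul]
    refine Finset.sum_eq_zero fun p hp => ?_
    rw [Finset.HasAntidiagonal.mem_antidiagonal] at hp
    have degree_le : p.2.degree ≤ d.degree := by rw [← hp, map_add]; omega
    rw [hx p.2 (degree_le.trans_lt hd), mul_zero]

theorem eq_zero_of_forall_mem_tIdeal (h : ∀ D, x ∈ tIdeal σ R D) : x = 0 := by
  ext d; exact h (d.degree + 1) d (Nat.lt_succ_self _)

theorem mem_tIdeal_zero (x : MvPowerSeries σ R) : x ∈ tIdeal σ R 0 :=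
  fun _ hd => absurd hd (Nat.not_lt_zero _)

theorem tIdeal_antitone : Antitone (tIdeal σ R) :=
  fun _ _ hDE _ hx d hd => hx d (hd.trans_le hDE)

theorem mem_tIdeal_one : x ∈ tIdeal σ R 1 ↔ constantCoeff x = 0 := by
  rw [← coeff_zero_eq_constantCoeff_apply]
  refine ⟨fun h => h 0 (by rw [map_zero]; exact one_pos), fun h d hd => ?_⟩
  rw [Nat.lt_one_iff, Finsupp.degree_eq_zero_iff] at hd
  rw [hd, h]

theorem pderiv_mem_tIdeal (j : σ) (h : x ∈ tIdeal σ R (D + 1)) : pderiv R j x ∈ tIdeal σ R D := by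
  intro d hd
  rw [coeff_pderiv, h _ (by rw [map_add, Finsupp.degree_single]; omega), zero_mul]

theorem mul_mem_tIdeal (hx : x ∈ tIdeal σ R D) (hy : y ∈ tIdeal σ R D') :
    x * y ∈ tIdeal σ R (D + D') := by
  classical
  intro d hd
  rw [coeff_mul]
  refine Finset.sum_eq_zero fun p hp => ?_
  rw [Finset.HasAntidiagonal.mem_antidiagonal] at hp
  have degree_add : p.1.degree + p.2.degree = d.degree := by rw [← hp, map_add]
  rcases lt_or_ge p.1.degree D with h | h
  · rw [hx _ h, zero_mul]
  · rw [hy _ (by omega), mul_zero]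

theorem matrix_pow_mem_tIdeal {ι : Type*} [Fintype ι] [DecidableEq ι]
    {X : Matrix ι ι (MvPowerSeries σ R)} (hX : ∀ a b, X a b ∈ tIdeal σ R 1) (k : ℕ) (a b : ι) :
    (X ^ k) a b ∈ tIdeal σ R k := by
  induction k generalizing a b with
  | zero => exact mem_tIdeal_zero _
  | succ k ih =>
    rw [pow_succ, Matrix.mul_apply]
    exact sum_mem fun c _ => mul_mem_tIdeal (ih a c) (hX c b)

end TimesIdeal

theorem lamCoeff_mem_tIdeal {D : ℕ} (k : ℤ) {x : Loop N} (h : x ∈ tIdeal _ _ D) :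
    lamCoeff k x ∈ tIdeal _ _ D := by
  intro d hd
  rw [coeff_lamCoeff, h d hd, HahnSeries.coeff_zero]

theorem mem_tIdeal_of_lamCoeff {D : ℕ} {x : Loop N} (h : ∀ k, lamCoeff k x ∈ tIdeal _ _ D) :
    x ∈ tIdeal _ _ D := by
  intro d hd
  ext i
  have coeff_eq := h (-i) d hd
  rwa [coeff_lamCoeff, neg_neg] at coeff_eq

/-! ### The vacuum wave -/

section ExpSum

variable {A R ι : Type*} [Field A] [CommRing R] [Algebra A R] [Fintype ι] [DecidableEq ι]

/-- The partial sum `∑_{k < K} X^k / k!` of the exponential series. -/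
def expSum (A : Type*) {R ι : Type*} [Field A] [CommRing R] [Algebra A R] [Fintype ι]
    [DecidableEq ι] (K : ℕ) (X : Matrix ι ι R) : Matrix ι ι R :=
  ∑ k ∈ Finset.range K, (k.factorial : A)⁻¹ • X ^ k

theorem map_derivation_expSum [CharZero A] (D : Derivation A R R) {X : Matrix ι ι R}
    (h : Commute X (X.map D)) (K : ℕ) :
    (expSum A (K + 1) X).map D = X.map D * expSum A K X := by
  have map_sum_eq : (expSum A (K + 1) X).map D =
      ∑ k ∈ Finset.range (K + 1), (k.factorial : A)⁻¹ • (X ^ k).map D := by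
    ext1 a b
    simp only [expSum, Matrix.map_apply, Matrix.sum_apply, map_sum, Matrix.smul_apply,
      Derivation.map_smul]
  rw [map_sum_eq, Finset.sum_range_succ', pow_zero, map_derivation_one, smul_zero, add_zero,
    expSum, Finset.mul_sum]
  refine Finset.sum_congr rfl fun k _ => ?_
  have succ_ne_zero : (k + 1 : A) ≠ 0 := Nat.cast_add_one_ne_zero k
  have cast_succ_smul : (k + 1 : R) • (X.map D * X ^ k) = (k + 1 : A) • (X.map D * X ^ k) := by
    rw [← algebraMap_smul R (k + 1 : A), map_add, map_natCast, map_one]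
  rw [map_derivation_pow_of_commute D h, (h.pow_left k).eq, cast_succ_smul, smul_smul,
    mul_smul_comm, Nat.factorial_succ, Nat.cast_mul, Nat.cast_add_one, mul_inv, mul_comm (_⁻¹),
    mul_assoc, inv_mul_cancel₀ succ_ne_zero, mul_one]

end ExpSum

instance : CharZero (LaurentSeries ℂ) :=
  charZero_of_injective_ringHom (HahnSeries.C (Γ := ℤ) (R := ℂ)).injective

section Exponential

variable {X : Matrix (Idx m n) (Idx m n) (Loop N)}

theorem coeff_expT (X : Matrix (Idx m n) (Idx m n) (Loop N)) (a b : Idx m n)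
    (d : Fin (N + 1) →₀ ℕ) : coeff d (expT X a b) =
      ∑ k ∈ Finset.range (d.degree + 1), (k.factorial : ℂ)⁻¹ • coeff d ((X ^ k) a b) := rfl

theorem coeff_expSum (K : ℕ) (X : Matrix (Idx m n) (Idx m n) (Loop N)) (a b : Idx m n)
    (d : Fin (N + 1) →₀ ℕ) : coeff d (expSum (LaurentSeries ℂ) K X a b) =
      ∑ k ∈ Finset.range K, (k.factorial : ℂ)⁻¹ • coeff d ((X ^ k) a b) := by
  rw [expSum, Matrix.sum_apply, map_sum]
  refine Finset.sum_congr rfl fun k _ => ?_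
  rw [Matrix.smul_apply, coeff_smul, ← HahnSeries.C_mul_eq_smul, map_inv₀, map_natCast]

theorem expT_sub_expSum_mem (hX : ∀ a b, X a b ∈ tIdeal _ (LaurentSeries ℂ) 1) (K : ℕ)
    (a b : Idx m n) :
    expT X a b - expSum (LaurentSeries ℂ) K X a b ∈ tIdeal _ (LaurentSeries ℂ) K := by
  intro d hd
  rw [map_sub, coeff_expT, coeff_expSum, sub_eq_zero]
  refine Finset.sum_subset (Finset.range_mono (Nat.succ_le_of_lt hd)) fun k _ hk => ?_
  have degree_lt : d.degree < k := by rwa [Finset.mem_range, not_lt] at hk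
  rw [matrix_pow_mem_tIdeal hX k a b d degree_lt, smul_zero]

theorem map_pderiv_expT (j : Fin (N + 1)) (hX₀ : ∀ a b, X a b ∈ tIdeal _ (LaurentSeries ℂ) 1)
    (hX : Commute X (X.map (∂ₜ j))) : (expT X).map (∂ₜ j) = X.map (∂ₜ j) * expT X := by
  ext1 a b
  rw [← sub_eq_zero]
  refine eq_zero_of_forall_mem_tIdeal fun D => ?_
  have left_mem : ((expT X).map (∂ₜ j)) a b -
      ((expSum (LaurentSeries ℂ) (D + 1) X).map (∂ₜ j)) a b ∈ tIdeal _ (LaurentSeries ℂ) D := by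
    rw [Matrix.map_apply, Matrix.map_apply, ← map_sub]
    exact pderiv_mem_tIdeal j (expT_sub_expSum_mem hX₀ (D + 1) a b)
  have right_mem : (X.map (∂ₜ j) * expT X) a b -
      (X.map (∂ₜ j) * expSum (LaurentSeries ℂ) D X) a b ∈ tIdeal _ (LaurentSeries ℂ) D := by
    rw [← Matrix.sub_apply, ← mul_sub, Matrix.mul_apply]
    exact sum_mem fun c _ => Ideal.mul_mem_left _ _ (expT_sub_expSum_mem hX₀ D c b)
  rw [map_derivation_expSum _ hX] at left_mem
  simpa only [sub_sub_sub_cancel_right] using sub_mem left_mem right_mem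

end Exponential

theorem map_pderiv_Jmat (j : Fin (N + 1)) : (Jmat m n N).map (∂ₜ j) = 0 := by
  have pderiv_ite (p : Prop) [Decidable p] : ∂ₜ j (if p then (1 : Loop N) else 0) = 0 := by
    rw [apply_ite (∂ₜ j), map_zero, Derivation.map_one_eq_zero, ite_self]
  have map_e : ((lamPow 1 : Loop N) • eMat m n (Loop N)).map (∂ₜ j) = 0 := by
    ext1 a b
    rw [Matrix.map_apply, Matrix.smul_apply, smul_eq_mul, Derivation.leibniz, pderiv_lamPow, eMat,
      Matrix.single_apply, pderiv_ite, smul_zero, smul_zero, add_zero, Matrix.zero_apply]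
  have map_b : (bMat m n (Loop N)).map (∂ₜ j) = 0 := by
    rw [bMat, fromBlocks_map, ← fromBlocks_zero]
    congr 1 <;> ext1 a b
    · exact map_zero (∂ₜ j)
    · exact map_zero (∂ₜ j)
    · exact map_zero (∂ₜ j)
    · exact pderiv_ite _
  rw [Jmat, map_derivation_add, map_e, map_b, add_zero]

theorem pderiv_X (i j : Fin (N + 1)) : ∂ₜ j (X i : Loop N) = if i = j then 1 else 0 := by
  split_ifs with h
  · rw [h, pderiv_X_self]
  · exact pderiv_X_of_ne h

/-- The exponent of the vacuum wave. -/
def vacuumExponent (m n N : ℕ) : Matrix (Idx m n) (Idx m n) (Loop N) :=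
  -∑ i : Fin (N + 1), (X i : Loop N) • Jmat m n N ^ (2 * (i : ℕ) + 1)

theorem vacuumExponent_mem_tIdeal (a b : Idx m n) :
    vacuumExponent m n N a b ∈ tIdeal _ _ 1 := by
  rw [vacuumExponent, Matrix.neg_apply, Matrix.sum_apply]
  exact neg_mem (sum_mem fun i _ =>
    Ideal.mul_mem_right _ _ (mem_tIdeal_one.mpr (constantCoeff_X i)))

theorem map_pderiv_vacuumExponent (j : Fin (N + 1)) :
    (vacuumExponent m n N).map (∂ₜ j) = -Jmat m n N ^ (2 * (j : ℕ) + 1) := by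
  have pderiv_Jmat_pow (k : ℕ) (a b : Idx m n) : ∂ₜ j ((Jmat m n N ^ k) a b) = 0 :=
    congrFun₂ (map_derivation_pow_eq_zero _ (map_pderiv_Jmat j) k) a b
  ext1 a b
  simp only [vacuumExponent, Matrix.map_apply, Matrix.neg_apply, Matrix.sum_apply,
    Matrix.smul_apply, smul_eq_mul, map_neg, map_sum, Derivation.leibniz, pderiv_Jmat_pow,
    pderiv_X, mul_zero, zero_add, mul_ite, mul_one, Finset.sum_ite_eq', Finset.mem_univ, if_true]

theorem commute_vacuumExponent_Jmat : Commute (vacuumExponent m n N) (Jmat m n N) :=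
  (Commute.sum_left _ _ _ fun i _ =>
    ((Commute.refl _).pow_left _).smul_left (X i : Loop N)).neg_left

theorem map_pderiv_vacuum (j : Fin (N + 1)) :
    (vacuum m n N).map (∂ₜ j) = -(Jmat m n N ^ (2 * (j : ℕ) + 1) * vacuum m n N) := by
  have exponent_commute : Commute (vacuumExponent m n N) ((vacuumExponent m n N).map (∂ₜ j)) := by
    rw [map_pderiv_vacuumExponent]
    exact (commute_vacuumExponent_Jmat.pow_right _).neg_right
  have map_exp := map_pderiv_expT j vacuumExponent_mem_tIdeal exponent_commute
  rwa [map_pderiv_vacuumExponent, neg_mul] at map_exp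

theorem constantCoeff_vacuum (a b : Idx m n) : constantCoeff (vacuum m n N a b) =
    (1 : Matrix (Idx m n) (Idx m n) (LaurentSeries ℂ)) a b := by
  rw [← coeff_zero_eq_constantCoeff_apply, vacuum, coeff_expT, map_zero, zero_add,
    Finset.sum_range_one, pow_zero, Matrix.one_apply, Matrix.one_apply]
  split_ifs <;> simp

/-! ### The flows of the factors -/

section Flows

variable {A R ι : Type*} [CommSemiring A] [CommRing R] [Algebra A R] [Fintype ι] [DecidableEq ι]

theorem map_derivation_inv (D : Derivation A R R) (g : GL ι R) :
    (g⁻¹).val.map D = -((g⁻¹).val * g.val.map D * (g⁻¹).val) := by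
  rw [mul_assoc, map_derivation_mul_inv, mul_neg, neg_neg, ← mul_assoc, Units.inv_mul, one_mul]

theorem neg_add_of_map_derivation_quotient (D : Derivation A R R) {M E : GL ι R}
    {P : Matrix ι ι R} (h : ((M⁻¹).val * E.val).map D = -(P * ((M⁻¹).val * E.val))) :
    -(E.val.map D * (E⁻¹).val) + M.val.map D * (M⁻¹).val = M.val * P * (M⁻¹).val := by
  have map_E : E.val.map D = (M.val.map D * (M⁻¹).val - M.val * P * (M⁻¹).val) * E.val := by
    calc E.val.map D = (M.val * ((M⁻¹).val * E.val)).map D := by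
          rw [← mul_assoc, Units.mul_inv, one_mul]
      _ = _ := by rw [map_derivation_mul, h]; noncomm_ring
  rw [map_E, mul_assoc, Units.mul_inv, mul_one, neg_sub, sub_add_cancel]

end Flows

theorem map_pderiv_constTime (j : Fin (N + 1)) (f : GL (Idx m n) (LaurentSeries ℂ)) :
    (constTime f : GL (Idx m n) (Loop N)).val.map (∂ₜ j) = 0 :=
  Matrix.ext fun _ _ => pderiv_C

/-- The power `L^{2j+1}` of the Lax operator `L = M J M⁻¹`. -/
def laxPow (M : GL (Idx m n) (Loop N)) (j : Fin (N + 1)) : Matrix (Idx m n) (Idx m n) (Loop N) :=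
  M.val * Jmat m n N ^ (2 * (j : ℕ) + 1) * (M⁻¹).val

namespace IsFactorization

variable {f : GL (Idx m n) (LaurentSeries ℂ)} {M E : GL (Idx m n) (Loop N)}

theorem map_pderiv_quotient (h : IsFactorization f M E) (j : Fin (N + 1)) :
    ((M⁻¹).val * E.val).map (∂ₜ j) =
      -(Jmat m n N ^ (2 * (j : ℕ) + 1) * ((M⁻¹).val * E.val)) := by
  rw [← h.2.2, map_derivation_mul, map_pderiv_constTime, mul_zero, add_zero, map_pderiv_vacuum,
    neg_mul, mul_assoc]

theorem map_pderiv_split (h : IsFactorization f M E) (j : Fin (N + 1)) :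
    -(E.val.map (∂ₜ j) * (E⁻¹).val) = (laxPow M j).map plusPart ∧
      M.val.map (∂ₜ j) * (M⁻¹).val = (laxPow M j).map minusPart := by
  refine eq_of_add_eq_add_of_mem_unifSupp
    (neg_mem (mul_mem_unifSupp Ici_add_Ici_subset (map_pderiv_mem j h.2.1.mem) h.2.1.inv_mem))
    (map_plusPart_mem _)
    (mul_mem_unifSupp Iio_add_Iic_subset (h.1.map_pderiv_mem j) h.1.inv_mem)
    (map_minusPart_mem _) ?_
  rw [map_plusPart_add_map_minusPart,
    neg_add_of_map_derivation_quotient _ (h.map_pderiv_quotient j), laxPow]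

theorem map_pderiv_minus (h : IsFactorization f M E) (j : Fin (N + 1)) :
    M.val.map (∂ₜ j) = (laxPow M j).map minusPart * M.val := by
  rw [← (h.map_pderiv_split j).2, mul_assoc, Units.inv_mul, mul_one]

theorem map_pderiv_plus (h : IsFactorization f M E) (j : Fin (N + 1)) :
    E.val.map (∂ₜ j) = -((laxPow M j).map plusPart * E.val) := by
  rw [← (h.map_pderiv_split j).1, neg_mul, neg_neg, mul_assoc, Units.inv_mul, mul_one]

end IsFactorization

/-! ### The powers of `J` -/

section CyclicShift

variable {R : Type*} [CommRing R] {p : ℕ}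

/-- The `k`-th power (`k ≤ p + 1`) of the cyclic shift `∑ e_{i+1,i} + c e_{1,p+1}`; the lower block
of `Jmat` is `cyclicShift λ 1` with `p = 2n`. -/
def cyclicShift (c : R) (k : ℕ) : Matrix (Fin (p + 1)) (Fin (p + 1)) R :=
  of fun i j => if (i : ℕ) = j + k then 1 else if (i : ℕ) + (p + 1) = j + k then c else 0

theorem cyclicShift_zero (c : R) : cyclicShift (p := p) c 0 = 1 := by
  ext1 i j
  have wrap_ne : (i : ℕ) + (p + 1) ≠ j + 0 := by omega
  rw [cyclicShift, of_apply, Matrix.one_apply, if_neg wrap_ne, add_zero]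
  simp only [Fin.ext_iff]

theorem cyclicShift_period (c : R) : cyclicShift (p := p) c (p + 1) = c • 1 := by
  ext1 i j
  have low_ne : (i : ℕ) ≠ j + (p + 1) := by omega
  rw [cyclicShift, of_apply, if_neg low_ne, Matrix.smul_apply, Matrix.one_apply, smul_eq_mul,
    mul_ite, mul_one, mul_zero]
  simp only [Fin.ext_iff, Nat.add_right_cancel_iff]

theorem cyclicShift_one_castSucc (c : R) (i : Fin (p + 1)) (j : Fin p) :
    cyclicShift c 1 i j.castSucc = if i = j.succ then 1 else 0 := by
  have wrap_ne : (i : ℕ) + (p + 1) ≠ j.castSucc + 1 := by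
    rw [Fin.val_castSucc]; omega
  rw [cyclicShift, of_apply, if_neg wrap_ne]
  simp only [Fin.ext_iff, Fin.val_castSucc, Fin.val_succ]

theorem cyclicShift_one_last (c : R) (i : Fin (p + 1)) :
    cyclicShift c 1 i (Fin.last p) = if i = 0 then c else 0 := by
  have low_ne : (i : ℕ) ≠ Fin.last p + 1 := by
    rw [Fin.val_last]; omega
  rw [cyclicShift, of_apply, if_neg low_ne]
  simp only [Fin.ext_iff, Fin.val_last, Fin.val_zero, Nat.add_eq_right]

theorem cyclicShift_mul_cyclicShift_one (c : R) {k : ℕ} (hk : k ≤ p) :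
    cyclicShift (p := p) c k * cyclicShift c 1 = cyclicShift c (k + 1) := by
  ext1 i j
  rw [Matrix.mul_apply]
  induction j using Fin.lastCases with
  | cast j =>
    simp only [cyclicShift_one_castSucc, mul_ite, mul_one, mul_zero, Finset.sum_ite_eq',
      Finset.mem_univ, if_true]
    simp only [cyclicShift, of_apply, Fin.val_castSucc, Fin.val_succ, add_right_comm _ 1 k,
      add_assoc _ k 1]
  | last =>
    simp only [cyclicShift_one_last, mul_ite, mul_zero, Finset.sum_ite_eq', Finset.mem_univ,
      if_true]
    simp only [cyclicShift, of_apply, Fin.val_last, Fin.val_zero, zero_add]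
    have i_lt := i.isLt
    by_cases h : (i : ℕ) = k
    · rw [if_pos h, if_neg (by omega), if_pos (by omega), one_mul]
    · rw [if_neg h, if_neg (by omega), if_neg (by omega), if_neg (by omega), zero_mul]

theorem cyclicShift_one_pow (c : R) {k : ℕ} (hk : k ≤ p + 1) :
    cyclicShift (p := p) c 1 ^ k = cyclicShift c k := by
  induction k with
  | zero => rw [pow_zero, cyclicShift_zero]
  | succ k ih =>
    rw [pow_succ, ih (by omega), cyclicShift_mul_cyclicShift_one c (Nat.le_of_succ_le_succ hk)]

end CyclicShift

theorem fromBlocks_zero_pow_succ {ι κ R : Type*} [Fintype ι] [Fintype κ] [DecidableEq ι]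
    [DecidableEq κ] [CommRing R] (X : Matrix κ κ R) (k : ℕ) :
    (fromBlocks 0 0 0 X : Matrix (ι ⊕ κ) (ι ⊕ κ) R) ^ (k + 1) = fromBlocks 0 0 0 (X ^ (k + 1)) := by
  induction k with
  | zero => rw [zero_add, pow_one, pow_one]
  | succ k ih =>
    rw [pow_succ, ih, fromBlocks_multiply, pow_succ X (k + 1)]
    simp only [Matrix.mul_zero, Matrix.zero_mul, add_zero, zero_add]

theorem Jmat_eq : Jmat m n N = fromBlocks 0 0 0 (cyclicShift (lamPow 1) 1) := by
  ext1 a b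
  rw [Jmat, Matrix.add_apply, Matrix.smul_apply, smul_eq_mul, eMat, Matrix.single_apply, bMat]
  rcases a with i | i <;> rcases b with j | j
  · simp
  · simp
  · simp
  · have corner_iff : (Sum.inr 0 : Idx m n) = Sum.inr i ∧
        (Sum.inr (Fin.last (2 * n)) : Idx m n) = Sum.inr j ↔
        (i : ℕ) + (2 * n + 1) = j + 1 := by
      simp only [Sum.inr.injEq, Fin.ext_iff, Fin.val_zero, Fin.val_last]
      omega
    rw [fromBlocks_apply₂₂, fromBlocks_apply₂₂, cyclicShift, of_apply, of_apply]
    simp only [corner_iff]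
    split_ifs <;> first | omega | simp

theorem Jmat_pow_period : Jmat m n N ^ (2 * n + 1 + 1) = (lamPow 1 : Loop N) • Jmat m n N := by
  rw [Jmat_eq, fromBlocks_zero_pow_succ, pow_succ, cyclicShift_one_pow _ le_rfl, cyclicShift_period,
    fromBlocks_smul, smul_mul_assoc, one_mul]
  simp only [smul_zero]

theorem Jmat_mem : Jmat m n N ∈ unifSupp (Set.Icc 0 1) := by
  rw [Jmat_eq]
  rintro (i | i) (j | j)
  · exact zero_mem _
  · exact zero_mem _
  · exact zero_mem _
  · rw [fromBlocks_apply₂₂, cyclicShift, of_apply]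
    split_ifs
    · exact lamSupp_mono (by simp) one_mem_lamSupp
    · exact lamSupp_mono (by simp) (lamPow_mem 1)
    · exact zero_mem _

theorem Jmat_pow_mem (k : ℕ) : Jmat m n N ^ k ∈ unifSupp (Set.Icc 0 (k : ℤ)) := by
  induction k with
  | zero => exact unifSupp_mono (by simp) one_mem_unifSupp
  | succ k ih =>
    rw [pow_succ, Nat.cast_succ]
    exact mul_mem_unifSupp (Set.Icc_add_Icc_subset 0 (k : ℤ) 0 1) ih Jmat_mem

/-! ### The principal filtration -/

/-- The principal weight of an index. All indices of the first block get the weight `n` of the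
middle of the second block, so that weights lie between `0` and `2n`. -/
def weight : Idx m n → ℤ
  | Sum.inl _ => n
  | Sum.inr i => (i : ℕ)

theorem weight_nonneg (a : Idx m n) : 0 ≤ weight a := by
  rcases a with _ | _ <;> simp [weight]

theorem weight_le (a : Idx m n) : weight a ≤ 2 * n := by
  rcases a with i | i <;> simp only [weight] <;> omega

/-- Matrix loops of principal degree at most `d`, where `λ` has degree `2n+1` and `e_{a,b}` has
degree `weight a - weight b`. -/
def pDeg (m n N : ℕ) (d : ℤ) : AddSubgroup (Matrix (Idx m n) (Idx m n) (Loop N)) :=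
  matSupp fun a b => {k | (2 * n + 1) * k + weight a - weight b ≤ d}

section pDeg

variable {X Y : Matrix (Idx m n) (Idx m n) (Loop N)} {d e : ℤ}

theorem pDeg_mono (h : d ≤ e) (hX : X ∈ pDeg m n N d) : X ∈ pDeg m n N e :=
  matSupp_mono (fun _ _ _ hk => le_trans hk h) hX

theorem mul_mem_pDeg (hX : X ∈ pDeg m n N d) (hY : Y ∈ pDeg m n N e) :
    X * Y ∈ pDeg m n N (d + e) := by
  refine mul_mem_matSupp (fun a b c => ?_) hX hY
  rintro _ ⟨i, hi, j, hj, rfl⟩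
  simp only [Set.mem_ofPred_eq] at *
  linarith

theorem one_mem_pDeg : 1 ∈ pDeg m n N 0 := by
  intro a b
  rw [Matrix.one_apply]
  split_ifs with h
  · subst h
    exact lamSupp_mono (by simp) one_mem_lamSupp
  · exact zero_mem _

theorem pow_mem_pDeg (hX : X ∈ pDeg m n N d) (k : ℕ) : X ^ k ∈ pDeg m n N (k * d) := by
  induction k with
  | zero => rw [pow_zero, Nat.cast_zero, zero_mul]; exact one_mem_pDeg
  | succ k ih => rw [pow_succ, Nat.cast_succ, add_one_mul]; exact mul_mem_pDeg ih hX

theorem lamPow_smul_mem_pDeg (i : ℤ) (hX : X ∈ pDeg m n N d) :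
    (lamPow i : Loop N) • X ∈ pDeg m n N ((2 * n + 1) * i + d) := by
  refine smul_mem_matSupp (fun a b => ?_) (lamPow_mem i) hX
  rintro _ ⟨_, rfl, j, hj, rfl⟩
  simp only [Set.mem_ofPred_eq] at *
  linarith

theorem Jmat_mem_pDeg : Jmat m n N ∈ pDeg m n N 1 := by
  rw [Jmat_eq]
  rintro (i | i) (j | j)
  · exact zero_mem _
  · exact zero_mem _
  · exact zero_mem _
  · rw [fromBlocks_apply₂₂, cyclicShift, of_apply]
    split_ifs
    · refine lamSupp_mono (Set.singleton_subset_iff.mpr ?_) one_mem_lamSupp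
      simp only [weight, Set.mem_ofPred_eq]
      omega
    · refine lamSupp_mono (Set.singleton_subset_iff.mpr ?_) (lamPow_mem 1)
      simp only [weight, Set.mem_ofPred_eq]
      omega
    · exact zero_mem _

theorem mem_pDeg_of_mem_unifSupp (hX : X ∈ unifSupp (Set.Iio 0)) : X ∈ pDeg m n N (-1) := by
  refine matSupp_mono (fun a b k hk => ?_) hX
  simp only [Set.mem_Iio, Set.mem_ofPred_eq] at *
  nlinarith [weight_le a, weight_nonneg b]

theorem nsmul_mem_pDeg_iff {k : ℕ} (hk : k ≠ 0) : k • X ∈ pDeg m n N d ↔ X ∈ pDeg m n N d := by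
  refine ⟨fun h a b i hi => ?_, fun h => nsmul_mem h k⟩
  have nsmul_eq_zero : k • lamCoeff i (X a b) = 0 :=
    (map_nsmul (lamCoeffHom i) k (X a b)).symm.trans (h a b i hi)
  ext e
  have coeff_eq := congrArg (coeff e) nsmul_eq_zero
  rw [map_nsmul, map_zero, nsmul_eq_mul, mul_eq_zero] at coeff_eq
  exact coeff_eq.resolve_left (Nat.cast_ne_zero.mpr hk)

theorem eq_zero_of_forall_mem_pDeg (h : ∀ c : ℕ, X ∈ pDeg m n N (d - c)) : X = 0 := by
  ext1 a b
  refine ext_lamCoeff fun k => ?_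
  set gap := d - ((2 * n + 1) * k + weight a - weight b) + 1
  refine (h gap.toNat a b k ?_).trans (lamCoeff_zero k).symm
  simp only [Set.mem_ofPred_eq, not_le]
  linarith [Int.self_le_toNat gap]

end pDeg

/-! ### A pseudo-inverse of `ad J` -/

section GroupInverse

/-- `K` is the group inverse of `J`: the two commute and are mutually inverse in the corner ring
cut out by the idempotent `J * K`. -/
structure IsGroupInverse {A : Type*} [Monoid A] (J K : A) : Prop where
  commute : Commute J K
  mul_mul_self : J * K * J = J
  inv_mul_mul_inv : K * J * K = K

variable {A : Type*} [Ring A] {J K X : A}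

namespace IsGroupInverse

variable (h : IsGroupInverse J K)
include h

theorem mul_proj : J * (J * K) = J := by
  rw [h.commute.eq, ← mul_assoc, h.mul_mul_self]

theorem proj_mul_inv : J * K * K = K := by
  rw [h.commute.eq, h.inv_mul_mul_inv]

theorem inv_mul_proj : K * (J * K) = K := by
  rw [← mul_assoc, h.inv_mul_mul_inv]

theorem pow_mul_pow (k : ℕ) : J ^ (k + 1) * K ^ (k + 1) = J * K := by
  induction k with
  | zero => rw [zero_add, pow_one, pow_one]
  | succ k ih =>
    rw [pow_succ' J, pow_succ K, mul_assoc, ← mul_assoc (J ^ _), ih, h.proj_mul_inv]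

theorem proj_mul_inv_pow (k : ℕ) : J * K * K ^ (k + 1) = K ^ (k + 1) := by
  rw [pow_succ', ← mul_assoc, h.proj_mul_inv]

theorem proj_mul_corner_mul_proj : J * K * (J * K * X * J) * (J * K) = J * K * X * J := by
  calc _ = J * K * J * K * X * (J * (J * K)) := by noncomm_ring
    _ = _ := by rw [h.mul_mul_self, h.mul_proj]

theorem lie_sub_corner : ⁅J, X⁆ - J * K * ⁅J, X⁆ * (J * K) =
    K * ⁅J, ⁅J, X⁆⁆ * (1 - J * K) - (1 - J * K) * ⁅J, ⁅J, X⁆⁆ * K := by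
  have left_part : K * ⁅J, ⁅J, X⁆⁆ * (1 - J * K) =
      J * K * ⁅J, X⁆ - J * K * ⁅J, X⁆ * (J * K) := by
    rw [Ring.lie_def J ⁅J, X⁆]
    calc _ = K * J * ⁅J, X⁆ * (1 - J * K) - K * ⁅J, X⁆ * (J - J * (J * K)) := by noncomm_ring
      _ = _ := by rw [h.mul_proj, ← h.commute.eq]; noncomm_ring
  have right_part : (1 - J * K) * ⁅J, ⁅J, X⁆⁆ * K =
      J * K * ⁅J, X⁆ * (J * K) - ⁅J, X⁆ * (J * K) := by
    rw [Ring.lie_def J ⁅J, X⁆]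
    calc _ = (J - J * K * J) * ⁅J, X⁆ * K - (1 - J * K) * ⁅J, X⁆ * (J * K) := by noncomm_ring
      _ = _ := by rw [h.mul_mul_self]; noncomm_ring
  have complement_corner : (1 - J * K) * ⁅J, X⁆ * (1 - J * K) = 0 := by
    rw [Ring.lie_def]
    calc _ = (J - J * K * J) * X * (1 - J * K) - (1 - J * K) * X * (J - J * (J * K)) := by
          noncomm_ring
      _ = 0 := by rw [h.mul_mul_self, h.mul_proj]; noncomm_ring
  rw [left_part, right_part, ← sub_eq_zero, ← complement_corner]
  noncomm_ring

theorem corner_lie : J * K * ⁅J, X⁆ * (J * K) = J * (J * K * X * J) * K - J * K * X * J := by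
  rw [Ring.lie_def]
  calc _ = J * K * J * X * (J * K) - J * K * X * (J * (J * K)) := by noncomm_ring
    _ = J * (J * K) * X * (J * K) - J * K * X * J := by rw [h.mul_mul_self, h.mul_proj]
    _ = _ := by noncomm_ring

theorem corner_lie_lie : J * (J * K * ⁅J, X⁆ * (J * K)) * K - J * K * ⁅J, X⁆ * (J * K) =
    J * K * ⁅J, ⁅J, X⁆⁆ * K := by
  rw [Ring.lie_def J ⁅J, X⁆]
  calc _ = J * (J * K) * ⁅J, X⁆ * (J * K * K) - J * K * ⁅J, X⁆ * (J * K) := by noncomm_ring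
    _ = J * K * J * ⁅J, X⁆ * K - J * K * ⁅J, X⁆ * (J * K) := by
      rw [h.mul_proj, h.proj_mul_inv, h.mul_mul_self]
    _ = _ := by noncomm_ring

end IsGroupInverse

/-- The map `X ↦ J X K`; on the corner ring of a group inverse `K` of `J` it is conjugation by
`J`. -/
def sandwich (J K : A) : A →+ A := (AddMonoidHom.mulRight K).comp (AddMonoidHom.mulLeft J)

theorem sandwich_apply (J K X : A) : sandwich J K X = J * X * K := rfl

theorem sandwich_iterate (J K X : A) (k : ℕ) : (sandwich J K)^[k] X = J ^ k * X * K ^ k := by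
  induction k with
  | zero => simp
  | succ k ih =>
    rw [Function.iterate_succ_apply', ih, sandwich_apply, pow_succ' J, pow_succ K]
    simp only [mul_assoc]

/- The orbit sum of `b = φ w - w` under a map with `φ^p w = w` telescopes to zero, so `-p b` is the
sum of the differences `φ^i b - b`, each of which is a telescoping sum of images of `φ b - b`. -/
theorem nsmul_mem_of_map_sub_mem {B : Type*} [AddCommGroup B] (φ : B →+ B) (F : AddSubgroup B)
    (hF : ∀ y ∈ F, φ y ∈ F) {w b : B} {p : ℕ} (hw : φ^[p] w = w) (hb : b = φ w - w)
    (h : φ b - b ∈ F) : p • b ∈ F := by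
  have iterate_sub_mem (i : ℕ) : φ^[i] b - b ∈ F := by
    induction i with
    | zero => rw [Function.iterate_zero_apply, sub_self]; exact zero_mem F
    | succ i ih =>
      rw [Function.iterate_succ_apply', ← sub_add_sub_cancel _ (φ b) b, ← map_sub]
      exact add_mem (hF _ ih) h
  have orbit_sum : ∑ i ∈ Finset.range p, φ^[i] b = 0 := by
    have telescope (i : ℕ) : φ^[i] b = φ^[i + 1] w - φ^[i] w := by
      rw [hb, iterate_map_sub φ i, ← Function.iterate_succ_apply]
    simp_rw [telescope]
    rw [Finset.sum_range_sub (fun i => φ^[i] w), Function.iterate_zero_apply, hw, sub_self]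
  have nsmul_eq : p • b = -∑ i ∈ Finset.range p, (φ^[i] b - b) := by
    rw [Finset.sum_sub_distrib, orbit_sum, zero_sub, neg_neg, Finset.sum_const, Finset.card_range]
  rw [nsmul_eq]
  exact neg_mem (sum_mem fun i _ => iterate_sub_mem i)

end GroupInverse

theorem lamPow_smul_smul (i j : ℤ) (X : Matrix (Idx m n) (Idx m n) (Loop N)) :
    (lamPow i : Loop N) • (lamPow j : Loop N) • X = (lamPow (i + j) : Loop N) • X := by
  rw [smul_smul, ← lamPow_add]

theorem Jmat_pow_add (k : ℕ) : Jmat m n N ^ (k + 1 + (2 * n + 1)) =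
    (lamPow 1 : Loop N) • Jmat m n N ^ (k + 1) := by
  rw [add_assoc k, add_comm 1, pow_add, Jmat_pow_period, mul_smul_comm, ← pow_succ]

/-- The group inverse `λ⁻² J^{4n+1}` of `J`. -/
def pinvMat (m n N : ℕ) : Matrix (Idx m n) (Idx m n) (Loop N) :=
  (lamPow (-2) : Loop N) • Jmat m n N ^ (4 * n + 1)

theorem Jmat_pow_eq : Jmat m n N ^ (2 * n + 1) =
    (lamPow 1 : Loop N) • (Jmat m n N * pinvMat m n N) := by
  rw [pinvMat, mul_smul_comm, ← pow_succ', show 4 * n + 1 + 1 = 2 * n + 1 + (2 * n + 1) by ring,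
    Jmat_pow_add, lamPow_smul_smul, lamPow_smul_smul, show (1 + -2 + 1 : ℤ) = 0 from rfl,
    lamPow_zero, one_smul]

theorem isGroupInverse_Jmat_pinvMat : IsGroupInverse (Jmat m n N) (pinvMat m n N) := by
  have commute : Commute (Jmat m n N) (pinvMat m n N) :=
    (Commute.self_pow _ _).smul_right (lamPow (-2) : Loop N)
  have proj_eq : Jmat m n N * pinvMat m n N =
      (lamPow (-1) : Loop N) • Jmat m n N ^ (2 * n + 1) := by
    rw [Jmat_pow_eq, lamPow_smul_smul, neg_add_cancel, lamPow_zero, one_smul]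
  have proj_mul_pow (k : ℕ) : Jmat m n N * pinvMat m n N * Jmat m n N ^ (k + 1) =
      Jmat m n N ^ (k + 1) := by
    rw [proj_eq, smul_mul_assoc, ← pow_add, add_comm (2 * n + 1), Jmat_pow_add, lamPow_smul_smul,
      neg_add_cancel, lamPow_zero, one_smul]
  refine ⟨commute, by simpa using proj_mul_pow 0, ?_⟩
  conv_lhs => rw [← commute.eq]
  conv_lhs => arg 2; rw [pinvMat]
  rw [mul_smul_comm, proj_mul_pow, pinvMat]

theorem Jmat_pow_mul_pinvMat_pow (X : Matrix (Idx m n) (Idx m n) (Loop N)) :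
    Jmat m n N ^ (2 * n + 1) * X * pinvMat m n N ^ (2 * n + 1) =
      Jmat m n N * pinvMat m n N * X * (Jmat m n N * pinvMat m n N) := by
  have smul_pinv_pow : (lamPow 1 : Loop N) • pinvMat m n N ^ (2 * n + 1) =
      Jmat m n N * pinvMat m n N := by
    rw [← isGroupInverse_Jmat_pinvMat.proj_mul_inv_pow, ← smul_mul_assoc, ← Jmat_pow_eq,
      isGroupInverse_Jmat_pinvMat.pow_mul_pow]
  rw [Jmat_pow_eq, smul_mul_assoc, smul_mul_assoc, ← mul_smul_comm, smul_pinv_pow]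

theorem pinvMat_mem_pDeg : pinvMat m n N ∈ pDeg m n N (-1) := by
  refine pDeg_mono ?_ (lamPow_smul_mem_pDeg (-2) (pow_mem_pDeg Jmat_mem_pDeg _))
  push_cast
  linarith

theorem projMat_mem_pDeg : Jmat m n N * pinvMat m n N ∈ pDeg m n N 0 :=
  pDeg_mono (by norm_num) (mul_mem_pDeg Jmat_mem_pDeg pinvMat_mem_pDeg)

theorem lie_Jmat_mem_pDeg {X : Matrix (Idx m n) (Idx m n) (Loop N)} {d : ℤ}
    (h : ⁅Jmat m n N, ⁅Jmat m n N, X⁆⁆ ∈ pDeg m n N d) :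
    ⁅Jmat m n N, X⁆ ∈ pDeg m n N (d - 1) := by
  have inverse := isGroupInverse_Jmat_pinvMat (m := m) (n := n) (N := N)
  have compl_mem := sub_mem one_mem_pDeg (projMat_mem_pDeg (m := m) (n := n) (N := N))
  have off_corner_mem : ⁅Jmat m n N, X⁆ -
      Jmat m n N * pinvMat m n N * ⁅Jmat m n N, X⁆ * (Jmat m n N * pinvMat m n N) ∈
        pDeg m n N (d - 1) := by
    rw [inverse.lie_sub_corner]
    refine sub_mem ?_ ?_
    · exact pDeg_mono (by linarith) (mul_mem_pDeg (mul_mem_pDeg pinvMat_mem_pDeg h) compl_mem)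
    · exact pDeg_mono (by linarith) (mul_mem_pDeg (mul_mem_pDeg compl_mem h) pinvMat_mem_pDeg)
  have corner_mem : Jmat m n N * pinvMat m n N * ⁅Jmat m n N, X⁆ * (Jmat m n N * pinvMat m n N) ∈
      pDeg m n N (d - 1) := by
    rw [← nsmul_mem_pDeg_iff (Nat.succ_ne_zero (2 * n))]
    refine nsmul_mem_of_map_sub_mem (sandwich (Jmat m n N) (pinvMat m n N)) (pDeg m n N (d - 1))
      (fun Y hY => ?_) ?_ inverse.corner_lie ?_
    · exact pDeg_mono (by linarith)
        (mul_mem_pDeg (mul_mem_pDeg Jmat_mem_pDeg hY) pinvMat_mem_pDeg)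
    · rw [sandwich_iterate, Jmat_pow_mul_pinvMat_pow, inverse.proj_mul_corner_mul_proj]
    · rw [sandwich_apply, inverse.corner_lie_lie]
      exact pDeg_mono (by linarith)
        (mul_mem_pDeg (mul_mem_pDeg projMat_mem_pDeg h) pinvMat_mem_pDeg)
  simpa only [sub_add_cancel] using add_mem off_corner_mem corner_mem

/-! ### Loops that commute with `∂_x + J` -/

/- Both `X` and `[J, X]` solve `Y_x = -[J, Y]`, so `ad J` does not raise their degree, and every
application of `lie_Jmat_mem_pDeg` lowers the degree of `[J, Y]` by one for all solutions `Y`. -/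
theorem lie_Jmat_eq_zero_of_lax {X : Matrix (Idx m n) (Idx m n) (Loop N)} (hX : X ∈ pDeg m n N 1)
    (h : X.map (∂ₜ 0) = -⁅Jmat m n N, X⁆) : ⁅Jmat m n N, X⁆ = 0 := by
  have lie_mem {Y : Matrix (Idx m n) (Idx m n) (Loop N)} (hY : Y ∈ pDeg m n N 1)
      (hlax : Y.map (∂ₜ 0) = -⁅Jmat m n N, Y⁆) : ⁅Jmat m n N, Y⁆ ∈ pDeg m n N 1 := by
    rw [← neg_neg ⁅Jmat m n N, Y⁆, ← hlax]
    exact neg_mem (map_pderiv_mem 0 hY)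
  have lie_mem_sub (c : ℕ) : ∀ Y ∈ pDeg m n N 1, Y.map (∂ₜ 0) = -⁅Jmat m n N, Y⁆ →
      ⁅Jmat m n N, Y⁆ ∈ pDeg m n N (1 - c) := by
    induction c with
    | zero => intro Y hY hlax; simpa using lie_mem hY hlax
    | succ c ih =>
      intro Y hY hlax
      have lie_lax : (⁅Jmat m n N, Y⁆).map (∂ₜ 0) = -⁅Jmat m n N, ⁅Jmat m n N, Y⁆⁆ := by
        conv_lhs => rw [Ring.lie_def (Jmat m n N) Y]
        rw [map_derivation_sub, map_derivation_mul, map_derivation_mul,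
          map_pderiv_Jmat, hlax, Ring.lie_def (Jmat m n N) ⁅Jmat m n N, Y⁆]
        noncomm_ring
      refine pDeg_mono ?_ (lie_Jmat_mem_pDeg (ih _ (lie_mem hY hlax) lie_lax))
      push_cast
      linarith
  exact eq_zero_of_forall_mem_pDeg fun c => lie_mem_sub c X hX h

theorem pow_succ_sub_pow_succ_eq {A : Type*} [Ring A] {x y : A} (h : Commute x y) (p : ℕ) :
    x ^ (p + 1) - y ^ (p + 1) =
      (x - y) * ∑ i ∈ Finset.range (p + 1), (x ^ i - y ^ i) * y ^ (p - i) +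
        (p + 1) • ((x - y) * y ^ p) := by
  have diagonal_sum : ∑ i ∈ Finset.range (p + 1), y ^ i * y ^ (p - i) = (p + 1) • y ^ p := by
    rw [Finset.sum_congr rfl fun i hi => by
      rw [← pow_add, Nat.add_sub_of_le (Finset.mem_range_succ_iff.mp hi)], Finset.sum_const,
      Finset.card_range]
  have sum_split : ∑ i ∈ Finset.range (p + 1), (x ^ i - y ^ i) * y ^ (p - i) =
      ∑ i ∈ Finset.range (p + 1), x ^ i * y ^ (p - i) - (p + 1) • y ^ p := by
    simp_rw [sub_mul]
    rw [Finset.sum_sub_distrib, diagonal_sum]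
  rw [sum_split, ← h.mul_geom_sum₂ (p + 1), add_tsub_cancel_right, mul_sub, mul_smul_comm,
    sub_add_cancel]

section Uniqueness

variable {T : Matrix (Idx m n) (Idx m n) (Loop N)}

theorem pow_sub_Jmat_pow_mem_pDeg (hT : T - Jmat m n N ∈ pDeg m n N 0) (k : ℕ) :
    T ^ k - Jmat m n N ^ k ∈ pDeg m n N (k - 1) := by
  have T_mem : T ∈ pDeg m n N 1 :=
    sub_add_cancel T (Jmat m n N) ▸ add_mem (pDeg_mono zero_le_one hT) Jmat_mem_pDeg
  induction k with
  | zero => rw [pow_zero, pow_zero, sub_self]; exact zero_mem _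
  | succ k ih =>
    have split : T ^ (k + 1) - Jmat m n N ^ (k + 1) =
        (T ^ k - Jmat m n N ^ k) * T + Jmat m n N ^ k * (T - Jmat m n N) := by
      rw [pow_succ, pow_succ]; noncomm_ring
    rw [split]
    refine add_mem (pDeg_mono ?_ (mul_mem_pDeg ih T_mem))
      (pDeg_mono ?_ (mul_mem_pDeg (pow_mem_pDeg Jmat_mem_pDeg k) hT)) <;> push_cast <;> linarith

theorem geom_remainder_mem_pDeg (hT : T - Jmat m n N ∈ pDeg m n N 0) :
    ∑ i ∈ Finset.range (2 * n + 1 + 1), (T ^ i - Jmat m n N ^ i) * Jmat m n N ^ (2 * n + 1 - i) ∈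
      pDeg m n N (2 * n) := by
  refine sum_mem fun i hi => ?_
  have i_le : i ≤ 2 * n + 1 := Finset.mem_range_succ_iff.mp hi
  refine pDeg_mono ?_ (mul_mem_pDeg (pow_sub_Jmat_pow_mem_pDeg hT i)
    (pow_mem_pDeg Jmat_mem_pDeg (2 * n + 1 - i)))
  push_cast [Nat.cast_sub i_le]
  linarith

/- `T^{2n+2} = λ T` and `J^{2n+2} = λ J`, expanded to first order in `T - J`. Since `2n + 2 ≠ 1`,
the corner part of `T - J` has lower degree, and then so does `T - J`. -/
theorem exists_sub_Jmat_eq (hT : T - Jmat m n N ∈ pDeg m n N 0) (hc : Commute T (Jmat m n N))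
    (hp : T ^ (2 * n + 1 + 1) = (lamPow 1 : Loop N) • T) :
    ∃ R ∈ pDeg m n N (-1), T - Jmat m n N = (T - Jmat m n N) * R +
      (2 * n + 1 + 1) • ((T - Jmat m n N) * (Jmat m n N * pinvMat m n N)) := by
  have scaled := pow_succ_sub_pow_succ_eq hc (2 * n + 1)
  rw [hp, Jmat_pow_period, ← smul_sub] at scaled
  refine ⟨_, pDeg_mono ?_ (lamPow_smul_mem_pDeg (-1) (geom_remainder_mem_pDeg hT)), ?_⟩
  · linarith
  · have unscaled := congrArg (fun X => (lamPow (-1) : Loop N) • X) scaled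
    simp only [smul_add, lamPow_smul_smul, Jmat_pow_eq, mul_smul_comm,
      smul_comm (lamPow (-1) : Loop N) (_ : ℕ)] at unscaled
    simpa [mul_smul_comm] using unscaled

theorem eq_Jmat_of_commute (hT : T - Jmat m n N ∈ pDeg m n N 0) (hc : Commute T (Jmat m n N))
    (hp : T ^ (2 * n + 1 + 1) = (lamPow 1 : Loop N) • T) : T = Jmat m n N := by
  obtain ⟨R, hR, sub_eq⟩ := exists_sub_Jmat_eq hT hc hp
  set P := Jmat m n N * pinvMat m n N with hP
  have proj_idem : P * P = P := by
    rw [hP, mul_assoc, isGroupInverse_Jmat_pinvMat.inv_mul_proj]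
  have nsmul_sub_mul_proj : (2 * n + 1) • ((T - Jmat m n N) * P) =
      -((T - Jmat m n N) * R * P) := by
    have mul_proj_eq := congrArg (· * P) sub_eq
    simp only [add_mul, smul_mul_assoc, mul_assoc, proj_idem] at mul_proj_eq ⊢
    rw [succ_nsmul, ← add_assoc, right_eq_add, add_comm] at mul_proj_eq
    exact eq_neg_of_add_eq_zero_left mul_proj_eq
  have sub_mem_pDeg (c : ℕ) : T - Jmat m n N ∈ pDeg m n N (0 - c) := by
    induction c with
    | zero => simpa using hT
    | succ c ih =>
      have mul_R_mem : (T - Jmat m n N) * R ∈ pDeg m n N (0 - (c + 1 : ℕ)) :=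
        pDeg_mono (by push_cast; linarith) (mul_mem_pDeg ih hR)
      have mul_P_mem : (T - Jmat m n N) * P ∈ pDeg m n N (0 - (c + 1 : ℕ)) := by
        rw [← nsmul_mem_pDeg_iff (Nat.succ_ne_zero (2 * n)), Nat.succ_eq_add_one,
          nsmul_sub_mul_proj]
        exact neg_mem (pDeg_mono (add_zero _).le (mul_mem_pDeg mul_R_mem projMat_mem_pDeg))
      rw [sub_eq]
      exact add_mem mul_R_mem (nsmul_mem mul_P_mem _)
  exact sub_eq_zero.mp (eq_zero_of_forall_mem_pDeg sub_mem_pDeg)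

end Uniqueness

/-! ### Intertwiners of connections -/

section Intertwines

variable {A R ι : Type*} [CommSemiring A] [CommRing R] [Algebra A R] [Fintype ι]
  {D : Derivation A R R} {U V W X Y : Matrix ι ι R}

/-- `X` intertwines the connections `D + V` and `D + W`, that is, `X (D + V) = (D + W) X`. The Lax
equation `[D + V, X] = 0` is the case `V = W`. -/
def Intertwines (D : Derivation A R R) (X V W : Matrix ι ι R) : Prop :=
  X.map D = X * V - W * X

theorem Intertwines.mul (hX : Intertwines D X V W) (hY : Intertwines D Y U V) :
    Intertwines D (X * Y) U W := by
  rw [Intertwines, map_derivation_mul, show X.map D = _ from hX, show Y.map D = _ from hY]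
  noncomm_ring

variable [DecidableEq ι]

theorem Intertwines.inv {g : GL ι R} (h : Intertwines D g.val V W) :
    Intertwines D (g⁻¹).val W V := by
  rw [Intertwines, map_derivation_inv, show g.val.map D = _ from h]
  calc _ = (g⁻¹).val * W * (g.val * (g⁻¹).val) - (g⁻¹).val * g.val * V * (g⁻¹).val := by
        noncomm_ring
    _ = _ := by rw [Units.mul_inv, Units.inv_mul, mul_one, one_mul]

theorem Intertwines.conj {g : GL ι R} (h : Intertwines D g.val V W) (hX : Intertwines D X V V) :
    Intertwines D (g.val * X * (g⁻¹).val) W W :=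
  (h.mul hX).mul h.inv

theorem intertwines_gauge (D : Derivation A R R) (g : GL ι R) (V : Matrix ι ι R) :
    Intertwines D g.val V (g.val * V * (g⁻¹).val - g.val.map D * (g⁻¹).val) := by
  rw [Intertwines, sub_mul, mul_assoc _ _ g.val, mul_assoc _ _ g.val, Units.inv_mul, mul_one,
    mul_one, sub_sub_cancel]

/-- A common fundamental solution of `D + V` and `D' + W` forces the zero curvature equation. -/
theorem Intertwines.zero_curvature {D' : Derivation A R R} (comm : ∀ a, D (D' a) = D' (D a))
    {g : GL ι R} (h : Intertwines D g.val 0 V) (h' : Intertwines D' g.val 0 W) :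
    V.map D' = W.map D + (V * W - W * V) := by
  rw [Intertwines, mul_zero, zero_sub] at h h'
  have mixed : (g.val.map D).map D' = (g.val.map D').map D :=
    Matrix.ext fun a b => (comm (g.val a b)).symm
  have expand (D₁ : Derivation A R R) (Z T : Matrix ι ι R) :
      (-(Z * T)).map D₁ = -(Z.map D₁ * T + Z * T.map D₁) := by
    rw [← map_derivation_mul]
    exact Matrix.ext fun a b => map_neg D₁ _
  rw [h, h', expand, expand, h, h', neg_inj] at mixed
  refine g.isUnit.mul_right_cancel ?_
  rw [← sub_eq_zero] at mixed ⊢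
  rw [← mixed]
  noncomm_ring

end Intertwines

/-! ### The group `N⁺` -/

theorem mul_single_eq_zero {ι R : Type*} [Fintype ι] [DecidableEq ι] [CommRing R]
    {X : Matrix ι ι R} {i : ι} (h : ∀ a, X a i = 0) (j : ι) : X * Matrix.single i j 1 = 0 := by
  ext1 a b
  simp [Matrix.mul_apply, Matrix.single_apply, ite_and, h]

theorem single_mul_eq_zero {ι R : Type*} [Fintype ι] [DecidableEq ι] [CommRing R]
    {X : Matrix ι ι R} {j : ι} (h : ∀ b, X j b = 0) (i : ι) : Matrix.single i j 1 * X = 0 := by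
  ext1 a b
  simp [Matrix.mul_apply, Matrix.single_apply, ite_and, h]

namespace InLieNplus

variable {η Δ : Matrix (Idx m n) (Idx m n) (TSeries N)}

theorem apply_inr_zero (h : InLieNplus η) (a : Idx m n) : η a (Sum.inr 0) = 0 := by
  obtain ⟨D, hD, rfl⟩ := h
  rcases a with a | a
  · rfl
  · exact hD a 0 (Fin.zero_le a)

theorem inr_last_apply (h : InLieNplus η) (b : Idx m n) :
    η (Sum.inr (Fin.last (2 * n))) b = 0 := by
  obtain ⟨D, hD, rfl⟩ := h
  rcases b with b | b
  · rfl
  · exact hD _ b (Fin.le_last b)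

theorem neg (h : InLieNplus η) : InLieNplus (-η) := by
  obtain ⟨D, hD, rfl⟩ := h
  refine ⟨-D, fun i j hij => neg_eq_zero.mpr (hD i j hij), ?_⟩
  simp only [fromBlocks_neg, neg_zero]

theorem map_pderiv (h : InLieNplus η) (j : Fin (N + 1)) : InLieNplus (η.map (∂ₛ j)) := by
  obtain ⟨D, hD, rfl⟩ := h
  refine ⟨D.map (∂ₛ j), fun i k hik => by rw [Matrix.map_apply, hD i k hik, map_zero], ?_⟩
  simp only [fromBlocks_map, Matrix.map_zero _ (map_zero (∂ₛ j))]

theorem mul_inNplus (h : InLieNplus η) (hΔ : InNplus Δ) : InLieNplus (η * Δ) := by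
  obtain ⟨D, hD, rfl⟩ := h
  obtain ⟨T, -, hT, rfl⟩ := hΔ
  refine ⟨D * T, fun i j hij => ?_, by simp [fromBlocks_multiply]⟩
  rw [Matrix.mul_apply]
  refine Finset.sum_eq_zero fun k _ => ?_
  rcases le_or_gt k i with hk | hk
  · rw [hD i k hk, zero_mul]
  · rw [hT k j (hij.trans_lt hk), mul_zero]

theorem map_constLoop_mem_pDeg (h : InLieNplus η) : η.map constLoop ∈ pDeg m n N (-1) := by
  obtain ⟨D, hD, rfl⟩ := h
  have zero_entry (s : Set ℤ) : constLoop (0 : TSeries N) ∈ lamSupp s :=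
    (map_zero (constLoop (N := N))).symm ▸ zero_mem _
  rintro (a | a) (b | b)
  · exact zero_entry _
  · exact zero_entry _
  · exact zero_entry _
  · rw [Matrix.map_apply, fromBlocks_apply₂₂]
    rcases le_or_gt b a with hba | hab
    · rw [hD a b hba]
      exact zero_entry _
    · refine lamSupp_mono (Set.singleton_subset_iff.mpr ?_) (constLoop_mem _)
      simp only [weight, Set.mem_ofPred_eq]
      have : (a : ℕ) < b := hab
      omega

end InLieNplus

theorem diag_inv_eq_one {p : ℕ} {R : Type*} [CommRing R] {D D' : Matrix (Fin p) (Fin p) R}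
    (hD : D.BlockTriangular id) (hD' : D'.BlockTriangular id) (diag : ∀ i, D i i = 1)
    (mul_eq : D * D' = 1) (i : Fin p) : D' i i = 1 := by
  rw [← Matrix.one_apply_eq i, ← mul_eq, Matrix.mul_apply, Finset.sum_eq_single i, diag, one_mul]
  · intro k _ hk
    rcases lt_or_gt_of_ne hk with hki | hik
    · rw [hD hki, zero_mul]
    · rw [hD' hik, mul_zero]
  · exact fun hi => absurd (Finset.mem_univ i) hi

namespace InNplus

variable {Δ : Matrix (Idx m n) (Idx m n) (TSeries N)}

theorem exists_unit (h : InNplus Δ) :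
    ∃ g : GL (Idx m n) (TSeries N), g.val = Δ ∧ InNplus (g⁻¹).val := by
  obtain ⟨D, diag, lower, rfl⟩ := h
  have upper : D.BlockTriangular id := fun i j hij => lower i j hij
  have isUnit_det : IsUnit D.det := by
    rw [Matrix.det_of_isUpperTriangular upper, Finset.prod_eq_one fun i _ => diag i]
    exact isUnit_one
  let _ : Invertible D := Matrix.invertibleOfIsUnitDet D isUnit_det
  have upper_inv : (D⁻¹).BlockTriangular id := Matrix.blockTriangular_inv_of_blockTriangular upper
  have mul_inv : D * D⁻¹ = 1 := Matrix.mul_nonsing_inv D isUnit_det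
  have inv_mul : D⁻¹ * D = 1 := Matrix.nonsing_inv_mul D isUnit_det
  exact ⟨⟨fromBlocks 1 0 0 D, fromBlocks 1 0 0 D⁻¹, by simp [fromBlocks_multiply, mul_inv],
    by simp [fromBlocks_multiply, inv_mul]⟩, rfl, D⁻¹, diag_inv_eq_one upper upper_inv diag mul_inv,
    fun i j hij => upper_inv hij, rfl⟩

theorem sub_one (h : InNplus Δ) : InLieNplus (Δ - 1) := by
  obtain ⟨D, diag, lower, rfl⟩ := h
  refine ⟨D - 1, fun i j hji => ?_, ?_⟩
  · rcases hji.eq_or_lt with rfl | hji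
    · rw [Matrix.sub_apply, diag, Matrix.one_apply_eq, sub_self]
    · rw [Matrix.sub_apply, lower i j hji, Matrix.one_apply_ne hji.ne', sub_self]
  · rw [← fromBlocks_one, sub_eq_add_neg, fromBlocks_neg, fromBlocks_add]
    simp only [add_neg_cancel, neg_zero, add_zero, sub_eq_add_neg]

theorem map_constLoop_sub_one (h : InNplus Δ) :
    Δ.map constLoop - 1 ∈ pDeg m n N (-1) := by
  have map_sub_one : (Δ - 1).map constLoop = Δ.map constLoop - 1 :=
    map_sub (constLoop (N := N)).mapMatrix Δ 1 |>.trans (congrArg _ (map_one _))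
  exact map_sub_one ▸ h.sub_one.map_constLoop_mem_pDeg

theorem mul_eMat (h : InNplus Δ) : Δ * eMat m n (TSeries N) = eMat m n (TSeries N) := by
  rw [← sub_eq_zero, ← sub_one_mul]
  exact mul_single_eq_zero h.sub_one.apply_inr_zero _

theorem eMat_mul (h : InNplus Δ) : eMat m n (TSeries N) * Δ = eMat m n (TSeries N) := by
  rw [← sub_eq_zero, ← mul_sub_one]
  exact single_mul_eq_zero h.sub_one.inr_last_apply _

end InNplus

/-- Matrices over the series in the times, regarded as loops. -/
def constGL : GL (Idx m n) (TSeries N) →* GL (Idx m n) (Loop N) :=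
  Units.map (constLoop (N := N)).mapMatrix.toMonoidHom

theorem constGL_val (g : GL (Idx m n) (TSeries N)) : (constGL g).val = g.val.map constLoop := rfl

theorem constGL_inv_val (g : GL (Idx m n) (TSeries N)) :
    ((constGL g)⁻¹).val = (g⁻¹).val.map constLoop := rfl

theorem map_pderiv_map_constLoop {ι κ : Type*} (j : Fin (N + 1)) (X : Matrix ι κ (TSeries N)) :
    (X.map constLoop).map (∂ₜ j) = (X.map (∂ₛ j)).map constLoop :=
  Matrix.ext fun _ _ => pderiv_constLoop j _

theorem map_constLoop_eMat : (eMat m n (TSeries N)).map constLoop = eMat m n (Loop N) := by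
  rw [eMat, eMat, Matrix.map_single, map_one]

theorem map_constLoop_bMat : (bMat m n (TSeries N)).map constLoop = bMat m n (Loop N) := by
  rw [bMat, bMat, fromBlocks_map]
  simp only [Matrix.map_zero _ (map_zero (constLoop (N := N)))]
  congr 1
  ext1 i j
  rw [Matrix.map_apply, of_apply, of_apply, apply_ite constLoop, map_one, map_zero]

theorem Jmat_add_map_constLoop (u : Matrix (Idx m n) (Idx m n) (TSeries N)) :
    Jmat m n N + u.map constLoop =
      (lamPow 1 : Loop N) • (eMat m n (TSeries N)).map constLoop +
        (bMat m n (TSeries N) + u).map constLoop := by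
  rw [Matrix.map_add _ (map_add constLoop), map_constLoop_bMat, map_constLoop_eMat, Jmat, add_assoc]

/-- The gauge action of `N⁺` fixes the term `λ e` of `∂ + J + q`, so that it may be computed without
that term. -/
theorem IsGauge.intertwines {Δ q u : Matrix (Idx m n) (Idx m n) (TSeries N)} (h : IsGauge Δ q u)
    (hΔ : InNplus Δ) :
    Intertwines (∂ₜ 0) (Δ.map constLoop) (Jmat m n N + q.map constLoop)
      (Jmat m n N + u.map constLoop) := by
  have gauge_map := congrArg (fun X => X.map (constLoop (N := N))) h
  simp only [Matrix.map_mul, Matrix.map_add _ (map_add constLoop)] at gauge_map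
  have commutes_e : Δ.map constLoop * (eMat m n (TSeries N)).map constLoop =
      (eMat m n (TSeries N)).map constLoop * Δ.map constLoop := by
    rw [← Matrix.map_mul, ← Matrix.map_mul, hΔ.mul_eMat, hΔ.eMat_mul]
  rw [Intertwines, Jmat_add_map_constLoop, Jmat_add_map_constLoop, map_pderiv_map_constLoop,
    Matrix.map_add _ (map_add constLoop), Matrix.map_add _ (map_add constLoop), mul_add,
    add_mul _ _ (Δ.map _), gauge_map, mul_smul_comm, smul_mul_assoc, commutes_e]
  abel

/-! ### Uniqueness of `S(u, λ)` -/

theorem mul_sub_one_mem_pDeg {X Y : Matrix (Idx m n) (Idx m n) (Loop N)}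
    (hX : X - 1 ∈ pDeg m n N (-1)) (hY : Y - 1 ∈ pDeg m n N (-1)) :
    X * Y - 1 ∈ pDeg m n N (-1) := by
  have expand : X * Y - 1 = (X - 1) * (Y - 1) + (X - 1) + (Y - 1) := by noncomm_ring
  rw [expand]
  exact add_mem (add_mem (pDeg_mono (by norm_num) (mul_mem_pDeg hX hY)) hX) hY

/-- The invertible loops `g` for which `g` and `g⁻¹` are the identity up to terms of negative
principal degree; they contain both `N⁺` and `G_-`. -/
def unipotentLoops (m n N : ℕ) : Subgroup (GL (Idx m n) (Loop N)) where
  carrier := {g | g.val - 1 ∈ pDeg m n N (-1) ∧ (g⁻¹).val - 1 ∈ pDeg m n N (-1)}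
  one_mem' := by simp [zero_mem]
  mul_mem' hg hg' := ⟨mul_sub_one_mem_pDeg hg.1 hg'.1, by
    rw [_root_.mul_inv_rev]; exact mul_sub_one_mem_pDeg hg'.2 hg.2⟩
  inv_mem' hg := ⟨hg.2, by rw [inv_inv]; exact hg.1⟩

theorem IsMinus.mem_unipotentLoops {M : GL (Idx m n) (Loop N)} (h : IsMinus M) :
    M ∈ unipotentLoops m n N :=
  ⟨mem_pDeg_of_mem_unifSupp h.sub_one_mem, mem_pDeg_of_mem_unifSupp h.inv_sub_one_mem⟩

theorem constGL_mem_unipotentLoops {g : GL (Idx m n) (TSeries N)} (h : InNplus g.val)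
    (h' : InNplus (g⁻¹).val) : constGL g ∈ unipotentLoops m n N :=
  ⟨h.map_constLoop_sub_one, h'.map_constLoop_sub_one⟩

theorem conj_Jmat_sub_mem_pDeg {K : GL (Idx m n) (Loop N)} (hK : K ∈ unipotentLoops m n N) :
    K.val * Jmat m n N * (K⁻¹).val - Jmat m n N ∈ pDeg m n N 0 := by
  have expand : K.val * Jmat m n N * (K⁻¹).val - Jmat m n N =
      (K.val - 1) * Jmat m n N * ((K⁻¹).val - 1) + (K.val - 1) * Jmat m n N +
        Jmat m n N * ((K⁻¹).val - 1) := by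
    noncomm_ring
  rw [expand]
  exact add_mem (add_mem
    (pDeg_mono (by norm_num) (mul_mem_pDeg (mul_mem_pDeg hK.1 Jmat_mem_pDeg) hK.2))
    (pDeg_mono (by norm_num) (mul_mem_pDeg hK.1 Jmat_mem_pDeg)))
    (pDeg_mono (by norm_num) (mul_mem_pDeg Jmat_mem_pDeg hK.2))

theorem conj_Jmat_eq {K : GL (Idx m n) (Loop N)} (hK : K ∈ unipotentLoops m n N)
    (h : Intertwines (∂ₜ 0) (K.val * Jmat m n N * (K⁻¹).val) (Jmat m n N) (Jmat m n N)) :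
    K.val * Jmat m n N * (K⁻¹).val = Jmat m n N := by
  have sub_mem := conj_Jmat_sub_mem_pDeg hK
  have mem : K.val * Jmat m n N * (K⁻¹).val ∈ pDeg m n N 1 := by
    simpa only [sub_add_cancel] using add_mem (pDeg_mono zero_le_one sub_mem) Jmat_mem_pDeg
  have lie_eq_zero := lie_Jmat_eq_zero_of_lax mem (h.trans (by rw [Ring.lie_def, neg_sub]))
  rw [Ring.lie_def, sub_eq_zero] at lie_eq_zero
  refine eq_Jmat_of_commute sub_mem lie_eq_zero.symm ?_
  rw [Units.conj_pow, Jmat_pow_period, mul_smul_comm, smul_mul_assoc]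

theorem IsS.eq_conj {u : Matrix (Idx m n) (Idx m n) (TSeries N)} {Q : GL (Idx m n) (Loop N)}
    {S : Matrix (Idx m n) (Idx m n) (Loop N)} (hS : IsS u S) (hQ : Q ∈ unipotentLoops m n N)
    (h : Intertwines (∂ₜ 0) Q.val (Jmat m n N) (Jmat m n N + u.map constLoop)) :
    S = Q.val * Jmat m n N * (Q⁻¹).val := by
  obtain ⟨lax, Δ, M, hΔ, hM, conj⟩ := hS
  obtain ⟨g, rfl, hg⟩ := hΔ.exists_unit
  obtain ⟨R, hR⟩ : ∃ R, R = constGL g * M := ⟨_, rfl⟩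
  have R_mem : R ∈ unipotentLoops m n N :=
    hR ▸ mul_mem (constGL_mem_unipotentLoops hΔ hg) hM.mem_unipotentLoops
  have S_eq : S = R.val * Jmat m n N * (R⁻¹).val :=
    (Units.eq_mul_inv_iff_mul_eq R).mpr (by rw [hR]; exact conj)
  have S_lax : Intertwines (∂ₜ 0) S (Jmat m n N + u.map constLoop)
      (Jmat m n N + u.map constLoop) := by
    rw [Intertwines, ← sub_eq_zero, ← lax]
    abel
  have conj_eq : (Q⁻¹ * R).val * Jmat m n N * ((Q⁻¹ * R)⁻¹).val = (Q⁻¹).val * S * Q.val := by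
    rw [S_eq, _root_.mul_inv_rev, inv_inv, Units.val_mul, Units.val_mul]
    noncomm_ring
  have conj_lax : Intertwines (∂ₜ 0) ((Q⁻¹).val * S * Q.val) (Jmat m n N) (Jmat m n N) :=
    (h.inv.mul S_lax).mul h
  have conj_S := conj_Jmat_eq (mul_mem (inv_mem hQ) R_mem) (by rw [conj_eq]; exact conj_lax)
  rw [← conj_S, conj_eq]
  calc S = Q.val * (Q⁻¹).val * S * (Q.val * (Q⁻¹).val) := by rw [Units.mul_inv, one_mul, mul_one]
    _ = _ := by noncomm_ring

/-! ### The solution determined by `f` -/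

theorem IsFactorization.intertwines_minus {f : GL (Idx m n) (LaurentSeries ℂ)}
    {M E : GL (Idx m n) (Loop N)} (h : IsFactorization f M E) (j : Fin (N + 1)) :
    Intertwines (∂ₜ j) M.val (Jmat m n N ^ (2 * (j : ℕ) + 1)) ((laxPow M j).map plusPart) := by
  rw [Intertwines, h.map_pderiv_minus, eq_sub_iff_add_eq', ← add_mul,
    map_plusPart_add_map_minusPart, laxPow, mul_assoc, Units.inv_mul, mul_one]

theorem IsFactorization.intertwines_plus {f : GL (Idx m n) (LaurentSeries ℂ)}
    {M E : GL (Idx m n) (Loop N)} (h : IsFactorization f M E) (j : Fin (N + 1)) :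
    Intertwines (∂ₜ j) E.val 0 ((laxPow M j).map plusPart) := by
  rw [Intertwines, h.map_pderiv_plus, mul_zero, zero_sub]

/-- The operator `S(u, λ)` obtained by dressing `J` with `Δ M`, where `Δ = g`. -/
def dressed (g : GL (Idx m n) (TSeries N)) (M : GL (Idx m n) (Loop N)) :
    Matrix (Idx m n) (Idx m n) (Loop N) :=
  (constGL g * M).val * Jmat m n N * ((constGL g * M)⁻¹).val

/-- `(S^{2j+1})_+ - Δ_t Δ⁻¹`, where `t = t_{2j+1}`. -/
def flowMat (g : GL (Idx m n) (TSeries N)) (M : GL (Idx m n) (Loop N)) (j : Fin (N + 1)) :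
    Matrix (Idx m n) (Idx m n) (Loop N) :=
  (dressed g M ^ (2 * (j : ℕ) + 1)).map plusPart - (g.val.map (∂ₛ j) * (g⁻¹).val).map constLoop

section DressedPowers

variable {M : GL (Idx m n) (Loop N)} {g : GL (Idx m n) (TSeries N)}
  {X : Matrix (Idx m n) (Idx m n) (Loop N)}

theorem mul_map_constLoop_mem {s : Set ℤ} (hX : X ∈ unifSupp s)
    (Y : Matrix (Idx m n) (Idx m n) (TSeries N)) : X * Y.map constLoop ∈ unifSupp s :=
  mul_mem_unifSupp (Set.add_singleton.trans_subset (by simp)) hX (map_constLoop_mem Y)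

theorem map_constLoop_mul_mem {s : Set ℤ} (Y : Matrix (Idx m n) (Idx m n) (TSeries N))
    (hX : X ∈ unifSupp s) : Y.map constLoop * X ∈ unifSupp s :=
  mul_mem_unifSupp (Set.singleton_add.trans_subset (by simp)) (map_constLoop_mem Y) hX

theorem map_plusPart_mul_mul (X : Matrix (Idx m n) (Idx m n) (Loop N))
    (Y Z : Matrix (Idx m n) (Idx m n) (TSeries N)) :
    (Y.map constLoop * X * Z.map constLoop).map plusPart =
      Y.map constLoop * X.map plusPart * Z.map constLoop := by
  refine (eq_of_add_eq_add_of_mem_unifSupp (map_plusPart_mem _)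
    (mul_map_constLoop_mem (map_constLoop_mul_mem Y (map_plusPart_mem X)) Z)
    (map_minusPart_mem (Y.map constLoop * X * Z.map constLoop))
    (mul_map_constLoop_mem (map_constLoop_mul_mem Y (map_minusPart_mem X)) Z) ?_).1
  rw [map_plusPart_add_map_minusPart, ← add_mul, ← mul_add, map_plusPart_add_map_minusPart]

theorem dressed_pow (j : Fin (N + 1)) : dressed g M ^ (2 * (j : ℕ) + 1) =
    g.val.map constLoop * laxPow M j * (g⁻¹).val.map constLoop := by
  rw [dressed, Units.conj_pow, _root_.mul_inv_rev, Units.val_mul, Units.val_mul, constGL_val,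
    constGL_inv_val, laxPow]
  noncomm_ring

theorem flowMat_eq (j : Fin (N + 1)) : flowMat g M j =
    (constGL g).val * (laxPow M j).map plusPart * ((constGL g)⁻¹).val -
      (constGL g).val.map (∂ₜ j) * ((constGL g)⁻¹).val := by
  rw [flowMat, dressed_pow, map_plusPart_mul_mul, constGL_val, constGL_inv_val,
    map_pderiv_map_constLoop, Matrix.map_mul]

theorem flowMat_mem (j : Fin (N + 1)) : flowMat g M j ∈ unifSupp (Set.Ici 0) :=
  sub_mem (map_plusPart_mem _) (unifSupp_mono zero_subset_Ici (map_constLoop_mem _))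

end DressedPowers

section Coefficients

variable {X Y : Matrix (Idx m n) (Idx m n) (Loop N)}

theorem map_lamCoeff_add (k : ℤ) (X Y : Matrix (Idx m n) (Idx m n) (Loop N)) :
    (X + Y).map (lamCoeff k) = X.map (lamCoeff k) + Y.map (lamCoeff k) :=
  Matrix.map_add _ (map_add (lamCoeffHom k)) X Y

theorem map_lamCoeff_sub (k : ℤ) (X Y : Matrix (Idx m n) (Idx m n) (Loop N)) :
    (X - Y).map (lamCoeff k) = X.map (lamCoeff k) - Y.map (lamCoeff k) :=
  Matrix.map_sub _ (map_sub (lamCoeffHom k)) X Y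

theorem map_lamCoeff_map_constLoop_mul (k : ℤ) (Z : Matrix (Idx m n) (Idx m n) (TSeries N)) :
    (Z.map constLoop * X).map (lamCoeff k) = Z * X.map (lamCoeff k) := by
  ext1 a b
  simp only [Matrix.map_apply, Matrix.mul_apply, lamCoeff_sum, lamCoeff_constLoop_mul]

theorem map_lamCoeff_mul_map_constLoop (k : ℤ) (Z : Matrix (Idx m n) (Idx m n) (TSeries N)) :
    (X * Z.map constLoop).map (lamCoeff k) = X.map (lamCoeff k) * Z := by
  ext1 a b
  simp only [Matrix.map_apply, Matrix.mul_apply, lamCoeff_sum, mul_comm (X _ _),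
    lamCoeff_constLoop_mul, mul_comm (lamCoeff _ _)]

theorem map_lamCoeff_zero_map_constLoop (Z : Matrix (Idx m n) (Idx m n) (TSeries N)) :
    (Z.map constLoop).map (lamCoeff 0) = Z :=
  Matrix.ext fun _ _ => (lamCoeff_constLoop 0 _).trans (if_pos rfl)

theorem map_lamCoeff_zero_map_plusPart (X : Matrix (Idx m n) (Idx m n) (Loop N)) :
    (X.map plusPart).map (lamCoeff 0) = X.map (lamCoeff 0) :=
  Matrix.ext fun _ _ => (lamCoeff_plusPart 0 _).trans (if_pos le_rfl)

theorem map_lamCoeff_zero_lamPow_one_smul (hX : X ∈ unifSupp (Set.Ici 0)) :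
    ((lamPow 1 : Loop N) • X).map (lamCoeff 0) = 0 :=
  Matrix.ext fun a b => (lamCoeff_lamPow_mul 0 1 (X a b)).trans (hX a b _ (by norm_num))

theorem map_lamCoeff_zero_connection_mul (u : Matrix (Idx m n) (Idx m n) (TSeries N))
    (hX : X ∈ unifSupp (Set.Ici 0)) :
    ((Jmat m n N + u.map constLoop) * X).map (lamCoeff 0) =
      (bMat m n (TSeries N) + u) * X.map (lamCoeff 0) := by
  rw [Jmat_add_map_constLoop, add_mul, smul_mul_assoc, map_lamCoeff_add,
    map_lamCoeff_zero_lamPow_one_smul (map_constLoop_mul_mem _ hX), zero_add,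
    map_lamCoeff_map_constLoop_mul]

theorem map_lamCoeff_zero_mul_connection (u : Matrix (Idx m n) (Idx m n) (TSeries N))
    (hX : X ∈ unifSupp (Set.Ici 0)) :
    (X * (Jmat m n N + u.map constLoop)).map (lamCoeff 0) =
      X.map (lamCoeff 0) * (bMat m n (TSeries N) + u) := by
  rw [Jmat_add_map_constLoop, mul_add, mul_smul_comm, map_lamCoeff_add,
    map_lamCoeff_zero_lamPow_one_smul (mul_map_constLoop_mem hX _), zero_add,
    map_lamCoeff_mul_map_constLoop]

end Coefficients

/-- The data behind `IsSolutionOf f u`, with `Δ ∈ N⁺` given as a unit `g`. -/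
structure SolutionData (f : GL (Idx m n) (LaurentSeries ℂ)) (M E : GL (Idx m n) (Loop N))
    (q : Matrix (Idx m n) (Idx m n) (TSeries N)) (g : GL (Idx m n) (TSeries N))
    (u : Matrix (Idx m n) (Idx m n) (TSeries N)) : Prop where
  fact : IsFactorization f M E
  plus : Jmat m n N + q.map constLoop = (M.val * Jmat m n N * (M⁻¹).val).map plusPart
  mem : InNplus g.val
  inv_mem : InNplus (g⁻¹).val
  inV : InV u
  gauge : IsGauge g.val q u

theorem IsSolutionOf.exists_solutionData {f : GL (Idx m n) (LaurentSeries ℂ)}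
    {u : Matrix (Idx m n) (Idx m n) (TSeries N)} (h : IsSolutionOf f u) :
    ∃ M E q g, SolutionData f M E q g u := by
  obtain ⟨M, E, q, Δ, fact, plus, hΔ, hV, gauge⟩ := h
  obtain ⟨g, rfl, hg⟩ := hΔ.exists_unit
  exact ⟨M, E, q, g, fact, plus, hΔ, hg, hV, gauge⟩

namespace SolutionData

variable {f : GL (Idx m n) (LaurentSeries ℂ)} {M E : GL (Idx m n) (Loop N)}
  {q u : Matrix (Idx m n) (Idx m n) (TSeries N)} {g : GL (Idx m n) (TSeries N)}

theorem map_plusPart_laxPow_zero (h : SolutionData f M E q g u) :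
    (laxPow M 0).map plusPart = Jmat m n N + q.map constLoop := by
  rw [h.plus, laxPow, Fin.val_zero, mul_zero, zero_add, pow_one]

theorem intertwines_dressing (h : SolutionData f M E q g u) :
    Intertwines (∂ₜ 0) (constGL g * M).val (Jmat m n N) (Jmat m n N + u.map constLoop) := by
  have minus := h.fact.intertwines_minus 0
  rw [h.map_plusPart_laxPow_zero, Fin.val_zero, mul_zero, zero_add, pow_one] at minus
  exact (h.gauge.intertwines h.mem).mul minus

theorem intertwines_wave (h : SolutionData f M E q g u) :
    Intertwines (∂ₜ 0) (constGL g * E).val 0 (Jmat m n N + u.map constLoop) := by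
  have plus := h.fact.intertwines_plus 0
  rw [h.map_plusPart_laxPow_zero] at plus
  exact (h.gauge.intertwines h.mem).mul plus

theorem intertwines_wave_flowMat (h : SolutionData f M E q g u) (j : Fin (N + 1)) :
    Intertwines (∂ₜ j) (constGL g * E).val 0 (flowMat g M j) := by
  rw [flowMat_eq]
  exact (intertwines_gauge _ _ _).mul (h.fact.intertwines_plus j)

theorem isS_dressed (h : SolutionData f M E q g u) : IsS u (dressed g M) := by
  refine ⟨?_, g.val, M, h.mem, h.fact.1, ?_⟩
  · have J_lax : Intertwines (∂ₜ 0) (Jmat m n N) (Jmat m n N) (Jmat m n N) := by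
      rw [Intertwines, map_pderiv_Jmat, sub_self]
    have lax := h.intertwines_dressing.conj J_lax
    rw [Intertwines] at lax
    rw [dressed, lax]
    abel
  · exact (Units.eq_mul_inv_iff_mul_eq (constGL g * M)).mp rfl

theorem eq_dressed (h : SolutionData f M E q g u)
    {S : Matrix (Idx m n) (Idx m n) (Loop N)} (hS : IsS u S) : S = dressed g M :=
  hS.eq_conj (mul_mem (constGL_mem_unipotentLoops h.mem h.inv_mem) h.fact.1.mem_unipotentLoops)
    h.intertwines_dressing

theorem map_pderiv_eq (h : SolutionData f M E q g u) (j : Fin (N + 1)) :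
    u.map (∂ₛ j) = ((flowMat g M j).map (lamCoeff 0)).map (∂ₛ 0) +
      ((bMat m n (TSeries N) + u) * (flowMat g M j).map (lamCoeff 0) -
        (flowMat g M j).map (lamCoeff 0) * (bMat m n (TSeries N) + u)) := by
  have curvature := h.intertwines_wave.zero_curvature (pderiv_comm 0 j)
    (h.intertwines_wave_flowMat j)
  rw [map_derivation_add, map_pderiv_Jmat, zero_add, map_pderiv_map_constLoop] at curvature
  have coeff_zero := congrArg (fun X => X.map (lamCoeff 0)) curvature
  have map_lamCoeff_map_pderiv : ((flowMat g M j).map (∂ₜ 0)).map (lamCoeff 0) =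
      ((flowMat g M j).map (lamCoeff 0)).map (∂ₛ 0) :=
    Matrix.ext fun a b => lamCoeff_pderiv 0 0 (flowMat g M j a b)
  simpa only [map_lamCoeff_add, map_lamCoeff_sub, map_lamCoeff_zero_map_constLoop,
    map_lamCoeff_map_pderiv, map_lamCoeff_zero_connection_mul u (flowMat_mem j),
    map_lamCoeff_zero_mul_connection u (flowMat_mem j)] using coeff_zero

theorem solvesHierarchy (h : SolutionData f M E q g u) : SolvesHierarchy u (dressed g M) := by
  refine ⟨h.inV, fun j => ⟨-(g.val.map (∂ₛ j) * (g⁻¹).val), ?_,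
    (flowMat g M j).map (lamCoeff 0), ?_, h.map_pderiv_eq j⟩⟩
  · have map_sub_one : g.val.map (∂ₛ j) = (g.val - 1).map (∂ₛ j) := by
      rw [map_derivation_sub, map_derivation_one, sub_zero]
    rw [map_sub_one]
    exact ((h.mem.sub_one.map_pderiv j).mul_inNplus h.inv_mem).neg
  · rw [flowMat, map_lamCoeff_sub, map_lamCoeff_zero_map_constLoop, map_lamCoeff_zero_map_plusPart,
      sub_eq_add_neg]

end SolutionData

/-! ### Compressions to `H_-` -/

section vecSupp

variable {ι κ : Type*}

/-- The group of vector valued loops whose components involve only the powers `λ^k`, `k ∈ s`. -/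
def vecSupp (s : Set ℤ) : AddSubgroup (ι → Loop N) where
  carrier := {v | ∀ a, v a ∈ lamSupp s}
  add_mem' hv hw a := add_mem (hv a) (hw a)
  zero_mem' _ := zero_mem _
  neg_mem' hv a := neg_mem (hv a)

theorem vecSupp_mono {s t : Set ℤ} (h : s ⊆ t) : vecSupp s ≤ vecSupp (N := N) (ι := ι) t :=
  fun _ hv a => lamSupp_mono h (hv a)

theorem mulVec_mem_vecSupp [Fintype κ] {s t u : Set ℤ} (h : s + t ⊆ u) {X : Matrix ι κ (Loop N)}
    {v : κ → Loop N} (hX : X ∈ unifSupp s) (hv : v ∈ vecSupp t) : X *ᵥ v ∈ vecSupp u :=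
  fun a => sum_mem fun b _ => mul_mem_lamSupp h (hX a b) (hv b)

end vecSupp

section compress

variable {X Y : Matrix (Idx m n) (Idx m n) (Loop N)} {v : Idx m n → Loop N}

theorem isNeg_iff : IsNeg v ↔ v ∈ vecSupp (Set.Iio 0) := by
  refine ⟨fun h a => ?_, fun h a => plusPart_eq_zero (h a)⟩
  rw [← plusPart_add_minusPart (v a), h a, zero_add]
  exact minusPart_mem _

theorem compress_mem (X : Matrix (Idx m n) (Idx m n) (Loop N)) (v : Idx m n → Loop N) :
    compress X v ∈ vecSupp (Set.Iio 0) :=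
  fun _ => minusPart_mem _

theorem compress_eq_mulVec (h : X *ᵥ v ∈ vecSupp (Set.Iio 0)) : compress X v = X *ᵥ v :=
  funext fun a => minusPart_eq_self (h a)

theorem compress_eq_mulVec_of_mem (hX : X ∈ unifSupp (Set.Iic 0)) (hv : v ∈ vecSupp (Set.Iio 0)) :
    compress X v = X *ᵥ v :=
  compress_eq_mulVec (mulVec_mem_vecSupp Iic_add_Iio_subset hX hv)

theorem compress_eq_zero (hX : X ∈ unifSupp (Set.Ici 0)) (hv : v ∈ vecSupp (Set.Ici 0)) :
    compress X v = 0 :=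
  funext fun a => minusPart_eq_zero (mulVec_mem_vecSupp Ici_add_Ici_subset hX hv a)

theorem compress_one (hv : v ∈ vecSupp (Set.Iio 0)) : compress 1 v = v := by
  rw [compress_eq_mulVec (by rwa [one_mulVec]), one_mulVec]

theorem compress_mulVec (X Y : Matrix (Idx m n) (Idx m n) (Loop N)) (v : Idx m n → Loop N) :
    compress X (Y *ᵥ v) = compress (X * Y) v :=
  funext fun a => by rw [compress, compress, mulVec_mulVec]

theorem compress_add (X : Matrix (Idx m n) (Idx m n) (Loop N)) (v w : Idx m n → Loop N) :
    compress X (v + w) = compress X v + compress X w :=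
  funext fun a => by
    rw [compress, mulVec_add]
    exact map_add minusHom _ _

theorem sub_compress (X Y : Matrix (Idx m n) (Idx m n) (Loop N)) (v : Idx m n → Loop N) :
    compress (X - Y) v = compress X v - compress Y v :=
  funext fun a => by
    rw [compress, sub_mulVec]
    exact map_sub minusHom _ _

theorem neg_compress (X : Matrix (Idx m n) (Idx m n) (Loop N)) (v : Idx m n → Loop N) :
    compress (-X) v = -compress X v :=
  funext fun a => by
    rw [compress, neg_mulVec]
    exact map_neg minusHom _

theorem minusPart_constLoop_mul (c : TSeries N) (x : Loop N) :
    minusPart (constLoop c * x) = constLoop c * minusPart x :=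
  ext_lamCoeff fun k => by
    rw [lamCoeff_minusPart, lamCoeff_constLoop_mul, lamCoeff_constLoop_mul, lamCoeff_minusPart,
      mul_ite, mul_zero]

theorem compress_smul (X : Matrix (Idx m n) (Idx m n) (Loop N)) (c : TSeries N)
    (v : Idx m n → Loop N) : compress X (constLoop c • v) = constLoop c • compress X v :=
  funext fun a => by
    rw [compress, mulVec_smul]
    exact minusPart_constLoop_mul c _

/-- The operator `compress X` as a homomorphism of additive groups. -/
def compressHom (X : Matrix (Idx m n) (Idx m n) (Loop N)) :
    (Idx m n → Loop N) →+ (Idx m n → Loop N) :=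
  AddMonoidHom.mk' (compress X) (compress_add X)

theorem compress_zero (X : Matrix (Idx m n) (Idx m n) (Loop N)) : compress X 0 = 0 :=
  map_zero (compressHom X)

theorem mulVec_sub_compress (X : Matrix (Idx m n) (Idx m n) (Loop N)) (v : Idx m n → Loop N) :
    X *ᵥ v - compress X v = plusPart ∘ (X *ᵥ v) :=
  funext fun _ => sub_eq_of_eq_add (plusPart_add_minusPart _).symm

theorem compress_compress (hX : X ∈ unifSupp (Set.Ici 0))
    (Y : Matrix (Idx m n) (Idx m n) (Loop N)) (v : Idx m n → Loop N) :
    compress X (compress Y v) = compress (X * Y) v := by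
  have plus_mem : Y *ᵥ v - compress Y v ∈ vecSupp (Set.Ici 0) := by
    rw [mulVec_sub_compress]
    exact fun _ => plusPart_mem _
  rw [← compress_mulVec, ← sub_add_cancel (Y *ᵥ v) (compress Y v), compress_add,
    compress_eq_zero hX plus_mem, zero_add]

end compress

/-! ### Truncation in the times -/

section BoundedMod

/-- The vectors all of whose components have order at least `D` in the times. -/
def vecIdeal {ι : Type*} (D : ℕ) : Ideal (ι → Loop N) :=
  Ideal.pi fun _ => tIdeal (Fin (N + 1)) (LaurentSeries ℂ) D

variable {D : ℕ} {P : ℤ} {X : Matrix (Idx m n) (Idx m n) (Loop N)} {v : Idx m n → Loop N}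

theorem minusPart_mem_tIdeal {x : Loop N} (h : x ∈ tIdeal _ (LaurentSeries ℂ) D) :
    minusPart x ∈ tIdeal _ (LaurentSeries ℂ) D := by
  refine mem_tIdeal_of_lamCoeff fun k => ?_
  rw [lamCoeff_minusPart]
  split_ifs
  · exact lamCoeff_mem_tIdeal k h
  · exact zero_mem _

theorem mulVec_mem_vecIdeal (X : Matrix (Idx m n) (Idx m n) (Loop N)) (hv : v ∈ vecIdeal D) :
    X *ᵥ v ∈ vecIdeal D :=
  fun a => (tIdeal _ (LaurentSeries ℂ) D).sum_mem (t := Finset.univ) fun b _ =>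
    Ideal.mul_mem_left _ (X a b) (hv b)

theorem compress_mem_vecIdeal (X : Matrix (Idx m n) (Idx m n) (Loop N)) (hv : v ∈ vecIdeal D) :
    compress X v ∈ vecIdeal D :=
  fun a => minusPart_mem_tIdeal (mulVec_mem_vecIdeal X hv a)

/-- Modulo terms of order at least `D` in the times, the powers of `λ` in `X` are bounded by `P`. -/
def BoundedMod (D : ℕ) (P : ℤ) (X : Matrix (Idx m n) (Idx m n) (Loop N)) : Prop :=
  ∃ Y : Matrix (Idx m n) (Idx m n) (Loop N),
    Y ∈ unifSupp (Set.Iic P) ∧ ∀ a b, (X - Y) a b ∈ tIdeal _ (LaurentSeries ℂ) D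

theorem exists_boundedMod (D : ℕ) (X : Matrix (Idx m n) (Idx m n) (Loop N)) :
    ∃ P : ℕ, BoundedMod D P X := by
  obtain ⟨P, hP⟩ := (((Set.finite_univ (α := Idx m n × Idx m n)).prod
    (Finsupp.finite_of_degree_le (σ := Fin (N + 1)) D)).image
      fun p => (-(coeff p.2 (X p.1.1 p.1.2)).order).toNat).bddAbove
  refine ⟨P, of fun a b d => if d.degree < D then coeff d (X a b) else 0, fun a b k hk => ?_,
    fun a b d hd => ?_⟩
  · ext d
    rw [coeff_lamCoeff, map_zero]
    change HahnSeries.coeff (if d.degree < D then coeff d (X a b) else 0) (-k) = 0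
    split_ifs with hd
    · have order_bound : (-(coeff d (X a b)).order).toNat ≤ P :=
        hP ⟨((a, b), d), ⟨Set.mem_univ _, hd.le⟩, rfl⟩
      rw [Set.mem_Iic] at hk
      exact HahnSeries.coeff_eq_zero_of_lt_order (by omega)
    · exact HahnSeries.coeff_zero
  · rw [Matrix.sub_apply, map_sub, sub_eq_zero]
    exact (if_pos hd).symm

theorem BoundedMod.compress_sub_mem (h : BoundedMod D P X) (hv : v ∈ vecSupp (Set.Iio (-P))) :
    compress X v - X *ᵥ v ∈ vecIdeal D := by
  obtain ⟨Y, hY, sub_mem_tIdeal⟩ := h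
  have bounds : Set.Iic P + Set.Iio (-P) ⊆ Set.Iio 0 :=
    (Set.Iic_add_Iio_subset P (-P)).trans (by rw [add_neg_cancel])
  have compress_Y := compress_eq_mulVec (mulVec_mem_vecSupp bounds hY hv)
  have sub_mulVec_mem : (X - Y) *ᵥ v ∈ vecIdeal D :=
    fun a => (tIdeal _ (LaurentSeries ℂ) D).sum_mem (t := Finset.univ) fun b _ =>
      Ideal.mul_mem_right (v b) _ (sub_mem_tIdeal a b)
  have eq_sub : compress X v - X *ᵥ v = compress (X - Y) v - (X - Y) *ᵥ v := by
    rw [sub_compress, sub_mulVec, compress_Y, sub_sub_sub_cancel_right]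
  rw [eq_sub]
  exact sub_mem (fun a => minusPart_mem_tIdeal (sub_mulVec_mem a)) sub_mulVec_mem

/-- The operator `d(a) d(a⁻¹)` on `H_-`, whose determinant is the tau function. -/
def tauOp (a : GL (Idx m n) (Loop N)) : (Idx m n → Loop N) →+ (Idx m n → Loop N) :=
  (compressHom a.val).comp (compressHom (a⁻¹).val)

theorem tauOp_apply (a : GL (Idx m n) (Loop N)) (v : Idx m n → Loop N) :
    tauOp a v = compress a.val (compress (a⁻¹).val v) := rfl

theorem tauOp_smul (a : GL (Idx m n) (Loop N)) (c : TSeries N) (v : Idx m n → Loop N) :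
    tauOp a (constLoop c • v) = constLoop c • tauOp a v := by
  rw [tauOp_apply, tauOp_apply, compress_smul, compress_smul]

/-- `d(a⁻¹)` multiplies by `a⁻¹` far away from the positive powers of `λ`, so `d(a) d(a⁻¹)` acts
as the identity there. -/
theorem tauOp_sub_mem {a : GL (Idx m n) (Loop N)} {P : ℕ} (h : BoundedMod D P (a⁻¹).val)
    (hv : v ∈ vecSupp (Set.Iio (-(P : ℤ)))) : tauOp a v - v ∈ vecIdeal D := by
  have hv_neg : v ∈ vecSupp (Set.Iio 0) := vecSupp_mono (Set.Iio_subset_Iio (by omega)) hv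
  have compress_inverse : compress a.val ((a⁻¹).val *ᵥ v) = v := by
    rw [compress_mulVec, Units.mul_inv, compress_one hv_neg]
  have difference : tauOp a v - v =
      compress a.val (compress (a⁻¹).val v - (a⁻¹).val *ᵥ v) := by
    conv_lhs => rw [← compress_inverse]
    exact (map_sub (compressHom a.val) _ _).symm.trans (by rw [compress_inverse]; rfl)
  rw [difference]
  exact compress_mem_vecIdeal _ (h.compress_sub_mem hv)

end BoundedMod

/-! ### Coordinates and finite sections -/

section Sections

variable {K : ℕ}

/-- The coordinate of a vector along the basis vector `λ^{-(k+1)} e_b` of `H_-`. -/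
def coord (p : ℕ × Idx m n) : (Idx m n → Loop N) →+ TSeries N :=
  (lamCoeffHom (-((p.1 : ℤ) + 1))).comp (Pi.evalAddMonoidHom _ p.2)

theorem coord_apply (p : ℕ × Idx m n) (v : Idx m n → Loop N) :
    coord p v = lamCoeff (-((p.1 : ℤ) + 1)) (v p.2) := rfl

theorem coord_smul (p : ℕ × Idx m n) (c : TSeries N) (v : Idx m n → Loop N) :
    coord p (constLoop c • v) = c * coord p v :=
  lamCoeff_constLoop_mul _ _ _

theorem lamCoeff_negBasis (k : ℤ) (q : ℕ × Idx m n) (a : Idx m n) :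
    lamCoeff k (negBasis (N := N) q a) = if k = -((q.1 : ℤ) + 1) ∧ a = q.2 then 1 else 0 := by
  rw [negBasis]
  by_cases ha : a = q.2
  · subst ha
    rw [Pi.single_eq_same, lamCoeff_lamPow]
    simp only [and_true]
  · rw [Pi.single_eq_of_ne ha, lamCoeff_zero, if_neg fun h => ha h.2]

theorem coord_negBasis (p q : ℕ × Idx m n) :
    coord p (negBasis (N := N) q) = if p = q then 1 else 0 := by
  rw [coord_apply, lamCoeff_negBasis]
  simp only [neg_inj, add_left_inj, Nat.cast_inj, Prod.ext_iff]

theorem negBasis_mem (q : ℕ × Idx m n) : negBasis (N := N) q ∈ vecSupp {-((q.1 : ℤ) + 1)} :=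
  fun a k hk => by rw [lamCoeff_negBasis, if_neg fun index_eq => hk index_eq.1]

theorem negBasis_mem_Iio {P : ℕ} {q : ℕ × Idx m n} (h : P ≤ q.1) :
    negBasis (N := N) q ∈ vecSupp (Set.Iio (-(P : ℤ))) :=
  vecSupp_mono (Set.singleton_subset_iff.mpr (Set.mem_Iio.mpr (by omega))) (negBasis_mem q)

theorem mulVec_negBasis (X : Matrix (Idx m n) (Idx m n) (Loop N)) (q : ℕ × Idx m n)
    (c : Idx m n) : (X *ᵥ negBasis q) c = lamPow (-((q.1 : ℤ) + 1)) * X c q.2 := by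
  rw [negBasis, mulVec_single, mul_comm]
  rfl

theorem coord_compress (p : ℕ × Idx m n) (X : Matrix (Idx m n) (Idx m n) (Loop N))
    (v : Idx m n → Loop N) : coord p (compress X v) = coord p (X *ᵥ v) := by
  rw [coord_apply, coord_apply, compress, lamCoeff_minusPart, if_pos (by omega)]

theorem coord_mem_tIdeal {D : ℕ} (p : ℕ × Idx m n) {v : Idx m n → Loop N} (hv : v ∈ vecIdeal D) :
    coord p v ∈ tIdeal _ ℂ D :=
  lamCoeff_mem_tIdeal _ (hv _)

theorem coord_eq_zero {s : Set ℤ} {p : ℕ × Idx m n} (hp : -((p.1 : ℤ) + 1) ∉ s)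
    {v : Idx m n → Loop N} (hv : v ∈ vecSupp s) : coord p v = 0 :=
  hv _ _ hp

/-- The index in the basis of `H_-` of an index of the finite section of size `K`. -/
def secIdx : Fin K × Idx m n → ℕ × Idx m n := Prod.map Fin.val id

theorem secIdx_fst (p : Fin K × Idx m n) : (secIdx p).1 = p.1 := rfl

theorem secIdx_injective : Function.Injective (secIdx (m := m) (n := n) (K := K)) :=
  Fin.val_injective.prodMap Function.injective_id

/-- The projection of `H_-` to the span of the basis vectors `λ^{-(k+1)} e_b` with `k < K`. -/
def head (K : ℕ) : (Idx m n → Loop N) →+ (Idx m n → Loop N) :=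
  AddMonoidHom.mk' (fun v => ∑ p : Fin K × Idx m n,
      constLoop (coord (secIdx p) v) • negBasis (secIdx p))
    fun v w => by simp only [map_add, add_smul, Finset.sum_add_distrib]

/-- The projection of `H_-` complementary to `head`. -/
def tail (K : ℕ) : (Idx m n → Loop N) →+ (Idx m n → Loop N) := AddMonoidHom.id _ - head K

theorem head_apply (v : Idx m n → Loop N) : head K v =
    ∑ p : Fin K × Idx m n, constLoop (coord (secIdx p) v) • negBasis (secIdx p) := rfl

theorem tail_apply (v : Idx m n → Loop N) : tail K v = v - head K v := rfl

theorem head_add_tail (K : ℕ) (v : Idx m n → Loop N) : head K v + tail K v = v :=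
  add_sub_cancel _ _

theorem coord_head (p : Fin K × Idx m n) (v : Idx m n → Loop N) :
    coord (secIdx p) (head K v) = coord (secIdx p) v := by
  simp only [head_apply, map_sum, coord_smul, coord_negBasis, secIdx_injective.eq_iff, mul_ite,
    mul_one, mul_zero, Finset.sum_ite_eq, Finset.mem_univ, if_true]

theorem coord_tail (p : Fin K × Idx m n) (v : Idx m n → Loop N) :
    coord (secIdx p) (tail K v) = 0 := by
  rw [tail_apply, map_sub, coord_head, sub_self]

theorem head_negBasis (q : Fin K × Idx m n) :
    head K (negBasis (secIdx q)) = negBasis (N := N) (secIdx q) := by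
  simp only [head_apply, coord_negBasis, secIdx_injective.eq_iff, apply_ite constLoop, map_one,
    map_zero, ite_smul, one_smul, zero_smul, Finset.sum_ite_eq', Finset.mem_univ, if_true]

theorem head_mem {v : Idx m n → Loop N} : head K v ∈ vecSupp (Set.Iio 0) := by
  refine sum_mem fun p _ b => mul_mem_lamSupp ?_ (constLoop_mem _) (negBasis_mem (secIdx p) b)
  rw [Set.singleton_add_singleton, zero_add, Set.singleton_subset_iff, Set.mem_Iio]
  omega

theorem tail_mem (K : ℕ) {v : Idx m n → Loop N} (hv : v ∈ vecSupp (Set.Iio 0)) :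
    tail K v ∈ vecSupp (Set.Iio (-(K : ℤ))) := by
  intro a k hk
  rw [Set.mem_Iio, not_lt] at hk
  by_cases hk_neg : k < 0
  · have index_eq : -((((-k - 1).toNat : ℕ) : ℤ) + 1) = k := by omega
    have coord_eq := coord_tail (K := K) (⟨(-k - 1).toNat, by omega⟩, a) v
    rwa [coord_apply, secIdx_fst, index_eq] at coord_eq
  · exact sub_mem hv head_mem a k hk_neg

theorem tail_mem_vecIdeal {D : ℕ} {v : Idx m n → Loop N} (hv : v ∈ vecIdeal D) :
    tail K v ∈ vecIdeal D := by
  refine sub_mem hv (sum_mem fun p _ a => Ideal.mul_mem_right _ _ (mem_tIdeal_of_lamCoeff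
    fun k => ?_))
  rw [lamCoeff_constLoop]
  split_ifs
  · exact coord_mem_tIdeal _ hv
  · exact zero_mem _

/-- The finite section of size `K` of the matrix of an operator on `H_-`. -/
def sec (K : ℕ) (T : (Idx m n → Loop N) → (Idx m n → Loop N)) :
    Matrix (Fin K × Idx m n) (Fin K × Idx m n) (TSeries N) :=
  of fun p q => opEntry T (secIdx p) (secIdx q)

theorem sec_apply (T : (Idx m n → Loop N) → (Idx m n → Loop N)) (p q : Fin K × Idx m n) :
    sec K T p q = coord (secIdx p) (T (negBasis (secIdx q))) := rfl

/-- Finite sections are multiplicative up to the contribution of the discarded coordinates. -/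
theorem sec_comp {T : (Idx m n → Loop N) →+ (Idx m n → Loop N)}
    (hT : ∀ (c : TSeries N) v, T (constLoop c • v) = constLoop c • T v)
    (U : (Idx m n → Loop N) → (Idx m n → Loop N)) :
    sec K (T ∘ U) = sec K T * sec K U + sec K (T ∘ tail K ∘ U) := by
  ext1 p q
  rw [sec_apply, Function.comp_apply, ← head_add_tail K (U (negBasis (secIdx q))), map_add,
    map_add, head_apply, map_sum, map_sum, Matrix.add_apply, Matrix.mul_apply]
  refine congrArg (· + _) (Finset.sum_congr rfl fun s _ => ?_)
  rw [hT, coord_smul, mul_comm, sec_apply, sec_apply]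

theorem sec_mulVecLin_comp (X : Matrix (Idx m n) (Idx m n) (Loop N))
    (U : (Idx m n → Loop N) → (Idx m n → Loop N)) :
    sec K (X.mulVecLin ∘ U) = sec K X.mulVecLin * sec K U + sec K (X.mulVecLin ∘ tail K ∘ U) :=
  sec_comp (T := X.mulVecLin.toAddMonoidHom) (fun c => mulVec_smul X (constLoop c)) U

end Sections

/-! ### The time derivatives of `d(a) d(a⁻¹)` -/

theorem derivation_comp_mulVec {A R ι κ : Type*} [CommSemiring A] [CommRing R] [Algebra A R]
    [Fintype κ] (D : Derivation A R R) (X : Matrix ι κ R) (v : κ → R) :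
    D ∘ (X *ᵥ v) = X.map D *ᵥ v + X *ᵥ (D ∘ v) := by
  ext1 a
  simp only [Function.comp_apply, mulVec, dotProduct, map_sum, Derivation.leibniz, Pi.add_apply,
    Matrix.map_apply, smul_eq_mul, ← Finset.sum_add_distrib]
  exact Finset.sum_congr rfl fun b _ => by ring

theorem pderiv_comp_compress (j : Fin (N + 1)) (X : Matrix (Idx m n) (Idx m n) (Loop N))
    (v : Idx m n → Loop N) :
    ∂ₜ j ∘ compress X v = compress (X.map (∂ₜ j)) v + compress X (∂ₜ j ∘ v) := by
  ext1 a
  rw [Function.comp_apply, compress, ← minusPart_pderiv]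
  change minusPart ((∂ₜ j ∘ (X *ᵥ v)) a) = _
  rw [derivation_comp_mulVec]
  exact map_add minusHom _ _

theorem pderiv_comp_negBasis (j : Fin (N + 1)) (q : ℕ × Idx m n) :
    ∂ₜ j ∘ negBasis q = (0 : Idx m n → Loop N) := by
  ext1 a
  rw [Function.comp_apply, negBasis, Pi.zero_apply]
  by_cases ha : a = q.2
  · subst ha
    rw [Pi.single_eq_same, pderiv_lamPow]
  · rw [Pi.single_eq_of_ne ha, map_zero (∂ₜ j)]

theorem Jmat_pow_mem_Ici (k : ℕ) : Jmat m n N ^ k ∈ unifSupp (Set.Ici 0) :=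
  unifSupp_mono Set.Icc_subset_Ici_self (Jmat_pow_mem k)

theorem Jmat_pow_mem_Iic (k : ℕ) : Jmat m n N ^ k ∈ unifSupp (Set.Iic (k : ℤ)) :=
  unifSupp_mono Set.Icc_subset_Iic_self (Jmat_pow_mem k)

/-- The operator `d(M)⁻¹ d(M X)` on `H_-`, for `M` in `G_-`. -/
def shifted (M : GL (Idx m n) (Loop N)) (X : Matrix (Idx m n) (Idx m n) (Loop N))
    (v : Idx m n → Loop N) : Idx m n → Loop N :=
  (M⁻¹).val *ᵥ compress (M.val * X) v

section TauDerivative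

variable {f : GL (Idx m n) (LaurentSeries ℂ)} {M E : GL (Idx m n) (Loop N)}

theorem IsMinus.shifted_mem (h : IsMinus M) (X : Matrix (Idx m n) (Idx m n) (Loop N))
    (v : Idx m n → Loop N) : shifted M X v ∈ vecSupp (Set.Iio 0) :=
  mulVec_mem_vecSupp Iic_add_Iio_subset h.inv_mem (compress_mem _ _)

theorem compress_shifted (M : GL (Idx m n) (Loop N)) (X : Matrix (Idx m n) (Idx m n) (Loop N))
    (v : Idx m n → Loop N) : compress M.val (shifted M X v) = compress (M.val * X) v := by
  rw [shifted, compress_mulVec, Units.mul_inv, compress_one (compress_mem _ _)]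

theorem compress_inv_mul (M : GL (Idx m n) (Loop N)) (hE : IsPlus E)
    (X : Matrix (Idx m n) (Idx m n) (Loop N)) (v : Idx m n → Loop N) :
    compress (((M⁻¹ * E)⁻¹).val * X) v = compress ((M⁻¹ * E)⁻¹).val (shifted M X v) := by
  rw [_root_.mul_inv_rev, inv_inv, Units.val_mul, mul_assoc, ← compress_compress hE.inv_mem,
    ← compress_compress hE.inv_mem, compress_shifted]

theorem IsFactorization.pderiv_comp_tauOp_negBasis (h : IsFactorization f M E) (j : Fin (N + 1))
    (q : ℕ × Idx m n) : ∂ₜ j ∘ tauOp (M⁻¹ * E) (negBasis q) =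
      -compress (Jmat m n N ^ (2 * (j : ℕ) + 1)) (tauOp (M⁻¹ * E) (negBasis q)) +
        tauOp (M⁻¹ * E) (shifted M (Jmat m n N ^ (2 * (j : ℕ) + 1)) (negBasis q)) := by
  obtain ⟨J', hJ'⟩ : ∃ J', J' = Jmat m n N ^ (2 * (j : ℕ) + 1) := ⟨_, rfl⟩
  have map_quotient : (M⁻¹ * E).val.map (∂ₜ j) = -(J' * (M⁻¹ * E).val) :=
    hJ' ▸ h.map_pderiv_quotient j
  have map_inverse : ((M⁻¹ * E)⁻¹).val.map (∂ₜ j) = ((M⁻¹ * E)⁻¹).val * J' := by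
    rw [map_derivation_inv, map_quotient, mul_neg, neg_mul, neg_neg, mul_assoc, mul_assoc,
      Units.mul_inv, mul_one]
  have compress_J (v) : compress J' (tauOp (M⁻¹ * E) v) =
      compress (J' * (M⁻¹ * E).val) (compress ((M⁻¹ * E)⁻¹).val v) :=
    compress_compress (hJ' ▸ Jmat_pow_mem_Ici _) _ _
  rw [← hJ', compress_J, ← neg_compress, ← map_quotient, tauOp_apply, tauOp_apply,
    pderiv_comp_compress, pderiv_comp_compress, pderiv_comp_negBasis, compress_zero, add_zero,
    map_inverse, compress_inv_mul M h.2.1]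

theorem IsFactorization.map_pderiv_sec_tauOp (h : IsFactorization f M E) (j : Fin (N + 1))
    (K : ℕ) : (sec K (tauOp (M⁻¹ * E))).map (∂ₛ j) =
      -sec K ((Jmat m n N ^ (2 * (j : ℕ) + 1)).mulVecLin ∘ tauOp (M⁻¹ * E)) +
        sec K (tauOp (M⁻¹ * E) ∘ shifted M (Jmat m n N ^ (2 * (j : ℕ) + 1))) := by
  ext1 p q
  rw [Matrix.map_apply, sec_apply, coord_apply, ← lamCoeff_pderiv]
  change coord (secIdx p) (∂ₜ j ∘ _) = _
  rw [h.pderiv_comp_tauOp_negBasis, map_add, map_neg, coord_compress]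
  rfl

/-! ### The determinant of a finite section -/

section DerivationDet

variable {A R ι : Type*} [CommSemiring A] [CommRing R] [Algebra A R] [Fintype ι] [DecidableEq ι]
  {I : Ideal R} {X Y : Matrix ι ι R} {s : Set ι}

theorem adjugate_apply_mem {p q : ι} (hX : ∀ l, (X - 1) l q ∈ I) (hpq : p ≠ q) :
    X.adjugate p q ∈ I := by
  have eq_neg : X.adjugate p q = -(X.adjugate * (X - 1)) p q := by
    rw [mul_sub, adjugate_mul, mul_one, Matrix.sub_apply, Matrix.smul_apply, one_apply_ne hpq,
      smul_zero, zero_sub, neg_neg]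
  rw [eq_neg]
  exact neg_mem (sum_mem fun l _ => I.mul_mem_left _ (hX l))

/-- The rows outside `s` and the columns in `s` of `Y` vanish modulo `I`, so `Y` meets only entries
`(p, q)` of the adjugate with `q ∈ s` and `p ∉ s`. -/
theorem trace_adjugate_mul_mem (hX : ∀ p, ∀ q ∈ s, (X - 1) p q ∈ I)
    (hY : ∀ p q, p ∉ s ∨ q ∈ s → Y p q ∈ I) : (X.adjugate * Y).trace ∈ I := by
  refine sum_mem fun p _ => sum_mem fun q _ => ?_
  by_cases h : q ∉ s ∨ p ∈ s
  · exact I.mul_mem_left _ (hY q p h)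
  · rw [not_or, not_not] at h
    exact I.mul_mem_right _ (adjugate_apply_mem (fun l => hX l q h.1) fun e => h.2 (e ▸ h.1))

theorem derivation_det_sub_mem (D : Derivation A R R) {B C Z : Matrix ι ι R}
    (hD : X.map D = -(B * X + Y) + (X * C + Z)) (hX : ∀ p, ∀ q ∈ s, (X - 1) p q ∈ I)
    (hY : ∀ p q, p ∉ s ∨ q ∈ s → Y p q ∈ I) (hZ : ∀ p q, Z p q ∈ I) :
    D X.det - X.det * (C.trace - B.trace) ∈ I := by
  have trace_B : (X.adjugate * (B * X)).trace = X.det * B.trace := by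
    rw [trace_mul_comm, mul_assoc, mul_adjugate, mul_smul_comm, mul_one, trace_smul, smul_eq_mul]
  have trace_C : (X.adjugate * (X * C)).trace = X.det * C.trace := by
    rw [← mul_assoc, adjugate_mul, smul_mul_assoc, one_mul, trace_smul, smul_eq_mul]
  have difference : D X.det - X.det * (C.trace - B.trace) =
      (X.adjugate * Z).trace - (X.adjugate * Y).trace := by
    rw [derivation_det, hD, mul_add, mul_neg, mul_add, mul_add, trace_add, trace_neg, trace_add,
      trace_add, trace_B, trace_C]
    ring
  rw [difference]
  exact sub_mem (sum_mem fun p _ => sum_mem fun q _ => I.mul_mem_left _ (hZ q p))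
    (trace_adjugate_mul_mem hX hY)

end DerivationDet

section SectionDerivative

variable {a : GL (Idx m n) (Loop N)} {D P K : ℕ}

theorem tauOp_negBasis_sub_mem (hP : BoundedMod D P (a⁻¹).val) {q : ℕ × Idx m n} (hq : P ≤ q.1) :
    tauOp a (negBasis q) - negBasis q ∈ vecIdeal D :=
  tauOp_sub_mem hP (negBasis_mem_Iio hq)

theorem sec_tauOp_sub_one_mem (hP : BoundedMod D P (a⁻¹).val) (p : Fin K × Idx m n)
    {q : Fin K × Idx m n} (hq : P ≤ q.1) : (sec K (tauOp a) - 1) p q ∈ tIdeal _ ℂ D := by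
  have mem := coord_mem_tIdeal (secIdx p) (tauOp_negBasis_sub_mem hP (q := secIdx q) hq)
  rwa [map_sub, coord_negBasis, if_congr secIdx_injective.eq_iff rfl rfl, ← one_apply] at mem

theorem sec_mulVec_tail_tauOp_mem (hP : BoundedMod D P (a⁻¹).val) {k : ℕ} (hK : P + k ≤ K)
    {X : Matrix (Idx m n) (Idx m n) (Loop N)} (hX : X ∈ unifSupp (Set.Iic (k : ℤ)))
    {p q : Fin K × Idx m n} (h : ¬ P ≤ p.1 ∨ P ≤ q.1) :
    sec K (X.mulVecLin ∘ tail K ∘ tauOp a) p q ∈ tIdeal _ ℂ D := by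
  rw [sec_apply]
  rcases h with hp | hq
  · have mem : X *ᵥ tail K (tauOp a (negBasis (secIdx q))) ∈
        vecSupp (Set.Iio ((k : ℤ) + -(K : ℤ))) :=
      mulVec_mem_vecSupp (Set.Iic_add_Iio_subset _ _) hX (tail_mem K (compress_mem _ _))
    have coord_zero := coord_eq_zero (p := secIdx p)
      (by rw [Set.mem_Iio, secIdx_fst]; omega) mem
    exact coord_zero ▸ zero_mem _
  · have tail_eq : tail K (tauOp a (negBasis (secIdx q))) =
        tail K (tauOp a (negBasis (secIdx q)) - negBasis (secIdx q)) := by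
      rw [map_sub, tail_apply (negBasis _), head_negBasis, sub_self, sub_zero]
    refine coord_mem_tIdeal _ (mulVec_mem_vecIdeal X ?_)
    rw [Function.comp_apply, tail_eq]
    exact tail_mem_vecIdeal (tauOp_negBasis_sub_mem hP hq)

theorem sec_tauOp_tail_shifted_mem (hP : BoundedMod D P (a⁻¹).val) (hK : P ≤ K) (hM : IsMinus M)
    (X : Matrix (Idx m n) (Idx m n) (Loop N)) (p q : Fin K × Idx m n) :
    sec K (tauOp a ∘ tail K ∘ shifted M X) p q ∈ tIdeal _ ℂ D := by
  have tail_shifted_mem : tail K (shifted M X (negBasis (secIdx q))) ∈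
      vecSupp (Set.Iio (-(P : ℤ))) :=
    vecSupp_mono (Set.Iio_subset_Iio (by omega)) (tail_mem K (hM.shifted_mem X _))
  have mem := coord_mem_tIdeal (secIdx p) (tauOp_sub_mem hP tail_shifted_mem)
  rwa [map_sub, coord_tail, sub_zero] at mem

end SectionDerivative

theorem IsFactorization.pderiv_det_sec_sub_mem (h : IsFactorization f M E) (j : Fin (N + 1))
    {D P K : ℕ} (hP : BoundedMod D P ((M⁻¹ * E)⁻¹).val) (hK : P + (2 * (j : ℕ) + 1) ≤ K) :
    ∂ₛ j (sec K (tauOp (M⁻¹ * E))).det - (sec K (tauOp (M⁻¹ * E))).det *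
      ((sec K (shifted M (Jmat m n N ^ (2 * (j : ℕ) + 1)))).trace -
        (sec K (Jmat m n N ^ (2 * (j : ℕ) + 1)).mulVecLin).trace) ∈ tIdeal _ ℂ D := by
  have section_derivative := h.map_pderiv_sec_tauOp j K
  rw [sec_mulVecLin_comp, sec_comp (tauOp_smul _)] at section_derivative
  exact derivation_det_sub_mem (s := {p : Fin K × Idx m n | P ≤ p.1}) _ section_derivative
    (fun p q hq => sec_tauOp_sub_one_mem hP p hq)
    (fun p q => sec_mulVec_tail_tauOp_mem hP hK (Jmat_pow_mem_Iic _))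
    (sec_tauOp_tail_shifted_mem hP (by omega) h.1 (Jmat m n N ^ (2 * (j : ℕ) + 1)))

end TauDerivative

/-! ### The trace of a finite section -/

theorem lamDer_mem_Ici {a : Loop N} (h : a ∈ lamSupp (Set.Ici 0)) :
    lamDer a ∈ lamSupp (Set.Ici 0) := by
  intro k hk
  rw [Set.mem_Ici, not_le] at hk
  rw [lamCoeff_lamDer]
  rcases eq_or_ne k (-1) with rfl | hk'
  · rw [neg_add_cancel, zero_smul]
  · rw [h (k + 1) (by rw [Set.mem_Ici]; omega), smul_zero]

theorem lamCoeff_lamPow_mul_plusPart (i l : ℤ) (a : Loop N) :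
    lamCoeff i (lamPow l * plusPart (lamPow (-l) * a)) = if l ≤ i then lamCoeff i a else 0 := by
  rw [lamCoeff_lamPow_mul, lamCoeff_plusPart, lamCoeff_lamPow_mul, sub_neg_eq_add, sub_add_cancel]
  exact if_congr sub_nonneg rfl rfl

/-- The power `λ^i` of `a` survives in the terms with `l < i`, so it is counted `i` times. -/
theorem sum_lamPow_mul_plusPart {K : ℕ} {a : Loop N} (ha : a ∈ lamSupp (Set.Iic (K : ℤ))) :
    ∑ l : Fin K, lamPow ((l : ℤ) + 1) * plusPart (lamPow (-((l : ℤ) + 1)) * a) =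
      plusPart (lamPow 1 * lamDer a) := by
  refine ext_lamCoeff fun i => ?_
  rw [lamCoeff_sum, lamCoeff_plusPart, lamCoeff_lamPow_mul, lamCoeff_lamDer, sub_add_cancel]
  simp only [lamCoeff_lamPow_mul_plusPart]
  rcases lt_or_ge i 0 with hi | hi
  · rw [if_neg hi.not_ge]
    exact Finset.sum_eq_zero fun l _ => if_neg (by omega)
  obtain ⟨i, rfl⟩ := Int.eq_ofNat_of_zero_le hi
  rw [if_pos hi]
  rcases le_or_gt i K with hK | hK
  · simp only [Int.add_one_le_iff, Nat.cast_lt]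
    rw [← Finset.sum_filter, Finset.sum_const, Fin.card_filter_val_lt, min_eq_right hK,
      natCast_zsmul]
  · rw [ha i (by rw [Set.mem_Iic]; omega), smul_zero]
    exact Finset.sum_eq_zero fun _ _ => ite_self _

theorem lamCoeff_zero_mul_plusPart {a : Loop N} (ha : a ∈ lamSupp (Set.Iic 0)) (b : Loop N) :
    lamCoeff 0 (a * plusPart b) = lamCoeff 0 (a * b) := by
  have minus_zero : lamCoeff 0 (a * minusPart b) = 0 :=
    mul_mem_lamSupp Iic_add_Iio_subset ha (minusPart_mem b) 0 Set.self_notMem_Iio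
  conv_rhs => rw [← plusPart_add_minusPart b, mul_add, lamCoeff_add, minus_zero, add_zero]

/-- The coefficient `-⟨M⁻¹, ∂_λ (M X)⟩_{-1}`, which for `X = J^{2j+1}` is the logarithmic
derivative of the tau function along `t_{2j+1}`. -/
def tauLog (M : GL (Idx m n) (Loop N)) (X : Matrix (Idx m n) (Idx m n) (Loop N)) : TSeries N :=
  -pairing (-1) (M⁻¹).val ((M.val * X).map lamDer)

section TraceSection

variable {M : GL (Idx m n) (Loop N)} {K : ℕ}

theorem mulVec_sub_shifted (M : GL (Idx m n) (Loop N))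
    (X : Matrix (Idx m n) (Idx m n) (Loop N)) (v : Idx m n → Loop N) :
    X *ᵥ v - shifted M X v = (M⁻¹).val *ᵥ (plusPart ∘ ((M.val * X) *ᵥ v)) := by
  rw [← mulVec_sub_compress, mulVec_sub, mulVec_mulVec, ← mul_assoc, Units.inv_mul, one_mul,
    shifted]

theorem sec_mulVecLin_sub_sec_shifted_apply_self (M : GL (Idx m n) (Loop N))
    (X : Matrix (Idx m n) (Idx m n) (Loop N)) (p : Fin K × Idx m n) :
    sec K X.mulVecLin p p - sec K (shifted M X) p p =
      ∑ c, lamCoeff 0 ((M⁻¹).val p.2 c * (lamPow ((p.1 : ℤ) + 1) *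
        plusPart (lamPow (-((p.1 : ℤ) + 1)) * (M.val * X) c p.2))) := by
  rw [sec_apply, sec_apply, ← map_sub, mulVecLin_apply, mulVec_sub_shifted, coord_apply, mulVec,
    dotProduct, lamCoeff_sum]
  refine Finset.sum_congr rfl fun c _ => ?_
  rw [mul_left_comm, lamCoeff_lamPow_mul, zero_sub, Function.comp_apply, mulVec_negBasis]
  rfl

theorem IsMinus.trace_sec_shifted (h : IsMinus M) {X : Matrix (Idx m n) (Idx m n) (Loop N)}
    (hX : X ∈ unifSupp (Set.Iic (K : ℤ))) :
    (sec K (shifted M X)).trace - (sec K X.mulVecLin).trace = tauLog M X := by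
  have mul_mem : M.val * X ∈ unifSupp (Set.Iic (K : ℤ)) :=
    mul_mem_unifSupp ((Set.Iic_add_Iic_subset 0 _).trans (by rw [zero_add])) h.mem hX
  rw [tauLog, ← neg_sub, neg_inj, ← trace_sub, Matrix.trace, Fintype.sum_prod_type_right, pairing,
    Matrix.trace, lamCoeff_sum]
  refine Finset.sum_congr rfl fun b _ => ?_
  simp only [diag_apply, Matrix.sub_apply, sec_mulVecLin_sub_sec_shifted_apply_self]
  rw [Finset.sum_comm, Matrix.mul_apply, lamCoeff_sum]
  refine Finset.sum_congr rfl fun c _ => ?_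
  rw [← lamCoeff_sum, ← Finset.mul_sum, sum_lamPow_mul_plusPart (mul_mem c b),
    lamCoeff_zero_mul_plusPart (h.inv_mem b c), mul_left_comm, lamCoeff_lamPow_mul, zero_sub,
    Matrix.map_apply]

end TraceSection

/-! ### The tau function as a determinant -/

theorem HasDet.congr {c : TSeries N} {r s : (Idx m n → Loop N) → (Idx m n → Loop N)}
    (h : HasDet r c) (hrs : ∀ v ∈ vecSupp (Set.Iio 0), r v = s v) : HasDet s c := by
  have on_basis (p) : r (negBasis p) = s (negBasis p) :=
    hrs _ (negBasis_mem_Iio (P := 0) (Nat.zero_le p.1))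
  simpa only [HasDet, opEntry, on_basis] using h

theorem EqScalar.hasDet_comp {c : TSeries N} {x y : ExtLoop m n N} (h : EqScalar c x y)
    {s : (Idx m n → Loop N) → (Idx m n → Loop N)} (s_mem : ∀ v, s v ∈ vecSupp (Set.Iio 0))
    (right_inv : ∀ v ∈ vecSupp (Set.Iio 0), y.op (s v) = v) : HasDet (x.op ∘ s) c := by
  obtain ⟨-, r, r_det, x_eq⟩ := h
  refine r_det.congr fun v hv => ?_
  rw [Function.comp_apply, x_eq _ (isNeg_iff.mpr (s_mem v)), right_inv v hv]

/-- `τ` is the limit of the determinants of the finite sections of `d(a) d(a⁻¹)`. -/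
def IsTauDet (a : GL (Idx m n) (Loop N)) (τ : TSeries N) : Prop :=
  ∀ D : ℕ, ∀ᶠ K : ℕ in atTop, τ - (sec K (tauOp a)).det ∈ tIdeal _ ℂ D

theorem HasDet.isTauDet {a : GL (Idx m n) (Loop N)} {τ : TSeries N} (h : HasDet (tauOp a) τ) :
    IsTauDet a τ := by
  intro D
  have coeff_eventually_eq := (eventually_all_finite (l := atTop)
    (Finsupp.finite_of_degree_le (σ := Fin (N + 1)) D)).mpr fun d _ => h.2 d
  filter_upwards [coeff_eventually_eq] with K coeff_eq d hd
  rw [map_sub, sub_eq_zero, ← coeff_eq d (le_of_lt hd)]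
  rfl

theorem IsTauDet.constantCoeff_eq_one {a : GL (Idx m n) (Loop N)} {τ : TSeries N}
    (hτ : IsTauDet a τ) (ha : BoundedMod 1 (0 : ℕ) (a⁻¹).val) : constantCoeff τ = 1 := by
  obtain ⟨K, hK⟩ := (hτ 1).exists
  have map_section : (sec K (tauOp a)).map constantCoeff = 1 := by
    ext1 p q
    have entry := mem_tIdeal_one.mp (sec_tauOp_sub_one_mem ha p (Nat.zero_le q.1))
    rw [Matrix.sub_apply, map_sub, sub_eq_zero] at entry
    rw [Matrix.map_apply, entry, one_apply, one_apply, apply_ite constantCoeff, map_one, map_zero]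
  rw [mem_tIdeal_one, map_sub, sub_eq_zero] at hK
  rw [hK, RingHom.map_det, RingHom.mapMatrix_apply, map_section, det_one]

namespace IsFactorization

variable {f : GL (Idx m n) (LaurentSeries ℂ)} {M E : GL (Idx m n) (Loop N)} {τ : TSeries N}

theorem hasDet_tauOp (h : IsFactorization f M E)
    (hf : IsMinus (constTime f : GL (Idx m n) (Loop N)))
    (hτ : EqScalar τ (lift (vacuum m n N) * lift (constTime f⁻¹ : GL (Idx m n) (Loop N)).val)
      (lift (M⁻¹).val * lift E.val)) : HasDet (tauOp (M⁻¹ * E)) τ := by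
  have f_inv_mem : (constTime f⁻¹ : GL (Idx m n) (Loop N)).val ∈ unifSupp (Set.Iic 0) := by
    rw [map_inv]
    exact hf.inv_mem
  refine (hτ.hasDet_comp (s := fun v => compress (E⁻¹).val (compress M.val v))
    (fun _ => compress_mem _ _) fun v hv => ?_).congr fun v _ => ?_
  · change compress (M⁻¹).val (compress E.val (compress (E⁻¹).val (compress M.val v))) = v
    rw [compress_compress h.2.1.mem, Units.mul_inv, compress_one (compress_mem _ _),
      compress_eq_mulVec_of_mem h.1.mem hv, compress_mulVec, Units.inv_mul, compress_one hv]
  · change compress (vacuum m n N) (compress (constTime f⁻¹ : GL (Idx m n) (Loop N)).val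
      (compress (E⁻¹).val (compress M.val v))) = _
    rw [compress_eq_mulVec_of_mem f_inv_mem (compress_mem _ _), compress_mulVec, h.2.2,
      compress_compress h.2.1.inv_mem, tauOp_apply, _root_.mul_inv_rev, inv_inv, Units.val_mul,
      Units.val_mul]

theorem boundedMod_one (h : IsFactorization f M E)
    (hf : IsMinus (constTime f : GL (Idx m n) (Loop N))) :
    BoundedMod 1 (0 : ℕ) ((M⁻¹ * E)⁻¹).val := by
  have vacuum_eq : vacuum m n N = (M⁻¹ * E).val * (constTime f : GL (Idx m n) (Loop N)).val := by
    rw [Units.val_mul, ← h.2.2, map_inv, mul_assoc, Units.inv_mul, mul_one]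
  have difference : ((M⁻¹ * E)⁻¹).val - (constTime f : GL (Idx m n) (Loop N)).val =
      ((M⁻¹ * E)⁻¹).val * (1 - vacuum m n N) := by
    rw [vacuum_eq, mul_sub, ← mul_assoc, Units.inv_mul, mul_one, one_mul]
  refine ⟨_, hf.mem, fun a b => ?_⟩
  rw [difference, Matrix.mul_apply]
  refine sum_mem fun c _ => Ideal.mul_mem_left _ _ (mem_tIdeal_one.mpr ?_)
  rw [Matrix.sub_apply, map_sub, constantCoeff_vacuum, one_apply, one_apply,
    apply_ite constantCoeff, map_one, map_zero, sub_self]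

theorem pderiv_tau (h : IsFactorization f M E) (hτ : IsTauDet (M⁻¹ * E) τ) (j : Fin (N + 1)) :
    ∂ₛ j τ = τ * tauLog M (Jmat m n N ^ (2 * (j : ℕ) + 1)) := by
  rw [← sub_eq_zero]
  refine eq_zero_of_forall_mem_tIdeal fun D => ?_
  obtain ⟨P, hP⟩ := exists_boundedMod D ((M⁻¹ * E)⁻¹).val
  obtain ⟨K, det_close, hK⟩ :=
    ((hτ (D + 1)).and (eventually_ge_atTop (P + (2 * (j : ℕ) + 1)))).exists
  have det_derivative := h.pderiv_det_sec_sub_mem j hP hK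
  rw [h.1.trace_sec_shifted (unifSupp_mono (Set.Iic_subset_Iic.mpr (by omega))
    (Jmat_pow_mem_Iic _))] at det_derivative
  have derivative_close := pderiv_mem_tIdeal j det_close
  have product_close := Ideal.mul_mem_right (tauLog M (Jmat m n N ^ (2 * (j : ℕ) + 1))) _
    (tIdeal_antitone D.le_succ det_close)
  have total := sub_mem (add_mem derivative_close det_derivative) product_close
  rw [map_sub] at total
  convert total using 1
  ring

end IsFactorization

/-! ### Second logarithmic derivatives -/

section LogDeriv

variable {τ : TSeries N}

theorem logDeriv₂_eq_of_pderiv_eq_mul (hτ : constantCoeff τ ≠ 0) {j : Fin (N + 1)}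
    {L : TSeries N} (h : ∂ₛ j τ = τ * L) (i : Fin (N + 1)) : logDeriv₂ i j τ = ∂ₛ i L := by
  rw [logDeriv₂, h, ← mul_assoc, MvPowerSeries.inv_mul_cancel τ hτ, one_mul]

theorem logDeriv₂_comm (hτ : constantCoeff τ ≠ 0) (i j : Fin (N + 1)) :
    logDeriv₂ i j τ = logDeriv₂ j i τ := by
  have mul_quotient (a : TSeries N) : τ * (τ⁻¹ * a) = a := by
    rw [← mul_assoc, MvPowerSeries.mul_inv_cancel τ hτ, one_mul]
  have expand (i j : Fin (N + 1)) :
      τ * (τ * logDeriv₂ i j τ) = τ * ∂ₛ i (∂ₛ j τ) - ∂ₛ i τ * ∂ₛ j τ := by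
    have leibniz := congrArg (∂ₛ i) (mul_quotient (∂ₛ j τ))
    rw [Derivation.leibniz, smul_eq_mul, smul_eq_mul, ← logDeriv₂] at leibniz
    linear_combination τ * leibniz - ∂ₛ i τ * mul_quotient (∂ₛ j τ)
  have τ_ne_zero : τ ≠ 0 := fun e => hτ (by rw [e, map_zero])
  refine mul_left_cancel₀ τ_ne_zero (mul_left_cancel₀ τ_ne_zero ?_)
  rw [expand, expand, pderiv_comm i j, mul_comm (∂ₛ i τ)]

end LogDeriv

section ConjugationTrace

variable {A R ι : Type*} [CommSemiring A] [CommRing R] [Algebra A R] [Fintype ι] [DecidableEq ι]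

theorem trace_conj_mul_conj (g : GL ι R) (X Y : Matrix ι ι R) :
    (g.val * X * (g⁻¹).val * (g.val * Y * (g⁻¹).val)).trace = (X * Y).trace := by
  have product_conj : g.val * X * (g⁻¹).val * (g.val * Y * (g⁻¹).val) =
      g.val * (X * Y) * (g⁻¹).val := by
    calc _ = g.val * X * ((g⁻¹).val * g.val) * Y * (g⁻¹).val := by noncomm_ring
      _ = _ := by rw [Units.inv_mul]; noncomm_ring
  rw [product_conj, trace_units_conj]

theorem map_derivation_conj (D : Derivation A R R) (g : GL ι R) (X : Matrix ι ι R) :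
    (g.val * X * (g⁻¹).val).map D =
      g.val * (X.map D + ((g⁻¹).val * g.val.map D * X - X * ((g⁻¹).val * g.val.map D))) *
        (g⁻¹).val := by
  rw [map_derivation_mul, map_derivation_mul, map_derivation_inv]
  calc _ = g.val.map D * X * (g⁻¹).val + g.val * X.map D * (g⁻¹).val -
        g.val * X * ((g⁻¹).val * g.val.map D) * (g⁻¹).val := by noncomm_ring
    _ = (g.val * (g⁻¹).val) * g.val.map D * X * (g⁻¹).val + g.val * X.map D * (g⁻¹).val -
        g.val * X * ((g⁻¹).val * g.val.map D) * (g⁻¹).val := by rw [Units.mul_inv, one_mul]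
    _ = _ := by noncomm_ring

theorem trace_map_derivation_conj_mul_conj (D : Derivation A R R) (g : GL ι R)
    {X Y : Matrix ι ι R} (h : Commute X Y) :
    ((g.val * X * (g⁻¹).val).map D * (g.val * Y * (g⁻¹).val)).trace = (X.map D * Y).trace := by
  obtain ⟨Ω, hΩ⟩ : ∃ Ω, Ω = (g⁻¹).val * g.val.map D := ⟨_, rfl⟩
  have commutator_trace : ((Ω * X - X * Ω) * Y).trace = 0 := by
    rw [sub_mul, trace_sub, mul_assoc Ω, h.eq, mul_assoc X, trace_mul_comm X, mul_assoc Ω, sub_self]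
  rw [map_derivation_conj, trace_conj_mul_conj, ← hΩ, add_mul, trace_add, commutator_trace,
    add_zero]

end ConjugationTrace

theorem lamCoeff_trace_eq_zero {s : Set ℤ} {X : Matrix (Idx m n) (Idx m n) (Loop N)}
    (hX : X ∈ unifSupp s) {k : ℤ} (hk : k ∉ s) : lamCoeff k X.trace = 0 := by
  rw [Matrix.trace, lamCoeff_sum]
  exact Finset.sum_eq_zero fun a _ => hX a a k hk

theorem pairing_map_lamDer_conj (M : GL (Idx m n) (Loop N))
    {X Y : Matrix (Idx m n) (Idx m n) (Loop N)} (hXY : Commute X Y)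
    (hX : X ∈ unifSupp (Set.Ici 0)) (hY : Y ∈ unifSupp (Set.Ici 0)) :
    pairing (-1) ((M.val * X * (M⁻¹).val).map lamDer) (M.val * Y * (M⁻¹).val) = 0 := by
  have mem : X.map lamDer * Y ∈ unifSupp (Set.Ici 0) :=
    mul_mem_unifSupp Ici_add_Ici_subset (fun a b => lamDer_mem_Ici (hX a b)) hY
  rw [pairing, trace_map_derivation_conj_mul_conj lamDer M hXY]
  exact lamCoeff_trace_eq_zero mem (by rw [Set.mem_Ici]; omega)

theorem IsFactorization.pderiv_tauLog {f : GL (Idx m n) (LaurentSeries ℂ)}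
    {M E : GL (Idx m n) (Loop N)} (h : IsFactorization f M E) (i j : Fin (N + 1)) :
    ∂ₛ i (tauLog M (Jmat m n N ^ (2 * (j : ℕ) + 1))) =
      pairing (-1) (laxPow M j) (((laxPow M i).map plusPart).map lamDer) := by
  obtain ⟨J', hJ'⟩ : ∃ J', J' = Jmat m n N ^ (2 * (j : ℕ) + 1) := ⟨_, rfl⟩
  obtain ⟨B, hB⟩ : ∃ B, B = (laxPow M i).map minusPart := ⟨_, rfl⟩
  have map_M : M.val.map (∂ₜ i) = B * M.val := hB ▸ h.map_pderiv_minus i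
  have map_inverse : (M⁻¹).val.map (∂ₜ i) = -((M⁻¹).val * B) := by
    rw [map_derivation_inv, map_M, mul_assoc, mul_assoc, Units.mul_inv, mul_one]
  have map_MJ : (M.val * J').map (∂ₜ i) = B * (M.val * J') := by
    rw [map_derivation_mul, map_M, hJ', map_derivation_pow_eq_zero _ (map_pderiv_Jmat i), mul_zero,
      add_zero, mul_assoc]
  have exchange : ((M.val * J').map lamDer).map (∂ₜ i) = ((M.val * J').map (∂ₜ i)).map lamDer :=
    Matrix.ext fun _ _ => pderiv_lamDer _ _
  have map_product : ((M⁻¹).val * (M.val * J').map lamDer).map (∂ₜ i) =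
      (M⁻¹).val * (B.map lamDer * (M.val * J')) := by
    rw [map_derivation_mul, map_inverse, exchange, map_MJ, map_derivation_mul lamDer B]
    noncomm_ring
  have map_B : B.map lamDer = (laxPow M i).map lamDer - ((laxPow M i).map plusPart).map lamDer := by
    rw [← map_derivation_sub, hB, sub_eq_of_eq_add' (map_plusPart_add_map_minusPart _).symm]
  have total_derivative : pairing (-1) ((laxPow M i).map lamDer) (laxPow M j) = 0 :=
    pairing_map_lamDer_conj M ((Commute.refl _).pow_pow _ _) (Jmat_pow_mem_Ici _)
      (Jmat_pow_mem_Ici _)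
  have lax_eq : laxPow M j = M.val * J' * (M⁻¹).val := hJ' ▸ rfl
  rw [pairing] at total_derivative
  rw [← hJ', tauLog, pairing, map_neg, ← lamCoeff_pderiv, ← trace_map_derivation, map_product,
    trace_mul_comm, mul_assoc, ← lax_eq, map_B, sub_mul, trace_sub, lamCoeff_sub,
    total_derivative, zero_sub, neg_neg, pairing, trace_mul_comm]

theorem IsFactorization.logDeriv₂_tau {f : GL (Idx m n) (LaurentSeries ℂ)}
    {M E : GL (Idx m n) (Loop N)} (h : IsFactorization f M E) {τ : TSeries N}
    (hτ : IsTauDet (M⁻¹ * E) τ) (hτ₀ : constantCoeff τ ≠ 0) (i j : Fin (N + 1)) :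
    logDeriv₂ i j τ = pairing (-1) (laxPow M i) (((laxPow M j).map plusPart).map lamDer) := by
  rw [logDeriv₂_comm hτ₀, logDeriv₂_eq_of_pderiv_eq_mul hτ₀ (h.pderiv_tau hτ i), h.pderiv_tauLog]

/-! ### The tau structure in terms of `S` -/

theorem map_lamDer_map_constLoop (Z : Matrix (Idx m n) (Idx m n) (TSeries N)) :
    (Z.map constLoop).map lamDer = 0 :=
  Matrix.ext fun _ _ => lamDer_constLoop _

theorem map_lamDer_mul_mul (X : Matrix (Idx m n) (Idx m n) (Loop N))
    (Y Z : Matrix (Idx m n) (Idx m n) (TSeries N)) :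
    (Y.map constLoop * X * Z.map constLoop).map lamDer =
      Y.map constLoop * X.map lamDer * Z.map constLoop := by
  rw [map_derivation_mul, map_derivation_mul, map_lamDer_map_constLoop, map_lamDer_map_constLoop,
    zero_mul, zero_add, mul_zero, add_zero]

theorem pairing_dressed (g : GL (Idx m n) (TSeries N)) (M : GL (Idx m n) (Loop N))
    (i j : Fin (N + 1)) :
    pairing (-1) (dressed g M ^ (2 * (i : ℕ) + 1))
        (((dressed g M ^ (2 * (j : ℕ) + 1)).map plusPart).map lamDer) =
      pairing (-1) (laxPow M i) (((laxPow M j).map plusPart).map lamDer) := by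
  rw [dressed_pow, dressed_pow, map_plusPart_mul_mul, map_lamDer_mul_mul]
  exact congrArg (lamCoeff (-1)) (trace_conj_mul_conj (constGL g) _ _)

theorem lamDer_lamPow_one : lamDer (lamPow 1 : Loop N) = 1 := by
  refine ext_lamCoeff fun k => ?_
  rw [lamCoeff_lamDer, lamCoeff_lamPow, lamCoeff_one]
  rcases eq_or_ne k 0 with rfl | hk
  · simp
  · rw [if_neg (by omega), if_neg hk, smul_zero]

theorem map_lamDer_Jmat : (Jmat m n N).map lamDer = eMat m n (Loop N) := by
  have map_e : ((lamPow 1 : Loop N) • eMat m n (Loop N)).map lamDer = eMat m n (Loop N) := by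
    ext1 a b
    rw [Matrix.map_apply, Matrix.smul_apply, smul_eq_mul, eMat, single_apply]
    split_ifs
    · rw [mul_one, lamDer_lamPow_one]
    · rw [mul_zero, map_zero]
  rw [Jmat, map_derivation_add, map_e, ← map_constLoop_bMat, map_lamDer_map_constLoop, add_zero]

namespace SolutionData

variable {f : GL (Idx m n) (LaurentSeries ℂ)} {M E : GL (Idx m n) (Loop N)}
  {q u : Matrix (Idx m n) (Idx m n) (TSeries N)} {g : GL (Idx m n) (TSeries N)} {τ : TSeries N}

theorem flowMat_zero (h : SolutionData f M E q g u) :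
    flowMat g M 0 = Jmat m n N + u.map constLoop := by
  have agree : 0 - flowMat g M 0 * (constGL g * E).val =
      0 - (Jmat m n N + u.map constLoop) * (constGL g * E).val := by
    rw [← mul_zero (constGL g * E).val]
    exact (h.intertwines_wave_flowMat 0).symm.trans h.intertwines_wave
  exact (constGL g * E).isUnit.mul_right_cancel (sub_right_injective agree)

theorem map_lamDer_map_plusPart_dressed (h : SolutionData f M E q g u) :
    ((dressed g M).map plusPart).map lamDer = eMat m n (Loop N) := by
  have map_plusPart := h.flowMat_zero
  rw [flowMat, Fin.val_zero, mul_zero, zero_add, pow_one, sub_eq_iff_eq_add] at map_plusPart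
  rw [map_plusPart, map_derivation_add, map_derivation_add, map_lamDer_Jmat,
    map_lamDer_map_constLoop, map_lamDer_map_constLoop, add_zero, add_zero]

theorem logDeriv₂_tau (h : SolutionData f M E q g u) (hτ : IsTauDet (M⁻¹ * E) τ)
    (hτ₀ : constantCoeff τ ≠ 0) (i j : Fin (N + 1)) :
    logDeriv₂ i j τ = pairing (-1) (dressed g M ^ (2 * (i : ℕ) + 1))
      (((dressed g M ^ (2 * (j : ℕ) + 1)).map plusPart).map lamDer) := by
  rw [h.fact.logDeriv₂_tau hτ hτ₀, pairing_dressed]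

theorem logDeriv₂_tau_zero (h : SolutionData f M E q g u) (hτ : IsTauDet (M⁻¹ * E) τ)
    (hτ₀ : constantCoeff τ ≠ 0) (j : Fin (N + 1)) :
    logDeriv₂ 0 j τ = pairing (-1) (dressed g M ^ (2 * (j : ℕ) + 1)) (eMat m n (Loop N)) := by
  rw [logDeriv₂_comm hτ₀, h.logDeriv₂_tau hτ hτ₀, Fin.val_zero, mul_zero, zero_add, pow_one,
    h.map_lamDer_map_plusPart_dressed]

end SolutionData

end CKP

end

theorem mainTheorem9 (m n N : ℕ)
    (f : GL (CKP.Idx m n) (LaurentSeries ℂ))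
    (hf : CKP.IsMinus (CKP.constTime f : GL (CKP.Idx m n) (CKP.Loop N)))
    (τ : CKP.TSeries N) (hτ : CKP.IsTau f τ)
    (u : Matrix (CKP.Idx m n) (CKP.Idx m n) (CKP.TSeries N)) (hu : CKP.IsSolutionOf f u) :
    MvPowerSeries.constantCoeff τ = 1 ∧
    ∃ S : Matrix (CKP.Idx m n) (CKP.Idx m n) (CKP.Loop N),
      CKP.IsS u S ∧ (∀ S', CKP.IsS u S' → S' = S) ∧
      CKP.SolvesHierarchy u S ∧
      (∀ j : Fin (N + 1), CKP.logDeriv₂ 0 j τ =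
        CKP.pairing (-1) (S ^ (2 * (j : ℕ) + 1)) (CKP.eMat m n (CKP.Loop N))) ∧
      (∀ j k : Fin (N + 1), CKP.logDeriv₂ j k τ =
        CKP.pairing (-1) (S ^ (2 * (j : ℕ) + 1))
          (((S ^ (2 * (k : ℕ) + 1)).map CKP.plusPart).map CKP.lamDeriv)) := by
  obtain ⟨M, E, fact, tau_scalar⟩ := hτ
  obtain ⟨M', E', q, g, data⟩ := hu.exists_solutionData
  obtain ⟨rfl, rfl⟩ := fact.unique data.fact
  have tau_det : CKP.IsTauDet (M⁻¹ * E) τ := (fact.hasDet_tauOp hf tau_scalar).isTauDet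
  have tau_zero : MvPowerSeries.constantCoeff τ = 1 :=
    tau_det.constantCoeff_eq_one (fact.boundedMod_one hf)
  have tau_zero_ne : MvPowerSeries.constantCoeff τ ≠ 0 := tau_zero ▸ one_ne_zero
  exact ⟨tau_zero, CKP.dressed g M, data.isS_dressed, fun _ => data.eq_dressed,
    data.solvesHierarchy, data.logDeriv₂_tau_zero tau_det tau_zero_ne,
    data.logDeriv₂_tau tau_det tau_zero_ne⟩
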